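/- **Setting.** A network is a finite directed acyclic graph (parallel edges allowed) with unit-capacity edges, a source $S$ and $m$ destinations $D_1,\dots,D_m\neq S$. $M_{\mathcal A}$ is the min-cut capacity between $S$ and $\{D_i:i\in\mathcal A\}$, $\mathcal A\subseteq[m]$. The network is *separable* if there are pairwise disjoint edge sets $\mathcal E'_{\mathcal J}\subseteq\mathcal E$, $\emptyset\ne\mathcal J\subseteq[m]$, such that the subgraph $\mathcal G'_{\mathcal J}=(\mathcal V,\mathcal E'_{\mathcal J})$ has one and the same min-cut capacity $M'_{\mathcal J}$ from $S$ to every nonempty subset of $\{D_i:i\in\mathcal J\}$, min-cut capacity $0$ from $S$ to $\{D_i:i\notin\mathcal J\}$, and $M_{\mathcal A}=\sum_{\mathcal J\cap\mathcal A\ne\emptyset}M'_{\mathcal J}$ for all $\mathcal A\subseteq[m]$. Its *child* two-layer network has $M'_{\mathcal J}$ relays for each nonempty $\mathcal J$, an edge from $S$ to every relay, and an edge from every relay added for $\mathcal J$ to every $D_i$, $i\in\mathcal J$. Let $\mathcal M_i$ be the set of relays connected to $D_i$ and $\mathcal T$ the set of all relays. A *code* of length $n\ge1$ over a finite field $\mathbb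 F_q$ has independent messages $W_1,\dots,W_m$ and source randomness $\Theta$ independent of them; each edge $e$ carries $X_e\in\mathbb F_q^n$, a function of $(W_{[m]},\Theta)$ if $e$ leaves $S$ and of the symbols on the edges entering its tail otherwise. Its rates are $R_i=H(W_i)/n$ (entropy in base $q$). It is *decodable* if $H(W_i\mid X_e: e \text{ enters } D_i)=0$ for all $i$, and *secure* (against $k$ wiretapped edges) if $I(W_{[m]};X_{\mathcal Z})=0$ for every set $\mathcal Z$ of at most $k$ edges. The *secure capacity region* is the closure of the set of rate tuples of decodable and secure codes. A *linear scheme* $(M,V)$ over $\mathbb F_q$ on the child sends $X_r$ to the relay $r$, where $X=MW+VK$, $W$ consists of $R_i$ message packets for each $D_i$, $K$ of $\rho$ random packets, all packets are independent and uniform in $\mathbb F_q$, and relays forward what they receive. A *multicast code* is a linear network code that sends on each $\mathcal G'_{\mathcal J}$ the $M'_{\mathcal J}$ symbols $X_r$ of the relays $r$ added for $\mathcal J$, so that each $D_i$, $i\in\mathcal J$, can recover all of them linearly; its global encoding matrix is $G$, so that the edges carry $Y=GX$. A matrix with $k$ columns is *MDS* if any $k$ of its rows are linearly independent; similarly with $\rho$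 for $k$. **Theorem.** Let $\mathcal G$ be a separable network with a decomposition as above, and $k\ge0$. 1. The child network has the same min-cut capacities $M_{\mathcal A}$ as $\mathcal G$, for all $\mathcal A\subseteq[m]$. 2. There is $q_0$, depending only on the network, the decomposition and $k$, such that for every finite field $\mathbb K$ with $|\mathbb K|\ge q_0$: (a) a multicast code over $\mathbb K$ exists; (b) if a linear scheme over $\mathbb K$ is decodable on the child, then its composition with any multicast code over $\mathbb K$ is decodable on $\mathcal G$; (c) for every $|\mathcal E|\times|\mathcal T|$ matrix $G$ over $\mathbb K$ there is an MDS matrix $\tilde V\in\mathbb K^{\mathcal T\times k}$ with $\operatorname{rk}\big([\,GM\ \ G\tilde V\,]|_{\mathcal Z}\big)=\operatorname{rk}\big(G\tilde V|_{\mathcal Z}\big)$ for every matrix $M$ with rows indexed by $\mathcal T$ and every set $\mathcal Z$ of at most $k$ edges (rows); moreover, if $G$ is the global encoding matrix of a linear network code on $\mathcal G$, sending $G(MW+\tilde VK)$ is secure, for every $M$; (d) for every finite field $\mathbb F$ of which $\mathbb K$ is an extension and every linear scheme $(M,V)$ over $\mathbb F$ with $R_i$ packets for $D_i$ that is decodable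 and secure on the child: there is a multicast code over $\mathbb K$ whose composition with $(M,V)$, taken over $\mathbb K$, is decodable and secure on $\mathcal G$, with rates $R_i$; and for every multicast code over $\mathbb K$ there is a linear scheme $(\tilde M,\tilde V)$ over $\mathbb K$ with the same numbers of message and random packets, with $\tilde V$ MDS if $V$ is, that is decodable and secure on the child and whose composition with the multicast code is decodable and secure on $\mathcal G$, with rates $R_i$. 3. Suppose that $M_{\{i\}}\ge k$ for all $i\in[m]$. In each of the following cases the secure capacity region of $\mathcal G$ equals that of its child and is the set of all $R\in\mathbb R_{\ge0}^m$ that satisfy the stated inequalities for all nonempty $\mathcal A\subseteq[m]$: - $k=1$: $\sum_{i\in\mathcal A}R_i\le M_{\mathcal A}-C_{\mathcal A}$, where $C_{\mathcal A}$ is the number of connected components of the graph on $\mathcal A$ in which $i\ne j$ are adjacent iff $\mathcal M_i\cap\mathcal M_j\neq\emptyset$; - $m=3$: $\sum_{i\in\mathcal A}R_i\le M_{\mathcal A}-k$; - $|\mathcal M_i\cap\mathcal M_j|\ge k$ for all $i\ne j$: $\sum_{i\in\mathcal A}R_i\le M_{\mathcal A}-k$. -/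

import Mathlib

open MeasureTheory

noncomputable section

/-! ### Networks with unit-capacity edges and min-cuts -/

/-- A directed acyclic (multi)graph with nodes `V` and unit-capacity edges `E`, one source and `m`
destinations. -/
structure Network (V E : Type*) (m : ℕ) where
  tail : E → V
  head : E → V
  source : V
  dest : Fin m → V
  dest_ne_source : ∀ i, dest i ≠ source
  acyclic : ∀ v, ¬ Relation.TransGen (fun u w => ∃ e, tail e = u ∧ head e = w) v v

namespace Network

variable {V E : Type*} {m : ℕ}

/-- There is a directed path from `u` to `v` that only uses edges of `H`. -/
def Reach (N : Network V E m) (H : Set E) (u v : V) : Prop :=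
  Relation.ReflTransGen (fun a b => ∃ e ∈ H, N.tail e = a ∧ N.head e = b) u v

/-- Removing the edges `C` from the subgraph `(V, H)` disconnects the source from every destination
with index in `A`. -/
def IsCut (N : Network V E m) (H : Set E) (A : Finset (Fin m)) (C : Finset E) : Prop :=
  ∀ i ∈ A, ¬ N.Reach (H \ (C : Set E)) N.source (N.dest i)

/-- The min-cut capacity between the source and `{D_i : i ∈ A}` in the subgraph `(V, H)`. -/
def minCut (N : Network V E m) (H : Set E) (A : Finset (Fin m)) : ℕ :=
  sInf {c | ∃ C : Finset E, N.IsCut H A C ∧ C.card = c}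

/-- `M_A`: the min-cut capacity between the source and `{D_i : i ∈ A}` in the whole network. -/
def cutCap (N : Network V E m) (A : Finset (Fin m)) : ℕ := N.minCut Set.univ A

open scoped Classical in
/-- The edges entering the node `v`. -/
def incoming [Fintype E] (N : Network V E m) (v : V) : Finset E :=
  Finset.univ.filter fun e => N.head e = v

/-- A decomposition of the network; the network is separable if it has one: edge disjoint subgraphs
`(V, part J)`, one for each nonempty `J ⊆ [m]`; the min-cut capacity of `(V, part J)` is the same
number towards every nonempty subset of `J`, and is zero towards the complement of `J`; the
min-cut capacities of the network are sums of those of the subgraphs. -/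
structure Separation (N : Network V E m) where
  part : Finset (Fin m) → Set E
  disjoint : ∀ J L : Finset (Fin m), J.Nonempty → L.Nonempty → J ≠ L → Disjoint (part J) (part L)
  cut_inside : ∀ J B : Finset (Fin m), B ⊆ J → B.Nonempty →
    N.minCut (part J) B = N.minCut (part J) J
  cut_outside : ∀ J : Finset (Fin m), J.Nonempty → N.minCut (part J) Jᶜ = 0
  cut_sum : ∀ A : Finset (Fin m),
    N.cutCap A = ∑ J ∈ Finset.univ.filter (fun J : Finset (Fin m) => (J ∩ A).Nonempty),
      N.minCut (part J) J

end Network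

/-! ### Two-layer networks -/

/-- Nodes of a two-layer network with relays `T`. -/
inductive TwoLayerNode (T : Type) (m : ℕ) : Type
  | source : TwoLayerNode T m
  | relay (r : T) : TwoLayerNode T m
  | dest (i : Fin m) : TwoLayerNode T m

/-- Edges of a two-layer network: one from the source to each relay, and one from each relay in
`conn i` to the destination `i`. -/
inductive TwoLayerEdge (T : Type) {m : ℕ} (conn : Fin m → Finset T) : Type
  | first (r : T) : TwoLayerEdge T conn
  | second (i : Fin m) (r : T) (h : r ∈ conn i) : TwoLayerEdge T conn

namespace TwoLayerEdge

variable {T : Type} {m : ℕ} {conn : Fin m → Finset T}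

def tail : TwoLayerEdge T conn → TwoLayerNode T m
  | first _ => .source
  | second _ r _ => .relay r

def head : TwoLayerEdge T conn → TwoLayerNode T m
  | first r => .relay r
  | second i _ _ => .dest i

/-- The relay that sends or receives on the edge. -/
def relay : TwoLayerEdge T conn → T
  | first r => r
  | second _ r _ => r

theorem finite [Finite T] : Finite (TwoLayerEdge T conn) := by
  let f : TwoLayerEdge T conn → T ⊕ (Fin m × T) := fun e => match e with
    | first r => .inl r
    | second i r _ => .inr (i, r)
  refine Finite.of_injective f ?_
  rintro (r | ⟨i, r, h⟩) (r' | ⟨i', r', h'⟩) hf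
  · simpa [f] using hf
  · simp [f] at hf
  · simp [f] at hf
  · simp only [f, Sum.inr.injEq, Prod.mk.injEq] at hf
    obtain ⟨rfl, rfl⟩ := hf
    rfl

instance [Finite T] : Fintype (TwoLayerEdge T conn) :=
  @Fintype.ofFinite _ finite

end TwoLayerEdge

/-- The layer of a node. -/
def TwoLayerNode.layer {T : Type} {m : ℕ} : TwoLayerNode T m → ℕ
  | .source => 0
  | .relay _ => 1
  | .dest _ => 2

/-- The two-layer network with relays `T` in which the destination `i` is connected to the relays
in `conn i`. -/
def twoLayer (T : Type) {m : ℕ} (conn : Fin m → Finset T) :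
    Network (TwoLayerNode T m) (TwoLayerEdge T conn) m where
  tail := TwoLayerEdge.tail
  head := TwoLayerEdge.head
  source := .source
  dest := .dest
  dest_ne_source := by intro i h; cases h
  acyclic := by
    have key : ∀ u w : TwoLayerNode T m,
        Relation.TransGen (fun u w => ∃ e : TwoLayerEdge T conn, e.tail = u ∧ e.head = w) u w →
          u.layer < w.layer := by
      intro u w h
      have step : ∀ a b : TwoLayerNode T m,
          (∃ e : TwoLayerEdge T conn, e.tail = a ∧ e.head = b) → a.layer < b.layer := by
        rintro a b ⟨e, rfl, rfl⟩
        cases e <;> simp [TwoLayerEdge.tail, TwoLayerEdge.head, TwoLayerNode.layer]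
      induction h with
      | single h => exact step _ _ h
      | tail _ h ih => exact ih.trans (step _ _ h)
    intro v h
    exact lt_irrefl _ (key v v h)

/-- The graph on `A` in which distinct `i`, `j` are adjacent when they share a relay. -/
def overlapGraph {T : Type} {m : ℕ} (conn : Fin m → Finset T) (A : Finset (Fin m)) :
    SimpleGraph A where
  Adj i j := i ≠ j ∧ ∃ r, r ∈ conn i ∧ r ∈ conn j
  symm := ⟨fun _ _ h => ⟨h.1.symm, h.2.imp fun _ hr => hr.symm⟩⟩
  loopless := ⟨fun _ h => h.1 rfl⟩

/-- `C_A`: the number of connected components of the overlap graph on `A`. -/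
def numComponents {T : Type} {m : ℕ} (conn : Fin m → Finset T) (A : Finset (Fin m)) : ℕ :=
  Nat.card (overlapGraph conn A).ConnectedComponent

namespace Network.Separation

variable {V E : Type*} {m : ℕ} {N : Network V E m}

/-- `M'_J`: the min-cut capacity of the subgraph `(V, part J)`. -/
def cap (sep : N.Separation) (J : Finset (Fin m)) : ℕ := N.minCut (sep.part J) J

/-- The relays of the child network: `M'_J` of them for every nonempty `J ⊆ [m]`. -/
abbrev ChildRelay (sep : N.Separation) : Type :=
  Σ J : {J : Finset (Fin m) // J.Nonempty}, Fin (sep.cap J.1)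

/-- The destination `i` of the child network is connected to the relays added for `J ∋ i`. -/
def childConn (sep : N.Separation) (i : Fin m) : Finset sep.ChildRelay :=
  Finset.univ.filter fun r => i ∈ r.1.1

/-- The child two-layer network. -/
def child (sep : N.Separation) :
    Network (TwoLayerNode sep.ChildRelay m) (TwoLayerEdge sep.ChildRelay sep.childConn) m :=
  twoLayer sep.ChildRelay sep.childConn

end Network.Separation

/-! ### Entropy of random variables with finitely many values (in nats) -/

section Entropy

variable {Ω α β : Type*} [MeasurableSpace Ω] [Fintype α] [Fintype β]

/-- `H(X)` -/
def entropy (μ : Measure Ω) (X : Ω → α) : ℝ := ∑ a, Real.negMulLog (μ.real (X ⁻¹' {a}))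

/-- `H(X | Y) = H(X, Y) - H(Y)` -/
def condEntropy (μ : Measure Ω) (X : Ω → α) (Y : Ω → β) : ℝ :=
  entropy μ (fun ω => (X ω, Y ω)) - entropy μ Y

/-- `I(X ; Y) = H(X) + H(Y) - H(X, Y)` -/
def mutualInfo (μ : Measure Ω) (X : Ω → α) (Y : Ω → β) : ℝ :=
  entropy μ X + entropy μ Y - entropy μ (fun ω => (X ω, Y ω))

end Entropy

/-! ### Block codes, security and the secure capacity region -/

/-- A block code of length `n` over the finite field `F`. The sample space is the product of the
message alphabets and of the space of the randomness of the source, with the product measure: the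
messages and the source randomness are independent. Edges leaving the source carry functions of
the messages and of the source randomness; any other edge carries a function of what the edges
entering its tail carry. -/
structure Code {V E : Type*} {m : ℕ} (N : Network V E m) where
  n : ℕ
  n_pos : 0 < n
  F : Type
  [field : Field F]
  [fintypeF : Fintype F]
  Msg : Fin m → Type
  [fintypeMsg : ∀ i, Fintype (Msg i)]
  [measMsg : ∀ i, MeasurableSpace (Msg i)]
  [discMsg : ∀ i, DiscreteMeasurableSpace (Msg i)]
  Rnd : Type
  [measRnd : MeasurableSpace Rnd]
  msgLaw : ∀ i, Measure (Msg i)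
  [probMsg : ∀ i, IsProbabilityMeasure (msgLaw i)]
  rndLaw : Measure Rnd
  [probRnd : IsProbabilityMeasure rndLaw]
  sym : E → (∀ i, Msg i) × Rnd → (Fin n → F)
  sym_meas : ∀ e x, MeasurableSet (sym e ⁻¹' {x})
  sym_relay : ∀ e, N.tail e ≠ N.source →
    ∃ f : ({l : E // N.head l = N.tail e} → (Fin n → F)) → (Fin n → F),
      ∀ ω, sym e ω = f fun l => sym l.1 ω

attribute [instance] Code.field Code.fintypeF Code.fintypeMsg Code.measMsg Code.discMsg
  Code.measRnd Code.probMsg Code.probRnd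

namespace Code

variable {V E : Type*} {m : ℕ} {N : Network V E m}

/-- The law of the messages and of the source randomness. -/
def law (c : Code N) : Measure ((∀ i, c.Msg i) × c.Rnd) := (Measure.pi c.msgLaw).prod c.rndLaw

/-- The symbols on the edges in `Z`. -/
def symOn (c : Code N) (Z : Finset E) (ω : (∀ i, c.Msg i) × c.Rnd) : Z → Fin c.n → c.F :=
  fun e => c.sym e.1 ω

/-- `R_i = H(W_i) / n`, where the entropy is measured in symbols of `F`. -/
def rate (c : Code N) (i : Fin m) : ℝ :=
  entropy c.law (fun ω => ω.1 i) / (c.n * Real.log (Fintype.card c.F))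

open scoped Classical in
/-- Zero-error decoding: `H(W_i | symbols on the edges entering D_i) = 0` for every `i`. -/
def Decodable [Fintype E] (c : Code N) : Prop :=
  ∀ i, condEntropy c.law (fun ω => ω.1 i) (c.symOn (N.incoming (N.dest i))) = 0

open scoped Classical in
/-- Perfect secrecy: the symbols on any at most `k` edges carry no information about the
messages. -/
def Secure (c : Code N) (k : ℕ) : Prop :=
  ∀ Z : Finset E, Z.card ≤ k → mutualInfo c.law (fun ω => ω.1) (c.symOn Z) = 0

end Code

/-- The secure capacity region against an eavesdropper on any `k` edges. -/
def secureCapacityRegion {V E : Type*} [Fintype E] {m : ℕ} (N : Network V E m) (k : ℕ) :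
    Set (Fin m → ℝ) :=
  closure {R | ∃ c : Code N, c.Decodable ∧ c.Secure k ∧ ∀ i, c.rate i = R i}

/-- The rate region `R ≥ 0`, `∑_{i ∈ A} R_i ≤ b A` for all nonempty `A ⊆ [m]`. -/
def rateRegion {m : ℕ} (b : Finset (Fin m) → ℝ) : Set (Fin m → ℝ) :=
  {R | (∀ i, 0 ≤ R i) ∧ ∀ A : Finset (Fin m), A.Nonempty → ∑ i ∈ A, R i ≤ b A}

/-! ### Linear schemes -/

/-- A linear scheme with `R i` message packets for the destination `i` and `ρ` random packets: the
symbols indexed by `T` are `X = M W + V K`. -/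
structure LinearScheme (F : Type) (T : Type) {m : ℕ} (R : Fin m → ℕ) (ρ : ℕ) where
  M : Matrix T (Σ i, Fin (R i)) F
  V : Matrix T (Fin ρ) F

/-- Any `ρ` rows of `V` are linearly independent. -/
def IsMDS {F T : Type} [Field F] {ρ : ℕ} (V : Matrix T (Fin ρ) F) : Prop :=
  ∀ I : Finset T, I.card = ρ → LinearIndependent F fun r : I => V r.1

namespace LinearScheme

variable {F T : Type} {m : ℕ} {R : Fin m → ℕ} {ρ : ℕ}

/-- The same scheme over an extension field. -/
def baseChange (K : Type) [Field F] [Field K] [Algebra F K] (s : LinearScheme F T R ρ) :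
    LinearScheme K T R ρ where
  M := s.M.map (algebraMap F K)
  V := s.V.map (algebraMap F K)

/-- The vector `X = M W + V K`. -/
def symbols [Field F] (s : LinearScheme F T R ρ) (W : ∀ i, Fin (R i) → F) (K : Fin ρ → F) :
    T → F :=
  s.M.mulVec (fun p => W p.1 p.2) + s.V.mulVec K

end LinearScheme

/-- `G` can be the global encoding matrix of a linear network code: the row of an edge that does
not leave the source is a linear combination of the rows of the edges entering its tail. -/
def Network.Realizable {V E : Type*} {m : ℕ} (N : Network V E m) {K T : Type} [Field K]
    (G : Matrix E T K) : Prop :=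
  ∀ e, N.tail e ≠ N.source → G e ∈ Submodule.span K (G '' {l | N.head l = N.tail e})

theorem dotProduct_factors {E K T ι : Type*} [Field K] [Fintype T] {G : Matrix E T K}
    {S : Set E} {g : T → K} (hg : g ∈ Submodule.span K (G '' S)) (X : ι → T → K) :
    ∃ f : (S → K) → K, ∀ ω, g ⬝ᵥ X ω = f fun l => G l.1 ⬝ᵥ X ω := by
  induction hg using Submodule.span_induction with
  | mem x hx =>
    obtain ⟨l, hl, rfl⟩ := hx
    exact ⟨fun y => y ⟨l, hl⟩, fun ω => rfl⟩
  | zero => exact ⟨fun _ => 0, fun ω => by simp⟩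
  | add x y _ _ hx hy =>
    obtain ⟨f, hf⟩ := hx
    obtain ⟨g, hg⟩ := hy
    exact ⟨fun z => f z + g z, fun ω => by rw [add_dotProduct, hf, hg]⟩
  | smul a x _ hx =>
    obtain ⟨f, hf⟩ := hx
    exact ⟨fun z => a * f z, fun ω => by rw [smul_dotProduct, hf, smul_eq_mul]⟩

/-- The code of block length one in which the edge `e` carries `(G X)_e` with `X = M W + V K`; the
message packets `W` and the random packets `K` are uniform. -/
def linearCode {V E : Type*} {m : ℕ} (N : Network V E m) {F T : Type} [Field F] [Fintype F]
    [Fintype T] {R : Fin m → ℕ} {ρ : ℕ} (G : Matrix E T F) (hG : N.Realizable G)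
    (s : LinearScheme F T R ρ) : Code N where
  n := 1
  n_pos := one_pos
  F := F
  Msg i := Fin (R i) → F
  measMsg _ := ⊤
  discMsg _ := @DiscreteMeasurableSpace.mk _ ⊤ fun _ => trivial
  Rnd := Fin ρ → F
  measRnd := ⊤
  msgLaw _ := @PMF.toMeasure _ ⊤ (PMF.uniformOfFintype _)
  probMsg _ := @PMF.toMeasure.isProbabilityMeasure _ ⊤ _
  rndLaw := @PMF.toMeasure _ ⊤ (PMF.uniformOfFintype _)
  probRnd := @PMF.toMeasure.isProbabilityMeasure _ ⊤ _
  sym e ω := fun _ => G e ⬝ᵥ s.symbols ω.1 ω.2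
  sym_meas e x := by
    let _ : ∀ i, MeasurableSpace (Fin (R i) → F) := fun _ => ⊤
    have : ∀ i, DiscreteMeasurableSpace (Fin (R i) → F) := fun _ => ⟨fun _ => trivial⟩
    let _ : MeasurableSpace (Fin ρ → F) := ⊤
    have : DiscreteMeasurableSpace (Fin ρ → F) := ⟨fun _ => trivial⟩
    exact (Set.toFinite _).measurableSet
  sym_relay e he := by
    obtain ⟨f, hf⟩ := dotProduct_factors (hG e he)
      (fun ω : (∀ i, Fin (R i) → F) × (Fin ρ → F) => s.symbols ω.1 ω.2)
    exact ⟨fun y _ => f fun l => y l 0, fun ω => funext fun _ => hf ω⟩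

open scoped Classical in
/-- In a two-layer network every relay forwards the symbol that it receives. -/
def forwarding (F : Type) [Field F] {T : Type} {m : ℕ} (conn : Fin m → Finset T) :
    Matrix (TwoLayerEdge T conn) T F :=
  fun e => Pi.single e.relay 1

theorem forwarding_realizable (F : Type) [Field F] {T : Type} {m : ℕ} (conn : Fin m → Finset T) :
    (twoLayer T conn).Realizable (forwarding F conn) := by
  intro e he
  cases e with
  | first r => exact absurd rfl he
  | second i r h =>
    exact Submodule.subset_span ⟨TwoLayerEdge.first r, rfl, rfl⟩

namespace Network.Separation

variable {V E : Type*} {m : ℕ} {N : Network V E m}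

/-- A linear scheme on the child network: the relay `r` receives `X_r` and forwards it. -/
def childCode (sep : N.Separation) {F : Type} [Field F] [Fintype F] {R : Fin m → ℕ} {ρ : ℕ}
    (s : LinearScheme F sep.ChildRelay R ρ) : Code sep.child :=
  linearCode sep.child (forwarding F sep.childConn) (forwarding_realizable F sep.childConn) s

open scoped Classical in
/-- Linear multicasting over all the subgraphs `(V, part J)`, with global encoding matrix `G`: over
the subgraph of `J` the source multicasts the `M'_J` symbols of the child relays added for `J` to
all the destinations in `J`, using no edge and no symbol outside this subgraph. -/
structure Multicast (sep : N.Separation) (K : Type) [Field K] where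
  G : Matrix E sep.ChildRelay K
  support : ∀ e r, e ∉ sep.part r.1.1 → G e r = 0
  relay : ∀ J : Finset (Fin m), J.Nonempty → ∀ e ∈ sep.part J, N.tail e ≠ N.source →
    G e ∈ Submodule.span K (G '' {l | l ∈ sep.part J ∧ N.head l = N.tail e})
  receive : ∀ r : sep.ChildRelay, ∀ i ∈ r.1.1,
    (Pi.single r 1 : sep.ChildRelay → K) ∈
      Submodule.span K (G '' {l | l ∈ sep.part r.1.1 ∧ N.head l = N.dest i})

theorem Multicast.realizable {sep : N.Separation} {K : Type} [Field K] (g : sep.Multicast K) :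
    N.Realizable g.G := by
  intro e he
  by_cases h : ∃ J : Finset (Fin m), J.Nonempty ∧ e ∈ sep.part J
  · obtain ⟨J, hJ, heJ⟩ := h
    exact Submodule.span_mono (Set.image_mono fun l hl => hl.2) (g.relay J hJ e heJ he)
  · have : g.G e = 0 := by
      funext r
      exact g.support e r fun hr => h ⟨r.1.1, r.1.2, hr⟩
    rw [this]
    exact Submodule.zero_mem _

/-- The scheme on the parent network obtained by multicasting the symbols of a linear scheme for
the child network. -/
def Multicast.code {sep : N.Separation} {K : Type} [Field K] [Fintype K] (g : sep.Multicast K)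
    {R : Fin m → ℕ} {ρ : ℕ} (s : LinearScheme K sep.ChildRelay R ρ) : Code N :=
  linearCode N g.G g.realizable s

end Network.Separation

end

/-! The three capacity cases are one statement: whenever `k ≤ M_{i}` for all `i`, the secure region
of a separable network is given by `∑_{i ∈ A} R_i ≤ M_A - k` (`secureCapacityRegion_eq`). The child
is itself separable with the same cut values, so it has the same region. For `k = 1` the bounds with
`C_A` describe the same set: distinct components of the overlap graph use disjoint sets of relays,
so adding the bounds `M - 1` over the components of `A` already gives `M_A - C_A`.

Outer bound (`Code.sum_entropy_le_of_isCut`): the wiretapper reads `k` edges of a minimum cut. They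
reveal nothing about the messages, while the whole cut determines `W_A`, so at most `M_A - k`
symbols are left to carry `W_A`.

Secure schemes on the child (`exists_secure_scheme`): take a matrix `D` whose rows for `D_i` are
supported on the relays of `D_i` and in which any `|T| - k` columns are invertible; Hall's theorem
and a generic choice provide it. Send a uniformly random `X` with `D X = (W, 0)`. Each destination
reads its packets off its own rows, and any `k` coordinates of `X` can be matched by an element of
`ker D`.

From the child to the parent (`exists_generic_block_matrix`): a wiretapper on the parent sees
combinations of up to `k` rows of `G` instead of `k` coordinates of `X`. Each row of a multicast
matrix lives in a single block `J`. A generic invertible matrix `A`, block diagonal for these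
blocks, makes every set of at most `k` rows as harmless as `k` coordinates, and the block shape
preserves decoding. Absorbing `A` into the multicast code or into the scheme gives the two halves of
the conversion statement; one block and a Vandermonde matrix give the MDS statement.

Every generic choice is a union bound over finitely many subspaces, so only the field size matters.
Real rates are reached by rounding down on the network with `L` copies of each edge. -/

/-! ### Avoiding finitely many subspaces over a large finite field -/

/-- If `u₀ ∈ U` lies outside `W i`, each line in direction `u₀` meets the translate `W i - c i` at
most once. Hence the bad `u` form at most a `1/|K|` fraction of `U`, and fewer than `|K|` such sets
cannot cover `U`. -/
theorem Submodule.exists_mem_forall_add_notMem {K M ι : Type*} [Field K] [Fintype K]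
    [AddCommGroup M] [Module K M] [Finite M] [Fintype ι] (U : Submodule K M)
    (W : ι → Submodule K M) (c : ι → M) (hc : Fintype.card ι < Fintype.card K) :
    ∃ u ∈ U, ∀ i, ¬ U ≤ W i → u + c i ∉ W i := by
  classical
  have := Fintype.ofFinite M
  by_contra! hcon
  let B : ι → Finset M := fun i => Finset.univ.filter fun u => u ∈ U ∧ ¬ U ≤ W i ∧ u + c i ∈ W i
  let U' : Finset M := Finset.univ.filter fun u => u ∈ U
  have hB : ∀ i, (B i).card * Fintype.card K ≤ U'.card := by
    intro i
    by_cases hi : U ≤ W i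
    · simp [B, hi]
    obtain ⟨u₀, hu₀, hu₀'⟩ := Set.not_subset.1 hi
    rw [← Finset.card_univ (α := K), ← Finset.card_product]
    refine Finset.card_le_card_of_injOn (fun x => x.1 + x.2 • u₀) ?_ ?_
    · rintro ⟨b, t⟩ h
      simp only [B, Finset.coe_product, Finset.coe_filter, Finset.mem_univ, true_and,
        Set.mem_prod, Set.mem_ofPred_eq] at h
      simpa [U'] using U.add_mem h.1.1 (U.smul_mem t hu₀)
    · rintro ⟨b, t⟩ h ⟨b', t'⟩ h' heq
      simp only [B, Finset.coe_product, Finset.coe_filter, Finset.mem_univ, true_and,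
        Set.mem_prod, Set.mem_ofPred_eq] at h h' heq
      have h1 : (t' - t) • u₀ ∈ W i := by
        have : (t' - t) • u₀ = (b + c i) - (b' + c i) := by
          rw [sub_smul, add_sub_add_right_eq_sub, sub_eq_sub_iff_add_eq_add, add_comm, ← heq,
            add_comm]
        rw [this]
        exact (W i).sub_mem h.1.2.2 h'.1.2.2
      have ht : t' - t = 0 := by
        by_contra hne
        exact hu₀' (((W i).smul_mem_iff hne).1 h1)
      obtain rfl : t' = t := sub_eq_zero.1 ht
      simpa using heq
  have hU : U'.card ≤ ∑ i, (B i).card := by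
    refine (Finset.card_le_card (t := Finset.univ.biUnion B) ?_).trans Finset.card_biUnion_le
    intro u hu
    obtain ⟨i, hi, hi'⟩ := hcon u (by simpa [U'] using hu)
    simp only [Finset.mem_biUnion, Finset.mem_univ, true_and, B, Finset.mem_filter]
    exact ⟨i, by simpa [U'] using hu, hi, hi'⟩
  have hpos : 0 < U'.card := Finset.card_pos.2 ⟨0, by simp [U']⟩
  have : U'.card * Fintype.card K ≤ Fintype.card ι * U'.card := by
    calc U'.card * Fintype.card K ≤ (∑ i, (B i).card) * Fintype.card K := by gcongr
      _ = ∑ i, (B i).card * Fintype.card K := Finset.sum_mul _ _ _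
      _ ≤ ∑ _i : ι, U'.card := Finset.sum_le_sum fun i _ => hB i
      _ = _ := by simp
  rw [mul_comm] at this
  exact absurd (Nat.le_of_mul_le_mul_right this hpos) (not_le.2 hc)

theorem LinearIndependent.update_of_notMem {K M ι : Type*} [Field K] [AddCommGroup M] [Module K M]
    [DecidableEq ι] {v : ι → M} (hv : LinearIndependent K v) {i : ι} {u : M}
    (hu : u ∉ Submodule.span K (v '' {i}ᶜ)) : LinearIndependent K (Function.update v i u) := by
  have hEq : Set.EqOn v (Function.update v i u) {i}ᶜ := fun j hj =>
    (Function.update_of_ne hj u v).symm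
  have h1 : LinearIndepOn K (Function.update v i u) {i}ᶜ :=
    (linearIndepOn_congr hEq).1 (hv.linearIndepOn _)
  have h2 : LinearIndepOn K (Function.update v i u) (insert i {i}ᶜ) := by
    refine h1.insert ?_
    simpa [← Set.image_congr hEq] using hu
  exact linearIndepOn_univ_iff.1 (h2.mono fun j _ => by simp [em])

/-- The vectors that vanish outside `S`. -/
def supportedOn (K : Type*) {T : Type*} [Field K] (S : Set T) : Submodule K (T → K) where
  carrier := {b | ∀ r ∉ S, b r = 0}
  add_mem' ha hb r hr := by simp [ha r hr, hb r hr]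
  zero_mem' _ _ := rfl
  smul_mem' a b hb r hr := by simp [hb r hr]

theorem mem_supportedOn {K T : Type*} [Field K] {S : Set T} {b : T → K} :
    b ∈ supportedOn K S ↔ ∀ r ∉ S, b r = 0 := Iff.rfl

theorem single_mem_supportedOn {K T : Type*} [Field K] [DecidableEq T] {S : Set T} {s : T}
    (hs : s ∈ S) (a : K) : Pi.single s a ∈ supportedOn K S := by
  intro r hr
  have h : r ≠ s := fun h => hr (by rwa [h])
  simp [h]

theorem supportedOn_le_of_single_mem {K T : Type*} [Field K] [Fintype T] [DecidableEq T]
    {S : Set T} {W : Submodule K (T → K)} (h : ∀ s ∈ S, Pi.single s (1 : K) ∈ W) :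
    supportedOn K S ≤ W := by
  intro b hb
  rw [pi_eq_sum_univ' b]
  refine W.sum_mem fun s _ => ?_
  by_cases hs : s ∈ S
  · refine W.smul_mem _ ?_
    convert h s hs using 1
  · rw [hb s hs, zero_smul]
    exact W.zero_mem

/-! ### Generic block diagonal matrices -/

section Generic

open Matrix

theorem vecMul_updateRow {K T : Type*} [Field K] [Fintype T] [DecidableEq T] (A : Matrix T T K) (b : T → K) (r : T) (u : T → K) :
    b ᵥ* A.updateRow r u = b ᵥ* A + b r • (u - A r) := by
  have h : ∀ B : Matrix T T K, b ᵥ* B = b r • B r + ∑ s ∈ Finset.univ.erase r, b s • B s := by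
    intro B
    rw [Finset.add_sum_erase _ (fun s => b s • B s) (Finset.mem_univ r)]
    exact Matrix.vecMul_eq_sum b B
  rw [h, h A, Finset.sum_congr rfl fun s hs => by
    rw [show A.updateRow r u s = A s from updateRow_ne (Finset.ne_of_mem_erase hs)]]
  rw [show A.updateRow r u r = u from updateRow_self]
  rw [smul_sub]
  abel

/-- Every generator lives in one block, so dropping the generators of other blocks from a
combination projects it to block `j` without leaving the span. -/
theorem restrict_mem_span {K T ι Ξ : Type*} [Field K] (τ : T → ι) (g : Ξ → T → K)
    (hg : ∀ z, ∃ j, g z ∈ supportedOn K {r | τ r = j}) (Z : Set Ξ) (j : ι) {b : T → K}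
    (hb : b ∈ Submodule.span K (g '' Z)) :
    ∃ b' ∈ Submodule.span K (g '' Z), b' ∈ supportedOn K {r | τ r = j} ∧
      ∀ r, τ r = j → b' r = b r := by
  induction hb using Submodule.span_induction with
  | mem x hx =>
    obtain ⟨z, hz, rfl⟩ := hx
    obtain ⟨j', hj'⟩ := hg z
    by_cases h : j' = j
    · subst h
      exact ⟨g z, Submodule.subset_span ⟨z, hz, rfl⟩, hj', fun _ _ => rfl⟩
    · refine ⟨0, Submodule.zero_mem _, Submodule.zero_mem _, fun r hr => ?_⟩
      rw [hj' r fun h' => h (h'.symm.trans hr)]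
      rfl
  | zero => exact ⟨0, Submodule.zero_mem _, Submodule.zero_mem _, fun _ _ => rfl⟩
  | add x y _ _ hx hy =>
    obtain ⟨x', hx1, hx2, hx3⟩ := hx
    obtain ⟨y', hy1, hy2, hy3⟩ := hy
    exact ⟨x' + y', Submodule.add_mem _ hx1 hy1, Submodule.add_mem _ hx2 hy2, fun r hr => by
      simp [hx3 r hr, hy3 r hr]⟩
  | smul a x _ hx =>
    obtain ⟨x', hx1, hx2, hx3⟩ := hx
    exact ⟨a • x', Submodule.smul_mem _ a hx1, Submodule.smul_mem _ a hx2, fun r hr => by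
      simp [hx3 r hr]⟩

theorem vecMul_mem_block {K T ι : Type*} [Field K] [Fintype T] {τ : T → ι} {A : Matrix T T K}
    (hA : ∀ r, A r ∈ supportedOn K {s | τ s = τ r}) {j : ι} {b : T → K}
    (hb : b ∈ supportedOn K {r | τ r = j}) : b ᵥ* A ∈ supportedOn K {r | τ r = j} := by
  intro s hs
  refine Finset.sum_eq_zero fun r _ => ?_
  by_cases hr : τ r = j
  · change b r * A r s = 0
    rw [show A r s = 0 from hA r s fun h : τ s = τ r => hs (h.trans hr), mul_zero]
  · rw [hb r hr, zero_mul]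

/-- The transfer principle: an implication `L c → L' c` that holds for all vectors with at most `κ
c` nonzero coordinates continues to hold, after multiplication by a generic `A`, on the span of any
`κ c` of the vectors `g z`. The rows of `A` are made generic one at a time, starting from the
identity. -/
theorem exists_generic_block_matrix {K T ι Ξ C : Type*} [Field K] [Fintype K] [Fintype T]
    [DecidableEq T] [Fintype Ξ] [Fintype C] (τ : T → ι)
    (g : Ξ → T → K) (hg : ∀ z, ∃ j, g z ∈ supportedOn K {r | τ r = j})
    (L L' : C → Submodule K (T → K)) (hL : ∀ c, L' c ≤ L c) (κ : C → ℕ)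
    (base : ∀ c, ∀ I : Finset T, I.card ≤ κ c → ∀ x ∈ supportedOn K (I : Set T),
      x ∈ L c → x ∈ L' c)
    (hcard : Fintype.card (Option (C × Finset Ξ × Finset T)) < Fintype.card K) :
    ∃ A : Matrix T T K, LinearIndependent K A.row ∧
      (∀ r, A r ∈ supportedOn K {s | τ s = τ r}) ∧
      ∀ c, ∀ Z : Finset Ξ, Z.card ≤ κ c → ∀ b ∈ Submodule.span K (g '' Z),
        b ᵥ* A ∈ L c → b ᵥ* A ∈ L' c := by
  classical
  -- `S` is the set of rows already chosen. Allowing an additional `x` supported on `I`, with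
  -- dimension plus `|I|` as the budget, lets the induction trade one dimension of the span for one
  -- free coordinate.
  suffices main : ∀ S : Finset T, ∃ A : Matrix T T K, LinearIndependent K A.row ∧
      (∀ r, A r ∈ supportedOn K {s | τ s = τ r}) ∧
      ∀ c, ∀ (Z : Finset Ξ) (I : Finset T),
        Module.finrank K ↥(Submodule.span K (g '' Z) ⊓ supportedOn K (S : Set T)) + I.card ≤ κ c →
        ∀ b ∈ Submodule.span K (g '' Z) ⊓ supportedOn K (S : Set T),
        ∀ x ∈ supportedOn K (I : Set T), b ᵥ* A + x ∈ L c → b ᵥ* A + x ∈ L' c by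
    obtain ⟨A, hA, hblock, hgen⟩ := main Finset.univ
    refine ⟨A, hA, hblock, fun c Z hZ b hb hbL => ?_⟩
    have h1 : Module.finrank K
        ↥(Submodule.span K (g '' Z) ⊓ supportedOn K ((Finset.univ : Finset T) : Set T)) ≤
        Z.card := by
      refine (Submodule.finrank_mono inf_le_left).trans ?_
      rw [← Finset.coe_image]
      exact (finrank_span_finset_le_card _).trans Finset.card_image_le
    have := hgen c Z ∅ (by simpa using h1.trans hZ) b ⟨hb, fun r hr => absurd (by simp) hr⟩ 0
      (Submodule.zero_mem _) (by simpa using hbL)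
    simpa using this
  intro S
  induction S using Finset.induction_on with
  | empty =>
    refine ⟨1, ?_, fun r => ?_, ?_⟩
    · have := (Pi.basisFun K T).linearIndependent
      convert this using 1
      ext r s
      simp [Matrix.one_apply, Pi.single_apply, eq_comm]
    · intro s hs
      exact Matrix.one_apply_ne fun h => hs (by rw [h]; rfl)
    · intro c Z I hI b hb x hx h
      obtain rfl : b = 0 := funext fun r => hb.2 r (by simp)
      simp only [Matrix.zero_vecMul, zero_add] at h ⊢
      exact base c I (le_of_add_le_right hI) x hx h
  | insert r S hrS ih =>
    obtain ⟨A, hA, hblock, hgen⟩ := ih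
    -- A pivot for the new row: a vector of the span, inside the block of `r`, with coefficient one
    -- at `r`. It depends on `Z` alone, so the offsets below are fixed before `u` is chosen; the
    -- default `0` is never used as a pivot.
    let P : Finset Ξ → (T → K) → Prop := fun Z d =>
      d ∈ Submodule.span K (g '' Z) ∧ d ∈ supportedOn K ((insert r S : Finset T) : Set T) ∧
        d ∈ supportedOn K {s | τ s = τ r} ∧ d r = 1
    have hd : ∀ Z, ∃ d, (∃ b, P Z b) → P Z d := fun Z => by
      by_cases h : ∃ b, P Z b
      · exact ⟨h.choose, fun _ => h.choose_spec⟩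
      · exact ⟨0, fun h' => absurd h' h⟩
    choose d hd using hd
    let B : Finset Ξ → Submodule K (T → K) := fun Z =>
      Submodule.span K (g '' Z) ⊓ supportedOn K (S : Set T)
    let W : C × Finset Ξ × Finset T → Submodule K (T → K) := fun i =>
      (B i.2.1).map A.vecMulLinear ⊔ supportedOn K (i.2.2 : Set T) ⊔ L i.1
    -- The index `none` keeps the rows independent; the others keep the shifted row `v` out of every
    -- `W` that does not contain the whole block.
    obtain ⟨u, huU, hu⟩ := Submodule.exists_mem_forall_add_notMem
      (supportedOn K {s | τ s = τ r})
      (fun o => o.elim (Submodule.span K (A.row '' {r}ᶜ)) W)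
      (fun o => o.elim 0 fun i => (d i.2.1 - Pi.single r 1) ᵥ* A) hcard
    have hnone : u ∉ Submodule.span K (A.row '' {r}ᶜ) := by
      have := hu none
      simp only [Option.elim_none, add_zero] at this
      exact this fun hle => hA.notMem_span_image (by simp : r ∉ ({r}ᶜ : Set T)) (hle (hblock r))
    refine ⟨A.updateRow r u, ?_, ?_, ?_⟩
    · exact hA.update_of_notMem hnone
    · intro s
      by_cases hs : s = r
      · subst hs
        rw [show A.updateRow s u s = u from updateRow_self]
        exact huU
      · rw [show A.updateRow r u s = A s from updateRow_ne hs]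
        exact hblock s
    intro c Z I hI b hb x hx hbx
    have hB : B Z ≤ Submodule.span K (g '' Z) ⊓ supportedOn K ((insert r S : Finset T) : Set T) :=
      inf_le_inf le_rfl fun y hy s hs => hy s fun h => hs (by
        simp only [Finset.coe_insert]; exact Set.mem_insert_of_mem _ h)
    have hmemB : ∀ y ∈ Submodule.span K (g '' Z) ⊓
        supportedOn K ((insert r S : Finset T) : Set T), y r = 0 → y ∈ B Z := by
      intro y hy hyr
      refine ⟨hy.1, fun s hs => ?_⟩
      by_cases h : s = r
      · rw [h, hyr]
      · exact hy.2 s (by simp only [Finset.coe_insert, Set.mem_insert_iff, not_or]; exact ⟨h, hs⟩)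
    rw [vecMul_updateRow] at hbx ⊢
    by_cases hbr : b r = 0
    · rw [hbr, zero_smul, add_zero] at hbx ⊢
      exact hgen c Z I ((add_le_add_left (Submodule.finrank_mono hB) _).trans hI) b
        (hmemB b hb hbr) x hx hbx
    have hP : P Z (d Z) := by
      apply hd
      obtain ⟨b', hb1, hb2, hb3⟩ := restrict_mem_span τ g hg Z (τ r) hb.1
      refine ⟨(b r)⁻¹ • b', Submodule.smul_mem _ _ hb1, Submodule.smul_mem _ _ fun s hs => ?_,
        Submodule.smul_mem _ _ hb2, ?_⟩
      · by_cases h : τ s = τ r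
        · rw [hb3 s h, hb.2 s hs]
        · exact hb2 s h
      · simp [hb3 r rfl, inv_mul_cancel₀ hbr]
    obtain ⟨hd1, hd2, hd3, hd4⟩ := hP
    set D := d Z with hD
    -- The pivot is not in `B Z`, so the new row costs one dimension; this pays for the coordinate
    -- `s` added to `I` below.
    have hfin : Module.finrank K (B Z) + 1 ≤ Module.finrank K
        ↥(Submodule.span K (g '' Z) ⊓ supportedOn K ((insert r S : Finset T) : Set T)) := by
      refine Submodule.finrank_lt_finrank_of_lt (lt_of_le_of_ne hB fun h => ?_)
      have : D ∈ B Z := h ▸ ⟨hd1, hd2⟩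
      have h0 := this.2 r (by simpa using hrS)
      rw [hd4] at h0
      exact one_ne_zero h0
    set b' := b - b r • D with hb'
    have hb'B : b' ∈ B Z := by
      refine hmemB b' (Submodule.sub_mem _ hb (Submodule.smul_mem _ _ ⟨hd1, hd2⟩)) ?_
      simp [hb', hd4]
    set v := u + (D - Pi.single r 1) ᵥ* A with hv
    have hbv : b ᵥ* A + b r • (u - A r) = b' ᵥ* A + b r • v := by
      have h1 : (Pi.single r 1 : T → K) ᵥ* A = A r := Matrix.single_one_vecMul r A
      rw [hv, hb', Matrix.sub_vecMul, Matrix.sub_vecMul, Matrix.smul_vecMul, h1, smul_add,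
        smul_sub, smul_sub]
      abel
    rw [hbv] at hbx ⊢
    have hvU : v ∈ supportedOn K {s | τ s = τ r} :=
      Submodule.add_mem _ huU (vecMul_mem_block hblock
        (Submodule.sub_mem _ hd3 (single_mem_supportedOn (S := {s | τ s = τ r}) rfl 1)))
    -- If `W` contains the block, write each unit vector of the block as an element of `W`: the
    -- induction hypothesis with `insert s I` moves its `L c` part into `L' c`. Then `v` is absorbed
    -- into `B Z`, `I` and `L' c`, and the claim reduces to the old rows.
    by_cases hW : supportedOn K {s | τ s = τ r} ≤ W (c, Z, I)
    · have hW' : supportedOn K {s | τ s = τ r} ≤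
          (B Z).map A.vecMulLinear ⊔ supportedOn K (I : Set T) ⊔ L' c := by
        refine supportedOn_le_of_single_mem fun s hs => ?_
        obtain ⟨y, hy, l, hl, hyl⟩ := Submodule.mem_sup.1 (hW (single_mem_supportedOn hs 1))
        obtain ⟨_, ⟨b₁, hb₁, rfl⟩, x₁, hx₁, rfl⟩ := Submodule.mem_sup.1 hy
        refine Submodule.mem_sup.2 ⟨_, hy, l, ?_, hyl⟩
        have hl' : l = (-b₁) ᵥ* A + (Pi.single s 1 - x₁) := by
          rw [← hyl, Matrix.vecMulLinear_apply, Matrix.neg_vecMul]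
          abel
        rw [hl'] at hl ⊢
        refine hgen c Z (insert s I) ?_ (-b₁) (Submodule.neg_mem _ hb₁) _ ?_ hl
        · have := Finset.card_insert_le s I
          change Module.finrank K (B Z) + _ ≤ _
          omega
        · refine Submodule.sub_mem _ (single_mem_supportedOn (by simp) 1) fun q hq => hx₁ q ?_
          intro h
          exact hq (by simpa using Or.inr h)
      obtain ⟨y, hy, l, hl, hyl⟩ := Submodule.mem_sup.1 (hW' hvU)
      obtain ⟨_, ⟨b₁, hb₁, rfl⟩, x₁, hx₁, rfl⟩ := Submodule.mem_sup.1 hy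
      rw [Matrix.vecMulLinear_apply] at hyl
      have h1 : b' ᵥ* A + b r • v + x =
          ((b' + b r • b₁) ᵥ* A + (b r • x₁ + x)) + b r • l := by
        rw [← hyl, Matrix.add_vecMul, Matrix.smul_vecMul, smul_add, smul_add]
        abel
      have hlL : b r • l ∈ L c := (L c).smul_mem _ (hL c hl)
      rw [h1] at hbx ⊢
      refine Submodule.add_mem _ ?_ ((L' c).smul_mem _ hl)
      refine hgen c Z I (by change Module.finrank K (B Z) + _ ≤ _; omega) _
        (Submodule.add_mem _ hb'B (Submodule.smul_mem _ _ hb₁)) _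
        (Submodule.add_mem _ (Submodule.smul_mem _ _ hx₁) hx) ?_
      exact ((L c).add_mem_iff_left hlL).1 hbx
    -- Otherwise `v ∉ W` by the choice of `u`, while membership in `L c` with `b r ≠ 0` would put
    -- `v` into `W`.
    · exfalso
      have hvW : v ∉ W (c, Z, I) := hu (some (c, Z, I)) hW
      refine hvW (((W (c, Z, I)).smul_mem_iff hbr).1 ?_)
      have h1 : b r • v = (-b') ᵥ* A + (-x) + (b' ᵥ* A + b r • v + x) := by
        rw [Matrix.neg_vecMul]
        abel
      rw [h1]
      exact Submodule.add_mem_sup (Submodule.add_mem_sup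
        ⟨-b', Submodule.neg_mem _ hb'B, rfl⟩ (Submodule.neg_mem _ hx)) hbx

end Generic

/-! ### Matrices with prescribed zeros -/

/-- Each `f l` is a transversal of the allowed positions, so its square submatrix is generically
invertible. The vectors `D r` are chosen one `r` at a time. -/
theorem exists_columns_of_transversals {K T P Λ : Type*} [Field K] [Fintype K] [Fintype T]
    [DecidableEq T] [DecidableEq P] [Finite P] [Fintype Λ] (rel : P → T → Prop) (f : Λ → P → T)
    (hrel : ∀ l p, rel p (f l p)) (hinj : ∀ l, Function.Injective (f l))
    (hK : Fintype.card Λ < Fintype.card K) :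
    ∃ D : T → P → K, (∀ r p, ¬ rel p r → D r p = 0) ∧
      ∀ l, LinearIndependent K fun p => D (f l p) := by
  classical
  -- Unit vectors stand in for the columns not yet chosen. When `q = f l p₀` is treated, the unit
  -- vector at `p₀` is an admissible choice outside the span of the others, so the bad subspace for
  -- `l` is proper.
  suffices main : ∀ Q : Finset T, ∃ D : T → P → K, (∀ r p, ¬ rel p r → D r p = 0) ∧
      ∀ l, LinearIndependent K fun p => if f l p ∈ Q then D (f l p) else Pi.single p 1 by
    obtain ⟨D, h1, h2⟩ := main Finset.univ
    exact ⟨D, h1, fun l => by simpa using h2 l⟩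
  intro Q
  induction Q using Finset.induction_on with
  | empty => exact ⟨0, fun _ _ _ => rfl, fun l => by simpa using Pi.linearIndependent_single_one P K⟩
  | insert q Q hq ih =>
    obtain ⟨D, h1, h2⟩ := ih
    let fam : Λ → P → P → K := fun l p => if f l p ∈ Q then D (f l p) else Pi.single p 1
    obtain ⟨u, hu, hW⟩ := Submodule.exists_mem_forall_add_notMem (supportedOn K {p | rel p q})
      (fun l => Submodule.span K (fam l '' {p | f l p ≠ q})) (fun _ => 0) hK
    refine ⟨Function.update D q u, fun r p hrp => ?_, fun l => ?_⟩
    · by_cases hr : r = q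
      · subst hr
        simpa using hu p hrp
      · simpa [hr] using h1 r p hrp
    · have h3 : LinearIndependent K (fam l) := h2 l
      by_cases hql : ∃ p₀, f l p₀ = q
      · obtain ⟨p₀, hp₀⟩ := hql
        have hset : {p | f l p ≠ q} = {p₀}ᶜ := by
          ext p
          simp [← hp₀, (hinj l).eq_iff]
        have hU : ¬ supportedOn K {p | rel p q} ≤
            Submodule.span K (fam l '' {p | f l p ≠ q}) := by
          intro hle
          have h4 : Pi.single p₀ (1 : K) ∈ supportedOn K {p | rel p q} :=
            single_mem_supportedOn (S := {p | rel p q}) (hp₀ ▸ hrel l p₀ : rel p₀ q) 1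
          have h5 := h3.notMem_span_image (s := {p | f l p ≠ q}) (x := p₀) (by simp [hp₀])
          rw [show fam l p₀ = Pi.single p₀ 1 by simp [fam, hp₀, hq]] at h5
          exact h5 (hle h4)
        have h6 := hW l hU
        rw [add_zero, hset] at h6
        have h7 := h3.update_of_notMem h6
        have h8 : (fun p => if f l p ∈ insert q Q then Function.update D q u (f l p)
            else Pi.single p 1) = Function.update (fam l) p₀ u := by
          ext p a
          by_cases hp : p = p₀
          · subst hp
            simp [hp₀]
          · have : f l p ≠ q := fun h => hp (hinj l (h.trans hp₀.symm))
            simp [hp, this, fam]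
        rwa [h8]
      · have h8 : (fun p => if f l p ∈ insert q Q then Function.update D q u (f l p)
            else Pi.single p 1) = fam l := by
          ext p a
          have : f l p ≠ q := fun h => hql ⟨p, h⟩
          simp [this, fam]
        rwa [h8]

/-- Hall's condition: deleting `k` columns removes at most `k` relays from any union of
neighbourhoods, which is exactly the slack in `hR`. The `x` unconstrained rows bring the number of
rows up to `|T| - k`. -/
theorem exists_transversal {T : Type} [Fintype T] [DecidableEq T] {m : ℕ} (conn : Fin m → Finset T)
    (R : Fin m → ℕ) (k x : ℕ) (hR : ∀ A : Finset (Fin m), A.Nonempty →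
      ∑ i ∈ A, R i + k ≤ (A.biUnion conn).card)
    (hx : ∑ i, R i + x + k = Fintype.card T) (S : Finset T) (hS : S.card + k = Fintype.card T) :
    ∃ f : (Σ i, Fin (R i)) ⊕ Fin x → T, Function.Injective f ∧ (∀ p, f p ∈ S) ∧
      ∀ p, f (.inl p) ∈ conn p.1 := by
  classical
  let t : (Σ i, Fin (R i)) ⊕ Fin x → Finset T :=
    Sum.elim (fun p => S ∩ conn p.1) (fun _ => S)
  have hall : ∀ A : Finset ((Σ i, Fin (R i)) ⊕ Fin x), A.card ≤ (A.biUnion t).card := by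
    intro A
    by_cases hA : ∃ j, Sum.inr j ∈ A
    · obtain ⟨j, hj⟩ := hA
      calc A.card ≤ Fintype.card ((Σ i, Fin (R i)) ⊕ Fin x) := Finset.card_le_univ A
        _ = ∑ i, R i + x := by simp
        _ ≤ S.card := by omega
        _ ≤ _ := Finset.card_le_card (Finset.subset_biUnion_of_mem t hj)
    · push Not at hA
      rcases A.eq_empty_or_nonempty with rfl | hne
      · simp
      let B : Finset (Fin m) := Finset.univ.filter fun i => ∃ j, Sum.inl ⟨i, j⟩ ∈ A
      have hB : B.Nonempty := by
        obtain ⟨p | j, hp⟩ := hne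
        · exact ⟨p.1, by simpa [B] using ⟨p.2, hp⟩⟩
        · exact absurd hp (hA j)
      have h1 : A.card ≤ ∑ i ∈ B, R i := by
        calc A.card ≤ ((B.sigma fun i => (Finset.univ : Finset (Fin (R i)))).map
              Function.Embedding.inl).card := by
              refine Finset.card_le_card fun p hp => ?_
              rcases p with p | j
              · simpa [B] using ⟨p.2, hp⟩
              · exact absurd hp (hA j)
          _ = _ := by simp
      have h2 : S ∩ B.biUnion conn ⊆ A.biUnion t := by
        intro r hr
        simp only [Finset.mem_inter, Finset.mem_biUnion] at hr ⊢
        obtain ⟨hrS, i, hi, hri⟩ := hr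
        obtain ⟨j, hj⟩ := (Finset.mem_filter.1 hi).2
        exact ⟨_, hj, by simpa [t] using ⟨hrS, hri⟩⟩
      have h3 := Finset.card_union_add_card_inter S (B.biUnion conn)
      have h4 := Finset.card_le_univ (S ∪ B.biUnion conn)
      have h5 := hR B hB
      have h6 := Finset.card_le_card h2
      omega
  obtain ⟨f, hf, hft⟩ := (Finset.all_card_le_biUnion_card_iff_exists_injective t).1 hall
  refine ⟨f, hf, fun p => ?_, fun p => ?_⟩
  · have := hft p
    rcases p with p | j
    · exact (Finset.mem_inter.1 this).1
    · exact this
  · exact (Finset.mem_inter.1 (hft (.inl p))).2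

/-! ### Secure linear schemes on two-layer networks -/

section

open Matrix

/-- The random packets parametrise the kernel of a matrix with `|T| - k` rows in which any `|T| - k`
columns are invertible. The row supports give decodability and the invertible minors give security.
-/
theorem exists_secure_scheme {K T : Type} [Field K] [Fintype K] [Fintype T] {m : ℕ}
    [DecidableEq T] (hm : 0 < m) (conn : Fin m → Finset T) (R : Fin m → ℕ) (k : ℕ)
    (hR : ∀ A : Finset (Fin m), A.Nonempty → ∑ i ∈ A, R i + k ≤ (A.biUnion conn).card)
    (hK : Fintype.card (Finset T) < Fintype.card K) :
    ∃ (ρ : ℕ) (s : LinearScheme K T R ρ),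
      (∀ i w κ, (∀ r ∈ conn i, s.symbols w κ r = 0) → w i = 0) ∧
      ∀ I : Finset T, I.card ≤ k → ∀ w, ∃ κ, ∀ r ∈ I, (s.M *ᵥ w) r = (s.V *ᵥ κ) r := by
  classical
  obtain ⟨x, hx⟩ : ∃ x, ∑ i, R i + x + k = Fintype.card T := by
    have h1 := hR Finset.univ ⟨⟨0, hm⟩, Finset.mem_univ _⟩
    have h2 := Finset.card_le_univ (Finset.univ.biUnion conn)
    exact ⟨Fintype.card T - (∑ i, R i + k), by omega⟩
  have htr := exists_transversal conn R k x hR hx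
  have hP : Fintype.card ((Σ i, Fin (R i)) ⊕ Fin x) + k = Fintype.card T := by simpa using hx
  let Λ : Type := {S : Finset T // S.card + k = Fintype.card T}
  choose f hfinj hfS hfc using fun l : Λ => htr l.1 l.2
  -- The relation is vacuous for the rows `inr`, so they may use every relay.
  obtain ⟨D, hD, hDind⟩ := exists_columns_of_transversals (K := K)
    (fun (p : (Σ i, Fin (R i)) ⊕ Fin x) (r : T) => ∀ p', p = .inl p' → r ∈ conn p'.1) f
    (fun l p p' hp => by subst hp; exact hfc l p') hfinj
    ((Fintype.card_subtype_le _).trans_lt hK)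
  let Dm : Matrix ((Σ i, Fin (R i)) ⊕ Fin x) T K := fun p r => D r p
  have hsolve : ∀ S : Finset T, S.card + k = Fintype.card T →
      ∀ y, ∃ v ∈ supportedOn K (S : Set T), Dm *ᵥ v = y := by
    intro S hS y
    have h1 : Submodule.span K (Set.range fun p => D (f ⟨S, hS⟩ p)) = ⊤ :=
      (hDind ⟨S, hS⟩).span_eq_top_of_card_eq_finrank' (by simp)
    obtain ⟨c, hc⟩ := (Submodule.mem_span_range_iff_exists_fun K).1
      (h1 ▸ Submodule.mem_top : y ∈ Submodule.span K (Set.range fun p => D (f ⟨S, hS⟩ p)))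
    refine ⟨∑ p, c p • Pi.single (f ⟨S, hS⟩ p) 1, Submodule.sum_mem _ fun p _ =>
      Submodule.smul_mem _ _ (single_mem_supportedOn (S := (S : Set T)) (hfS ⟨S, hS⟩ p) 1), ?_⟩
    rw [← hc, Matrix.mulVec_sum]
    refine Finset.sum_congr rfl fun p _ => ?_
    rw [Matrix.mulVec_smul, Matrix.mulVec_single_one]
    rfl
  obtain ⟨S₀, -, hS₀⟩ := Finset.exists_subset_card_eq (s := (Finset.univ : Finset T))
    (n := Fintype.card T - k) (by simp)
  obtain ⟨B, hB⟩ := Dm.mulVecLin.exists_rightInverse_of_surjective (LinearMap.range_eq_top.2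
    fun y => by
      obtain ⟨v, -, hv⟩ := hsolve S₀ (by omega) y
      exact ⟨v, hv⟩)
  have hDB : ∀ y, Dm *ᵥ (B y) = y := fun y => LinearMap.congr_fun hB y
  let b := Module.finBasis K (LinearMap.ker Dm.mulVecLin)
  let inc : ((Σ i, Fin (R i)) → K) →ₗ[K] ((Σ i, Fin (R i)) ⊕ Fin x → K) :=
    { toFun := fun w => Sum.elim w 0
      map_add' := fun v w => by ext (p | p) <;> simp
      map_smul' := fun a w => by ext (p | p) <;> simp }
  -- `M` is a section of `Dm` on the messages padded by zero and `V` a basis of `ker Dm`, so `Dm X =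
  -- (W, 0)` whatever the random packets are.
  let s : LinearScheme K T R (Module.finrank K (LinearMap.ker Dm.mulVecLin)) :=
    { M := LinearMap.toMatrix' (B ∘ₗ inc)
      V := fun r j => (b j : T → K) r }
  have hM : ∀ w, s.M *ᵥ w = B (Sum.elim w 0) := fun w => by
    rw [show s.M = LinearMap.toMatrix' (B ∘ₗ inc) from rfl, LinearMap.toMatrix'_mulVec]
    rfl
  have hV : ∀ κ, s.V *ᵥ κ = ((∑ j, κ j • b j : LinearMap.ker Dm.mulVecLin) : T → K) := fun κ => by
    ext r
    simp [Matrix.mulVec, dotProduct, s, mul_comm]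
  refine ⟨_, s, fun i w κ hX => ?_, fun I hI w => ?_⟩
  · have h1 : Dm *ᵥ s.symbols w κ = Sum.elim (fun p => w p.1 p.2) 0 := by
      rw [LinearScheme.symbols, Matrix.mulVec_add, hM, hDB, hV]
      have := (∑ j, κ j • b j).2
      rw [LinearMap.mem_ker, Matrix.mulVecLin_apply] at this
      rw [this, add_zero]
    ext j
    have h2 := congrFun h1 (.inl ⟨i, j⟩)
    simp only [Sum.elim_inl] at h2
    rw [← h2]
    refine Finset.sum_eq_zero fun r _ => ?_
    by_cases hr : r ∈ conn i
    · rw [hX r hr, mul_zero]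
    · change D r (.inl ⟨i, j⟩) * _ = 0
      rw [hD r (.inl ⟨i, j⟩) fun h => hr (h ⟨i, j⟩ rfl), zero_mul]
  -- Prescribe the values `M w` on `I` and correct on `S`, disjoint from `I`, to reach the kernel.
  -- The kernel element then agrees with `M w` on `I`.
  · obtain ⟨S, hSI, hS⟩ := Finset.exists_subset_card_eq (s := Iᶜ) (n := Fintype.card T - k)
      (by rw [Finset.card_compl]; omega)
    let a : T → K := fun r => if r ∈ I then (s.M *ᵥ w) r else 0
    obtain ⟨v, hv, hDv⟩ := hsolve S (by omega) (-(Dm *ᵥ a))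
    have hker : a + v ∈ LinearMap.ker Dm.mulVecLin := by
      rw [LinearMap.mem_ker, Matrix.mulVecLin_apply, Matrix.mulVec_add, hDv, add_neg_cancel]
    refine ⟨b.repr ⟨a + v, hker⟩, fun r hr => ?_⟩
    rw [hV, b.sum_repr]
    have hvr : v r = 0 := hv r fun h => (Finset.mem_compl.1 (hSI h)) hr
    simp [a, hr, hvr]

end

/-! ### Linear multicast -/

namespace Network

variable {V E : Type*} {m : ℕ}

theorem wellFounded_feeds [Finite E] (N : Network V E m) :
    WellFounded fun l e : E => N.head l = N.tail e := by
  have key : ∀ l e : E, Relation.TransGen (fun l e : E => N.head l = N.tail e) l e →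
      Relation.TransGen (fun u w => ∃ e, N.tail e = u ∧ N.head e = w) (N.tail l) (N.tail e) := by
    intro l e h
    induction h with
    | single h => exact .single ⟨l, rfl, h⟩
    | tail _ h ih => exact ih.tail ⟨_, rfl, h⟩
  have : Std.Irrefl (Relation.TransGen fun l e : E => N.head l = N.tail e) :=
    ⟨fun e h => N.acyclic _ (key e e h)⟩
  exact Subrelation.wf (r := Relation.TransGen fun l e : E => N.head l = N.tail e)
    (fun h => Relation.TransGen.single h)
    (Finite.wellFounded_of_trans_of_irrefl (Relation.TransGen fun l e : E => N.head l = N.tail e))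

theorem reach_cases (N : Network V E m) {H : Set E} {u v : V} (h : N.Reach H u v) :
    v = u ∨ ∃ e ∈ H, N.head e = v ∧ N.Reach H u (N.tail e) := by
  rcases Relation.ReflTransGen.cases_tail h with h | ⟨w, hw, e, he, rfl, rfl⟩
  · exact .inl h
  · exact .inr ⟨e, he, rfl, hw⟩

theorem Reach.mono {N : Network V E m} {H H' : Set E} {u v : V} (h : N.Reach H u v)
    (hH : H ⊆ H') : N.Reach H' u v := by
  unfold Reach at h ⊢
  induction h with
  | refl => exact .refl
  | tail _ h ih =>
    obtain ⟨e, he, h⟩ := h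
    exact ih.tail ⟨e, hH he, h⟩

/-- The dichotomy plays the role of max-flow min-cut: a span that is not everything is certified by
a cut no larger than its dimension. Edges are coded in topological order, each new vector avoiding
every span of earlier edges that does not contain all of its admissible space. -/
theorem exists_generic_linear_code [Fintype E] (N : Network V E m) (H : Set E) (c : ℕ) {K : Type*}
    [Field K] [Fintype K] (hK : Fintype.card (Finset E) < Fintype.card K) :
    ∃ g : E → Fin c → K,
      (∀ e ∈ H, N.tail e ≠ N.source →
        g e ∈ Submodule.span K (g '' {l | l ∈ H ∧ N.head l = N.tail e})) ∧
      ∀ F : Finset E, ↑F ⊆ H → Submodule.span K (g '' F) = ⊤ ∨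
        ∃ C : Finset E, C.card ≤ Module.finrank K (Submodule.span K (g '' F)) ∧
          ∀ e ∈ F, e ∉ C → ¬ N.Reach (H \ C) N.source (N.tail e) := by
  classical
  -- `S` is closed under predecessors, so coding one more minimal edge does not disturb the
  -- conditions on the earlier ones.
  suffices main : ∀ n ≤ Fintype.card E, ∃ (S : Finset E) (g : E → Fin c → K), S.card = n ∧
      (∀ e ∈ S, ∀ l, N.head l = N.tail e → l ∈ S) ∧
      (∀ e ∈ S, e ∈ H → N.tail e ≠ N.source →
        g e ∈ Submodule.span K (g '' {l | l ∈ H ∧ N.head l = N.tail e})) ∧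
      ∀ F : Finset E, F ⊆ S → ↑F ⊆ H → Submodule.span K (g '' F) = ⊤ ∨
        ∃ C : Finset E, C.card ≤ Module.finrank K (Submodule.span K (g '' F)) ∧
          ∀ e ∈ F, e ∉ C → ¬ N.Reach (H \ C) N.source (N.tail e) by
    obtain ⟨S, g, hS, -, h1, h2⟩ := main _ le_rfl
    obtain rfl := Finset.card_eq_iff_eq_univ S |>.1 hS
    exact ⟨g, fun e => h1 e (Finset.mem_univ e), fun F => h2 F (Finset.subset_univ F)⟩
  intro n
  induction n with
  | zero =>
    refine fun _ => ⟨∅, 0, rfl, by simp, by simp, fun F hF _ => .inr ⟨∅, by simp, ?_⟩⟩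
    obtain rfl := Finset.subset_empty.1 hF
    simp
  | succ n ih =>
    intro hn
    obtain ⟨S, g, hS, hdown, hg, hcut⟩ := ih (by omega)
    obtain ⟨e, heS, hmin⟩ := N.wellFounded_feeds.has_min {e | e ∉ S} (by
      by_contra hne
      rw [Set.not_nonempty_iff_eq_empty, Set.eq_empty_iff_forall_notMem] at hne
      have : S = Finset.univ := Finset.eq_univ_iff_forall.2 fun e => by simpa using hne e
      rw [this, Finset.card_univ] at hS
      omega)
    have hpred : ∀ l, N.head l = N.tail e → l ∈ S := fun l hl => by
      by_contra h
      exact hmin l h hl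
    have heS' : e ∉ S := heS
    let U : Submodule K (Fin c → K) := if N.tail e = N.source then ⊤ else
      Submodule.span K (g '' {l | l ∈ H ∧ N.head l = N.tail e})
    obtain ⟨u, hu, hW⟩ := Submodule.exists_mem_forall_add_notMem U
      (fun F : Finset E => Submodule.span K (g '' F)) (fun _ => 0) hK
    have himg : ∀ F : Set E, e ∉ F → Function.update g e u '' F = g '' F := fun F hF =>
      Set.image_congr fun l hl => Function.update_of_ne (fun h : l = e => hF (h ▸ hl)) u g
    have hin : ∀ x ∈ insert e S, e ∉ {l | l ∈ H ∧ N.head l = N.tail x} := by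
      rintro x hx ⟨-, hxe⟩
      rcases Finset.mem_insert.1 hx with rfl | hx
      · exact heS' (hpred _ hxe)
      · exact heS' (hdown x hx _ hxe)
    refine ⟨insert e S, Function.update g e u, by rw [Finset.card_insert_of_notMem heS', hS],
      ?_, ?_, ?_⟩
    · intro x hx l hl
      rcases Finset.mem_insert.1 hx with rfl | hx
      · exact Finset.mem_insert_of_mem (hpred l hl)
      · exact Finset.mem_insert_of_mem (hdown x hx l hl)
    · intro x hx hxH hxs
      rw [himg _ (hin x hx)]
      rcases Finset.mem_insert.1 hx with rfl | hx
      · simpa [U, hxs] using hu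
      · rw [Function.update_of_ne fun h : x = e => heS' (h ▸ hx)]
        exact hg x hx hxH hxs
    · intro F hF hFH
      by_cases heF : e ∈ F
      swap
      · rw [himg _ (by simpa using heF)]
        refine hcut F (fun x hx => ?_) hFH
        exact (Finset.mem_insert.1 (hF hx)).resolve_left fun h => heF (h ▸ hx)
      have hFS : F.erase e ⊆ S := fun x hx =>
        (Finset.mem_insert.1 (hF (Finset.mem_of_mem_erase hx))).resolve_left
          (Finset.ne_of_mem_erase hx)
      have hFH' : ↑(F.erase e) ⊆ H := fun x hx => hFH (Finset.mem_of_mem_erase hx)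
      have hspan : Submodule.span K (Function.update g e u '' F) =
          Submodule.span K (g '' (F.erase e)) ⊔ Submodule.span K {u} := by
        conv_lhs => rw [← Finset.insert_erase heF, Finset.coe_insert, Set.image_insert_eq,
          himg _ (by simp), Function.update_self, Set.insert_eq, Submodule.span_union]
        rw [sup_comm]
      rw [hspan]
      rcases hcut _ hFS hFH' with htop | ⟨C, hC, hCcut⟩
      · left
        rw [htop, top_sup_eq]
      -- If the admissible space is already spanned, `e` may be traded for the edges entering its
      -- tail without changing the span, and a cut for these blocks `e` as well.
      by_cases hU : U ≤ Submodule.span K (g '' (F.erase e))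
      · by_cases hes : N.tail e = N.source
        · left
          rw [show U = ⊤ from if_pos hes, top_le_iff] at hU
          rw [hU, top_sup_eq]
        rw [show U = _ from if_neg hes] at hU
        let I : Finset E := Finset.univ.filter fun l => l ∈ H ∧ N.head l = N.tail e
        have hI : (I : Set E) = {l | l ∈ H ∧ N.head l = N.tail e} := by ext; simp [I]
        have hspan' : Submodule.span K (g '' (F.erase e ∪ I : Finset E)) =
            Submodule.span K (g '' (F.erase e)) := by
          rw [Finset.coe_union, Set.image_union, Submodule.span_union, hI, sup_eq_left]
          exact hU
        have h1 := hcut (F.erase e ∪ I) (Finset.union_subset hFS fun l hl =>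
          hpred l (by simpa [I] using (Finset.mem_filter.1 hl).2.2)) (by
            rw [Finset.coe_union, hI]
            exact Set.union_subset hFH' fun l hl => hl.1)
        rw [hspan'] at h1
        rcases h1 with h1 | ⟨C', hC', hcut'⟩
        · left
          rw [h1, top_sup_eq]
        · right
          refine ⟨C', hC'.trans (Submodule.finrank_mono le_sup_left), fun x hx hxC => ?_⟩
          by_cases hxe : x = e
          · subst hxe
            intro hreach
            rcases N.reach_cases hreach with h | ⟨l, hl, hlx, hreach'⟩
            · exact hes h
            · exact hcut' l (Finset.mem_union_right _ (by simpa [I] using ⟨hl.1, hlx⟩))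
                (by simpa using hl.2) hreach'
          · exact hcut' x (Finset.mem_union_left _ (Finset.mem_erase.2 ⟨hxe, hx⟩)) hxC
      -- Otherwise `u` is a new direction; the extra dimension pays for putting `e` itself into the
      -- cut.
      · right
        have hu' := hW (F.erase e) hU
        rw [add_zero] at hu'
        refine ⟨insert e C, (Finset.card_insert_le _ _).trans ?_, fun x hx hxC => ?_⟩
        · refine (Nat.succ_le_succ hC).trans (Submodule.finrank_lt_finrank_of_lt ?_)
          refine lt_of_le_of_ne le_sup_left fun h => hu' ?_
          rw [h]
          exact Submodule.mem_sup_right (Submodule.mem_span_singleton_self u)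
        · rw [Finset.mem_insert, not_or] at hxC
          intro hreach
          refine hCcut x (Finset.mem_erase.2 ⟨hxC.1, hx⟩) hxC.2 ?_
          exact hreach.mono (Set.sdiff_subset_sdiff_right (by simp))

end Network

namespace Network

variable {V E : Type*} {m : ℕ}

/-! ### Min-cuts -/

theorem minCut_le (N : Network V E m) {H : Set E} {A : Finset (Fin m)} {C : Finset E}
    (hC : N.IsCut H A C) : N.minCut H A ≤ C.card :=
  Nat.sInf_le ⟨C, hC, rfl⟩

theorem exists_isCut [Fintype E] (N : Network V E m) (H : Set E) (A : Finset (Fin m)) :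
    ∃ C : Finset E, N.IsCut H A C ∧ C.card = N.minCut H A := by
  refine Nat.sInf_mem (s := {c | ∃ C : Finset E, N.IsCut H A C ∧ C.card = c})
    ⟨_, Finset.univ, fun i _ h => ?_, rfl⟩
  rcases N.reach_cases h with h | ⟨e, he, -⟩
  · exact N.dest_ne_source i h
  · simp at he

theorem minCut_mono [Fintype E] (N : Network V E m) (H : Set E) {A B : Finset (Fin m)}
    (h : A ⊆ B) : N.minCut H A ≤ N.minCut H B := by
  obtain ⟨C, hC, hcard⟩ := N.exists_isCut H B
  rw [← hcard]
  exact N.minCut_le fun i hi => hC i (h hi)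

end Network

/-- Cutting the first-layer edge of each useful relay suffices. Conversely each useful relay must
lose an edge, and an edge belongs to one relay only. -/
theorem minCut_twoLayer {T : Type} [Fintype T] [DecidableEq T] {m : ℕ} (conn : Fin m → Finset T)
    (P : Finset T) (A : Finset (Fin m)) :
    (twoLayer T conn).minCut {e | e.relay ∈ P} A = (P ∩ A.biUnion conn).card := by
  classical
  refine le_antisymm ?_ ?_
  · have hcut : (twoLayer T conn).IsCut {e | e.relay ∈ P} A
        ((P ∩ A.biUnion conn).image TwoLayerEdge.first) := by
      intro i hi h
      rcases (twoLayer T conn).reach_cases h with h | ⟨e, he, hhead, hreach⟩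
      · exact (twoLayer T conn).dest_ne_source i h
      obtain r | ⟨i', r, hr⟩ := e
      · cases hhead
      obtain rfl : i' = i := by
        injection hhead
      rcases (twoLayer T conn).reach_cases hreach with h | ⟨e, he', hhead', -⟩
      · cases h
      obtain r' | ⟨i'', r', hr'⟩ := e
      · obtain rfl : r' = r := by injection hhead'
        refine he'.2 ?_
        simp only [Finset.coe_image, Set.mem_image, Finset.mem_coe, Finset.mem_inter,
          Finset.mem_biUnion]
        exact ⟨r', ⟨he'.1, i', hi, hr⟩, rfl⟩
      · cases (show TwoLayerNode.dest i'' = TwoLayerNode.relay r from hhead')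
    exact ((twoLayer T conn).minCut_le hcut).trans Finset.card_image_le
  · obtain ⟨C, hC, hcard⟩ := (twoLayer T conn).exists_isCut {e | e.relay ∈ P} A
    rw [← hcard]
    refine (Finset.card_le_card (t := C.image TwoLayerEdge.relay) fun r hr => ?_).trans
      Finset.card_image_le
    simp only [Finset.mem_inter, Finset.mem_biUnion] at hr
    obtain ⟨hrP, i, hi, hri⟩ := hr
    by_contra hno
    have hno' : ∀ e : TwoLayerEdge T conn, e.relay = r → e ∉ C := fun e he heC =>
      hno (Finset.mem_image.2 ⟨e, heC, he⟩)
    refine hC i hi ?_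
    refine (Relation.ReflTransGen.single (b := TwoLayerNode.relay r) ?_).tail ?_
    · exact ⟨.first r, ⟨hrP, by simpa using hno' (.first r) rfl⟩, rfl, rfl⟩
    · exact ⟨.second i r hri, ⟨hrP, by simpa using hno' (.second i r hri) rfl⟩, rfl, rfl⟩

namespace Network.Separation

variable {V E : Type*} {m : ℕ} {N : Network V E m}

/-! ### The child network and its min-cuts -/

theorem mem_childConn (sep : N.Separation) {i : Fin m} {r : sep.ChildRelay} :
    r ∈ sep.childConn i ↔ i ∈ r.1.1 := by
  simp [childConn]

theorem card_relays_over (sep : N.Separation) {J : Finset (Fin m)} (hJ : J.Nonempty) :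
    (Finset.univ.filter fun r : sep.ChildRelay => r.1.1 = J).card = sep.cap J := by
  classical
  have h : (Finset.univ.filter fun r : sep.ChildRelay => r.1.1 = J) =
      (Finset.univ : Finset (Fin (sep.cap J))).map
        ⟨fun x => (⟨⟨J, hJ⟩, x⟩ : sep.ChildRelay), fun x y h => by simpa using h⟩ := by
    ext ⟨⟨J', hJ'⟩, x⟩
    simp only [Finset.mem_filter, Finset.mem_univ, true_and, Finset.mem_map]
    constructor
    · rintro rfl
      exact ⟨x, rfl⟩
    · rintro ⟨y, hy⟩
      have := congrArg (fun r : sep.ChildRelay => r.1.1) hy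
      exact this.symm
  rw [h]
  simp

theorem minCut_child_part (sep : N.Separation) [DecidableEq sep.ChildRelay]
    (J B : Finset (Fin m)) :
    sep.child.minCut {e | e.relay.1.1 = J} B =
      if (J ∩ B).Nonempty then
        (Finset.univ.filter fun r : sep.ChildRelay => r.1.1 = J).card else 0 := by
  have h := minCut_twoLayer sep.childConn
    (Finset.univ.filter fun r : sep.ChildRelay => r.1.1 = J) B
  have hset : {e : TwoLayerEdge sep.ChildRelay sep.childConn | e.relay ∈
      Finset.univ.filter fun r : sep.ChildRelay => r.1.1 = J} = {e | e.relay.1.1 = J} := by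
    ext; simp
  rw [hset] at h
  rw [child, h]
  split_ifs with hJB
  · congr 1
    rw [Finset.inter_eq_left]
    intro r hr
    obtain ⟨i, hi⟩ := hJB
    rw [Finset.mem_inter] at hi
    rw [Finset.mem_filter] at hr
    exact Finset.mem_biUnion.2 ⟨i, hi.2, sep.mem_childConn.2 (by rw [hr.2]; exact hi.1)⟩
  · rw [Finset.card_eq_zero, Finset.eq_empty_iff_forall_notMem]
    intro r hr
    simp only [Finset.mem_inter, Finset.mem_filter, Finset.mem_univ, true_and,
      Finset.mem_biUnion, mem_childConn] at hr
    obtain ⟨rfl, i, hi, hir⟩ := hr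
    exact hJB ⟨i, Finset.mem_inter.2 ⟨hir, hi⟩⟩

theorem cutCap_child_eq_card (sep : N.Separation) [DecidableEq sep.ChildRelay]
    (A : Finset (Fin m)) : sep.child.cutCap A = (A.biUnion sep.childConn).card := by
  have h := minCut_twoLayer sep.childConn Finset.univ A
  simp only [Finset.mem_univ, Finset.univ_inter] at h
  exact h

theorem cutCap_child_eq_sum (sep : N.Separation) (A : Finset (Fin m)) :
    sep.child.cutCap A =
      ∑ J ∈ Finset.univ.filter (fun J : Finset (Fin m) => (J ∩ A).Nonempty), sep.cap J := by
  classical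
  rw [cutCap_child_eq_card, Finset.card_eq_sum_card_fiberwise (f := fun r => r.1.1)
    (t := Finset.univ.filter (fun J : Finset (Fin m) => (J ∩ A).Nonempty))]
  · refine Finset.sum_congr rfl fun J hJ => ?_
    have hJA := (Finset.mem_filter.1 hJ).2
    rw [← sep.card_relays_over (hJA.mono Finset.inter_subset_left)]
    congr 1
    ext r
    simp only [Finset.mem_filter, Finset.mem_biUnion, mem_childConn, Finset.mem_univ, true_and,
      and_iff_right_iff_imp]
    rintro rfl
    obtain ⟨i, hi⟩ := hJA
    exact ⟨i, (Finset.mem_inter.1 hi).2, (Finset.mem_inter.1 hi).1⟩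
  · intro r hr
    simp only [Finset.coe_biUnion, Set.mem_iUnion, Finset.mem_coe, mem_childConn] at hr
    obtain ⟨i, hi, hir⟩ := hr
    simpa using ⟨i, Finset.mem_inter.2 ⟨hir, hi⟩⟩

theorem cutCap_child (sep : N.Separation) (A : Finset (Fin m)) :
    sep.child.cutCap A = N.cutCap A := by
  rw [cutCap_child_eq_sum, sep.cut_sum]
  rfl

/-- The child network is itself separable. -/
def childSeparation (sep : N.Separation) : sep.child.Separation where
  part J := {e | e.relay.1.1 = J}
  disjoint J L _ _ hne := Set.disjoint_left.2 fun _ h h' => hne (h.symm.trans h')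
  cut_inside J B hB hne := by
    classical
    rw [minCut_child_part, minCut_child_part, Finset.inter_eq_right.2 hB, Finset.inter_self,
      if_pos hne, if_pos (hne.mono hB)]
  cut_outside J _ := by
    classical
    rw [minCut_child_part, Finset.inter_compl, if_neg (by simp)]
  cut_sum A := by
    classical
    rw [cutCap_child_eq_sum]
    refine Finset.sum_congr rfl fun J hJ => ?_
    have hJ' := (Finset.mem_filter.1 hJ).2.mono Finset.inter_subset_left
    rw [minCut_child_part, Finset.inter_self, if_pos hJ', sep.card_relays_over hJ']

/-! ### Existence of multicast codes -/

/-- One generic code per block serves all its destinations: a deficient span at `D_i` would come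
with a cut towards `D_i` smaller than `cap J`, contrary to `cut_inside`. Disjointness of the parts
lets the codes be placed side by side. -/
theorem nonempty_multicast [Fintype E] (sep : N.Separation) (K : Type) [Field K] [Fintype K]
    (hK : Fintype.card (Finset E) < Fintype.card K) : Nonempty (sep.Multicast K) := by
  classical
  choose g hg hcut using fun J : {J : Finset (Fin m) // J.Nonempty} =>
    N.exists_generic_linear_code (sep.part J.1) (sep.cap J.1) (K := K) hK
  let G : Matrix E sep.ChildRelay K := fun e r => if e ∈ sep.part r.1.1 then g r.1 e r.2 else 0
  let emb (J : {J : Finset (Fin m) // J.Nonempty}) :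
      (Fin (sep.cap J.1) → K) →ₗ[K] (sep.ChildRelay → K) :=
    { toFun := fun x r => (Pi.single J x : ∀ J : {J : Finset (Fin m) // J.Nonempty},
        Fin (sep.cap J.1) → K) r.1 r.2
      map_add' := fun x y => by
        ext r
        simp [Pi.single_add]
      map_smul' := fun a x => by
        ext r
        simp [Pi.single_smul] }
  have hG : ∀ J : {J : Finset (Fin m) // J.Nonempty}, ∀ e ∈ sep.part J.1, G e = emb J (g J e) := by
    intro J e he
    ext ⟨J', x⟩
    by_cases h : J' = J
    · subst h
      simp [G, emb, he]
    · have : e ∉ sep.part J'.1 := fun he' =>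
        Set.disjoint_left.1 (sep.disjoint J'.1 J.1 J'.2 J.2 fun h' => h (Subtype.ext h')) he' he
      simp [G, emb, this, h]
  have hGimg : ∀ J : {J : Finset (Fin m) // J.Nonempty}, ∀ S ⊆ sep.part J.1,
      Submodule.span K (G '' S) = (Submodule.span K (g J '' S)).map (emb J) := by
    intro J S hS
    rw [Submodule.map_span, Set.image_image]
    congr 1
    exact Set.image_congr fun e he => hG J e (hS he)
  refine ⟨⟨G, fun e r he => if_neg he, fun J hJ e he hes => ?_, fun r i hi => ?_⟩⟩
  · rw [hG ⟨J, hJ⟩ e he, hGimg ⟨J, hJ⟩ _ fun l hl => hl.1]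
    exact Submodule.mem_map_of_mem (hg ⟨J, hJ⟩ e he hes)
  · let F : Finset E := Finset.univ.filter fun l => l ∈ sep.part r.1.1 ∧ N.head l = N.dest i
    have hF : (F : Set E) = {l | l ∈ sep.part r.1.1 ∧ N.head l = N.dest i} := by ext; simp [F]
    have htop : Submodule.span K (g r.1 '' F) = ⊤ := by
      rcases hcut r.1 F (by rw [hF]; exact fun l hl => hl.1) with h | ⟨C, hC, hC'⟩
      · exact h
      have hiscut : N.IsCut (sep.part r.1.1) {i} C := by
        intro i' hi' hreach
        obtain rfl := Finset.mem_singleton.1 hi'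
        rcases N.reach_cases hreach with h | ⟨l, hl, hlx, hreach'⟩
        · exact N.dest_ne_source _ h
        · exact hC' l (by simpa [F] using ⟨hl.1, hlx⟩) (by simpa using hl.2) hreach'
      refine Submodule.eq_top_of_finrank_eq (le_antisymm (Submodule.finrank_le _) ?_)
      have h1 := N.minCut_le hiscut
      rw [sep.cut_inside r.1.1 {i} (by simpa using hi) (by simp)] at h1
      rw [Module.finrank_fin_fun]
      exact h1.trans hC
    rw [hGimg r.1 _ fun l hl => hl.1, ← hF, htop]
    refine ⟨Pi.single r.2 1, trivial, ?_⟩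
    ext ⟨J', x⟩
    obtain ⟨J, y⟩ := r
    by_cases h : J' = J
    · subst h
      by_cases hxy : x = y
      · subst hxy; simp [emb]
      · simp [emb, hxy]
    · simp [emb, h]

end Network.Separation

/-! ### Networks with all edges replicated -/

namespace Network

variable {V E : Type*} {m : ℕ}

/-- The network in which every edge is replaced by `L` parallel edges. -/
def replicate (N : Network V E m) (L : ℕ) : Network V (E × Fin L) m where
  tail e := N.tail e.1
  head e := N.head e.1
  source := N.source
  dest := N.dest
  dest_ne_source := N.dest_ne_source
  acyclic v h := N.acyclic v (Relation.TransGen.mono (fun _ _ ⟨e, he⟩ => ⟨e.1, he⟩) _ _ h)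

/-- An edge with one uncut copy is still usable, so a cut only profits from the bundles that it
contains completely, and each of these costs `L`. -/
theorem minCut_replicate [Fintype E] (N : Network V E m) (L : ℕ) (H : Set E)
    (A : Finset (Fin m)) :
    (N.replicate L).minCut (Prod.fst ⁻¹' H) A = L * N.minCut H A := by
  classical
  refine le_antisymm ?_ ?_
  · obtain ⟨C, hC, hcard⟩ := N.exists_isCut H A
    have hcut : (N.replicate L).IsCut (Prod.fst ⁻¹' H) A (C ×ˢ Finset.univ) := by
      intro i hi h
      refine hC i hi (Relation.ReflTransGen.mono ?_ _ _ h)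
      rintro a b ⟨e, he, h⟩
      exact ⟨e.1, ⟨he.1, fun h' => he.2 (by simpa using h')⟩, h⟩
    refine ((N.replicate L).minCut_le hcut).trans ?_
    rw [Finset.card_product, hcard, Finset.card_univ, Fintype.card_fin, mul_comm]
  · obtain ⟨C, hC, hcard⟩ := (N.replicate L).exists_isCut (Prod.fst ⁻¹' H) A
    rw [← hcard]
    let C' : Finset E := Finset.univ.filter fun e => ∀ l, (e, l) ∈ C
    have hcut : N.IsCut H A C' := by
      intro i hi h
      refine hC i hi (Relation.ReflTransGen.mono ?_ _ _ h)
      rintro a b ⟨e, he, h⟩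
      have : ∃ l, (e, l) ∉ C := by simpa [C'] using he.2
      obtain ⟨l, hl⟩ := this
      exact ⟨(e, l), ⟨he.1, by simpa using hl⟩, h⟩
    calc L * N.minCut H A ≤ L * C'.card := Nat.mul_le_mul_left _ (N.minCut_le hcut)
      _ = (C' ×ˢ (Finset.univ : Finset (Fin L))).card := by
        rw [Finset.card_product, Finset.card_univ, Fintype.card_fin, mul_comm]
      _ ≤ C.card := Finset.card_le_card fun e he => by
        have := (Finset.mem_product.1 he).1
        exact (Finset.mem_filter.1 this).2 e.2

theorem cutCap_replicate [Fintype E] (N : Network V E m) (L : ℕ)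
    (A : Finset (Fin m)) : (N.replicate L).cutCap A = L * N.cutCap A :=
  N.minCut_replicate L Set.univ A

/-- A decomposition of the network induces one of the replicated network. -/
def Separation.replicate [Fintype E] {N : Network V E m} (sep : N.Separation) (L : ℕ) : (N.replicate L).Separation where
  part J := Prod.fst ⁻¹' sep.part J
  disjoint J J' hJ hJ' hne := (sep.disjoint J J' hJ hJ' hne).preimage _
  cut_inside J B hB hne := by
    rw [N.minCut_replicate, N.minCut_replicate, sep.cut_inside J B hB hne]
  cut_outside J hJ := by rw [N.minCut_replicate, sep.cut_outside J hJ, mul_zero]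
  cut_sum A := by
    simp only [N.cutCap_replicate, N.minCut_replicate, sep.cut_sum, Finset.mul_sum]

end Network

/-! ### Entropy of random variables with finitely many values -/

section Entropy

variable {Ω α β : Type*} [MeasurableSpace Ω]

/-- All level sets of `X` are measurable. -/
def FibersMeasurable (X : Ω → α) : Prop := ∀ a, MeasurableSet (X ⁻¹' {a})

theorem FibersMeasurable.preimage [Finite α] {X : Ω → α} (hX : FibersMeasurable X) (S : Set α) :
    MeasurableSet (X ⁻¹' S) := by
  rw [← Set.biUnion_preimage_singleton]
  exact S.toFinite.measurableSet_biUnion fun a _ => hX a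

theorem FibersMeasurable.comp [Finite α] {X : Ω → α} (hX : FibersMeasurable X) (f : α → β) :
    FibersMeasurable fun ω => f (X ω) := fun b => hX.preimage (f ⁻¹' {b})

theorem FibersMeasurable.prodMk {X : Ω → α} {Y : Ω → β} (hX : FibersMeasurable X)
    (hY : FibersMeasurable Y) : FibersMeasurable fun ω => (X ω, Y ω) := by
  rintro ⟨a, b⟩
  convert (hX a).inter (hY b) using 1
  ext ω
  simp

theorem FibersMeasurable.pi {ι : Type*} [Finite ι] {α : ι → Type*} {X : ∀ i, Ω → α i}
    (hX : ∀ i, FibersMeasurable (X i)) : FibersMeasurable fun ω i => X i ω := by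
  intro a
  convert MeasurableSet.iInter fun i => hX i (a i) using 1
  ext ω
  simp [funext_iff]

variable [Fintype α] [Fintype β] {μ : Measure Ω}

theorem entropy_congr_ae {X Y : Ω → α} (h : X =ᵐ[μ] Y) : entropy μ X = entropy μ Y := by
  refine Finset.sum_congr rfl fun a _ => ?_
  congr 1
  refine measureReal_congr ?_
  filter_upwards [h] with ω hω
  exact propext (by change X ω = a ↔ Y ω = a; rw [hω])

variable [IsProbabilityMeasure μ]

theorem FibersMeasurable.sum_real_filter {X : Ω → α} (hX : FibersMeasurable X) (S : Set α)
    [DecidablePred (· ∈ S)] :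
    ∑ a ∈ Finset.univ.filter (· ∈ S), μ.real (X ⁻¹' {a}) = μ.real (X ⁻¹' S) := by
  rw [sum_measureReal_preimage_singleton _ fun a _ => hX a]
  simp

theorem FibersMeasurable.sum_real {X : Ω → α} (hX : FibersMeasurable X) :
    ∑ a, μ.real (X ⁻¹' {a}) = 1 := by
  rw [sum_measureReal_preimage_singleton _ fun a _ => hX a]
  simp

theorem FibersMeasurable.sum_real_snd {Ω α β : Type*} [MeasurableSpace Ω] [Fintype β]
    {μ : Measure Ω} [IsProbabilityMeasure μ] {X : Ω → α} {Y : Ω → β} (hX : FibersMeasurable X)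
    (hY : FibersMeasurable Y) (a : α) :
    ∑ b, μ.real ((fun ω => (X ω, Y ω)) ⁻¹' {(a, b)}) = μ.real (X ⁻¹' {a}) := by
  classical
  have h := sum_measureReal_preimage_singleton (μ := μ) ({a} ×ˢ (Finset.univ : Finset β))
    fun y _ => (hX.prodMk hY) y
  rw [Finset.sum_product, Finset.sum_singleton] at h
  rw [h]
  congr 1
  ext ω
  simp [eq_comm]

theorem FibersMeasurable.sum_real_fst {Ω α β : Type*} [MeasurableSpace Ω] [Fintype α]
    {μ : Measure Ω} [IsProbabilityMeasure μ] {X : Ω → α} {Y : Ω → β} (hX : FibersMeasurable X)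
    (hY : FibersMeasurable Y) (b : β) :
    ∑ a, μ.real ((fun ω => (X ω, Y ω)) ⁻¹' {(a, b)}) = μ.real (Y ⁻¹' {b}) := by
  classical
  have h := sum_measureReal_preimage_singleton (μ := μ) ((Finset.univ : Finset α) ×ˢ {b})
    fun y _ => (hX.prodMk hY) y
  rw [Finset.sum_product] at h
  simp only [Finset.sum_singleton] at h
  rw [h]
  congr 1
  ext ω
  simp [eq_comm]

theorem entropy_nonneg (X : Ω → α) : 0 ≤ entropy μ X :=
  Finset.sum_nonneg fun _ _ => Real.negMulLog_nonneg measureReal_nonneg measureReal_le_one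

theorem negMulLog_sum_le {ι : Type*} (s : Finset ι) (p : ι → ℝ) (hp : ∀ i ∈ s, 0 ≤ p i) :
    Real.negMulLog (∑ i ∈ s, p i) ≤ ∑ i ∈ s, Real.negMulLog (p i) := by
  rw [Real.negMulLog, ← Finset.sum_neg_distrib, Finset.sum_mul]
  refine Finset.sum_le_sum fun i hi => ?_
  rw [Real.negMulLog]
  rcases (hp i hi).eq_or_lt with h | h
  · simp [← h]
  · have := Real.log_le_log h (Finset.single_le_sum hp hi)
    nlinarith

theorem entropy_comp_le {X : Ω → α} (hX : FibersMeasurable X) (f : α → β) :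
    entropy μ (fun ω => f (X ω)) ≤ entropy μ X := by
  classical
  rw [entropy, entropy, ← Finset.sum_fiberwise_of_maps_to (t := Finset.univ) (g := f)
    fun _ _ => Finset.mem_univ _]
  refine Finset.sum_le_sum fun b _ => ?_
  refine le_trans (le_of_eq ?_) (negMulLog_sum_le _ _ fun _ _ => measureReal_nonneg)
  congr 1
  exact (hX.sum_real_filter (f ⁻¹' {b})).symm

theorem entropy_comp_of_injective {X : Ω → α} (hX : FibersMeasurable X) {f : α → β}
    (hf : Function.Injective f) : entropy μ (fun ω => f (X ω)) = entropy μ X := by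
  refine le_antisymm (entropy_comp_le hX f) ?_
  obtain ⟨ω₀⟩ : Nonempty Ω := nonempty_of_isProbabilityMeasure μ
  have : Nonempty α := ⟨X ω₀⟩
  have h := entropy_comp_le (μ := μ) (hX.comp f) (Function.invFun f)
  simpa only [Function.leftInverse_invFun hf _] using h

/-- This is `log t ≤ t - 1` at `t = q / p`. Positivity of `q` is only demanded where `p ≠ 0`; the
maximum keeps the bound valid at `p = 0`. -/
theorem negMulLog_le_of_gibbs {p q : ℝ} (hp : 0 ≤ p) (hq : p ≠ 0 → 0 < q) :
    Real.negMulLog p ≤ -p * Real.log q + (max q 0 - p) := by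
  rcases hp.eq_or_lt with rfl | h
  · simp
  · have hq' := hq h.ne'
    have h1 := Real.log_le_sub_one_of_pos (div_pos hq' h)
    rw [Real.log_div hq'.ne' h.ne'] at h1
    rw [max_eq_left hq'.le, Real.negMulLog]
    have h2 : p * (Real.log q - Real.log p) ≤ p * (q / p - 1) := mul_le_mul_of_nonneg_left h1 hp
    have h3 : p * (q / p - 1) = q - p := by field_simp
    linarith

/-- Gibbs' inequality against the product of the marginals, summed; the correction terms cancel
because both sides have total mass one. -/
theorem entropy_prodMk_le {X : Ω → α} {Y : Ω → β} (hX : FibersMeasurable X)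
    (hY : FibersMeasurable Y) :
    entropy μ (fun ω => (X ω, Y ω)) ≤ entropy μ X + entropy μ Y := by
  let p : α → β → ℝ := fun a b => μ.real ((fun ω => (X ω, Y ω)) ⁻¹' {(a, b)})
  let pX : α → ℝ := fun a => μ.real (X ⁻¹' {a})
  let pY : β → ℝ := fun b => μ.real (Y ⁻¹' {b})
  have hpX : ∀ a, ∑ b, p a b = pX a := hX.sum_real_snd hY
  have hpY : ∀ b, ∑ a, p a b = pY b := hX.sum_real_fst hY
  have hp0 : ∀ a b, 0 ≤ p a b := fun _ _ => measureReal_nonneg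
  have hX0 : ∀ a, 0 ≤ pX a := fun _ => measureReal_nonneg
  have hY0 : ∀ b, 0 ≤ pY b := fun _ => measureReal_nonneg
  have hX1 : ∑ a, pX a = 1 := hX.sum_real
  have hY1 : ∑ b, pY b = 1 := hY.sum_real
  have hpXle : ∀ a b, p a b ≤ pX a := fun a b => by
    rw [← hpX]
    exact Finset.single_le_sum (f := p a) (fun b _ => hp0 a b) (Finset.mem_univ b)
  have hpYle : ∀ a b, p a b ≤ pY b := fun a b => by
    rw [← hpY]
    exact Finset.single_le_sum (f := fun a => p a b) (fun a _ => hp0 a b) (Finset.mem_univ a)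
  have hterm : ∀ a b, Real.negMulLog (p a b) ≤
      -p a b * Real.log (pX a) + -p a b * Real.log (pY b) + (pX a * pY b - p a b) := by
    intro a b
    have h := negMulLog_le_of_gibbs (q := pX a * pY b) (hp0 a b) fun h => by
      have h' := (hp0 a b).lt_of_ne' h
      exact mul_pos (h'.trans_le (hpXle a b)) (h'.trans_le (hpYle a b))
    rw [max_eq_left (mul_nonneg (hX0 a) (hY0 b))] at h
    by_cases h0 : p a b = 0
    · simpa [h0] using h
    · have h' := (hp0 a b).lt_of_ne' h0
      rw [Real.log_mul (h'.trans_le (hpXle a b)).ne' (h'.trans_le (hpYle a b)).ne'] at h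
      linarith
  have hsum : ∑ a, ∑ b, Real.negMulLog (p a b) ≤ ∑ a, ∑ b,
      (-p a b * Real.log (pX a) + -p a b * Real.log (pY b) + (pX a * pY b - p a b)) :=
    Finset.sum_le_sum fun a _ => Finset.sum_le_sum fun b _ => hterm a b
  have h1 : ∑ a, ∑ b, -p a b * Real.log (pX a) = entropy μ X := by
    refine Finset.sum_congr rfl fun a _ => ?_
    rw [← Finset.sum_mul, Finset.sum_neg_distrib, hpX]
    rfl
  have h2 : ∑ a, ∑ b, -p a b * Real.log (pY b) = entropy μ Y := by
    rw [Finset.sum_comm]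
    refine Finset.sum_congr rfl fun b _ => ?_
    rw [← Finset.sum_mul, Finset.sum_neg_distrib, hpY]
    rfl
  have h3 : ∑ a, ∑ b, (pX a * pY b - p a b) = 0 := by
    simp only [Finset.sum_sub_distrib, hpX, ← Finset.mul_sum, hY1, mul_one, sub_self,
      Finset.sum_const_zero]
  simp only [Finset.sum_add_distrib] at hsum
  rw [h1, h2, h3, add_zero] at hsum
  rw [entropy, Fintype.sum_prod_type]
  exact hsum

theorem entropy_le_log_card {X : Ω → α} (hX : FibersMeasurable X) :
    entropy μ X ≤ Real.log (Fintype.card α) := by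
  obtain ⟨ω₀⟩ : Nonempty Ω := nonempty_of_isProbabilityMeasure μ
  have : Nonempty α := ⟨X ω₀⟩
  have hpos : (0 : ℝ) < Fintype.card α := by exact_mod_cast Fintype.card_pos
  have hsum : entropy μ X ≤ ∑ a, (-μ.real (X ⁻¹' {a}) * Real.log (Fintype.card α : ℝ)⁻¹ +
      ((Fintype.card α : ℝ)⁻¹ - μ.real (X ⁻¹' {a}))) := by
    refine Finset.sum_le_sum fun a _ => ?_
    have h := negMulLog_le_of_gibbs (p := μ.real (X ⁻¹' {a})) (q := (Fintype.card α : ℝ)⁻¹)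
      measureReal_nonneg fun _ => inv_pos.2 hpos
    rwa [max_eq_left (inv_pos.2 hpos).le] at h
  rw [Finset.sum_add_distrib, Finset.sum_sub_distrib, ← Finset.sum_mul, Finset.sum_neg_distrib,
    hX.sum_real, Real.log_inv] at hsum
  simpa [hpos.ne'] using hsum

/-- `H(X | Y)` is a sum of nonnegative terms `p (log pY - log p)`. If all vanish, each level set of
`Y` of positive mass carries a single value of `X`. -/
theorem exists_ae_eq_of_condEntropy_eq_zero {X : Ω → α} {Y : Ω → β} (hX : FibersMeasurable X)
    (hY : FibersMeasurable Y) (h : condEntropy μ X Y = 0) :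
    ∃ f : β → α, ∀ᵐ ω ∂μ, X ω = f (Y ω) := by
  classical
  let p : α → β → ℝ := fun a b => μ.real ((fun ω => (X ω, Y ω)) ⁻¹' {(a, b)})
  let pY : β → ℝ := fun b => μ.real (Y ⁻¹' {b})
  have hpY : ∀ b, ∑ a, p a b = pY b := hX.sum_real_fst hY
  have hp0 : ∀ a b, 0 ≤ p a b := fun _ _ => measureReal_nonneg
  have hpYle : ∀ a b, p a b ≤ pY b := fun a b => by
    rw [← hpY]
    exact Finset.single_le_sum (f := fun a => p a b) (fun a _ => hp0 a b) (Finset.mem_univ a)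
  have hnn : ∀ b a, 0 ≤ p a b * (Real.log (pY b) - Real.log (p a b)) := by
    intro b a
    rcases (hp0 a b).eq_or_lt with h0 | h0
    · rw [← h0, zero_mul]
    · exact mul_nonneg (hp0 a b) (sub_nonneg.2 (Real.log_le_log h0 (hpYle a b)))
  have hzero : ∑ b, ∑ a, p a b * (Real.log (pY b) - Real.log (p a b)) = 0 := by
    rw [← h, condEntropy, entropy, entropy, Fintype.sum_prod_type_right, ← Finset.sum_sub_distrib]
    refine Finset.sum_congr rfl fun b _ => ?_
    change _ = ∑ a, Real.negMulLog (p a b) - Real.negMulLog (pY b)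
    simp only [mul_sub, Finset.sum_sub_distrib, ← Finset.sum_mul, hpY, Real.negMulLog, neg_mul,
      Finset.sum_neg_distrib]
    ring
  have hpp : ∀ a b, p a b ≠ 0 → p a b = pY b := by
    intro a b hab
    have h1 := (Finset.sum_eq_zero_iff_of_nonneg fun b _ => Finset.sum_nonneg fun a _ =>
      hnn b a).1 hzero b (Finset.mem_univ b)
    have h2 := (Finset.sum_eq_zero_iff_of_nonneg fun a _ => hnn b a).1 h1 a (Finset.mem_univ a)
    have hpos := (hp0 a b).lt_of_ne' hab
    have h3 := (mul_eq_zero.1 h2).resolve_left hab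
    exact (Real.log_injOn_pos (hpos.trans_le (hpYle a b)) hpos (sub_eq_zero.1 h3)).symm
  obtain ⟨ω₀⟩ : Nonempty Ω := nonempty_of_isProbabilityMeasure μ
  -- The value on null level sets is arbitrary.
  let f : β → α := fun b => if h : ∃ a, p a b ≠ 0 then h.choose else X ω₀
  have hf : ∀ a b, a ≠ f b → p a b = 0 := by
    intro a b hab
    by_contra hne
    have hex : ∃ a, p a b ≠ 0 := ⟨a, hne⟩
    have hfb : p (f b) b ≠ 0 := by
      simp only [f, dif_pos hex]
      exact hex.choose_spec
    have h1 : p a b + p (f b) b ≤ pY b := by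
      rw [← hpY, ← Finset.sum_pair (f := fun a => p a b) hab]
      exact Finset.sum_le_sum_of_subset_of_nonneg (Finset.subset_univ _) fun a _ _ => hp0 a b
    rw [hpp a b hne, hpp _ b hfb] at h1
    have h2 := (hp0 a b).lt_of_ne' hne
    rw [hpp a b hne] at h2
    linarith
  refine ⟨f, ?_⟩
  have hcover : {ω | ¬ X ω = f (Y ω)} ⊆ ⋃ x ∈ {x : α × β | x.1 ≠ f x.2},
      (fun ω => (X ω, Y ω)) ⁻¹' {x} := fun ω hω => by
    simp only [Set.mem_iUnion]
    exact ⟨(X ω, Y ω), hω, rfl⟩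
  refine measure_mono_null hcover ((measure_biUnion_null_iff (Set.to_countable _)).2 ?_)
  rintro ⟨a, b⟩ hab
  exact (measureReal_eq_zero_iff (measure_ne_top _ _)).1 (hf a b hab)

theorem entropy_le_sum {ι : Type*} [DecidableEq ι] {α : ι → Type*} [∀ i, Fintype (α i)] {X : ∀ i, Ω → α i}
    (hX : ∀ i, FibersMeasurable (X i)) (s : Finset ι) :
    entropy μ (fun ω (i : s) => X i ω) ≤ ∑ i ∈ s, entropy μ (X i) := by
  induction s using Finset.induction_on with
  | empty =>
    refine (entropy_le_log_card (FibersMeasurable.pi fun i : (∅ : Finset ι) => hX i)).trans ?_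
    simp
  | insert i s hi ih =>
    rw [Finset.sum_insert hi]
    have h1 := (entropy_prodMk_le (μ := μ) (hX i)
      (FibersMeasurable.pi fun j : s => hX j)).trans (add_le_add_right ih _)
    refine le_trans ?_ h1
    refine entropy_comp_le ((hX i).prodMk (FibersMeasurable.pi fun j : s => hX j))
      (fun (x : α i × ∀ j : s, α j) (j : (insert i s : Finset ι)) =>
        if h : (j : ι) = i then h ▸ x.1
        else x.2 ⟨j, (Finset.mem_insert.1 j.2).resolve_left h⟩) |>.trans_eq' ?_
    congr 1
    funext ω j
    by_cases h : (j : ι) = i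
    · obtain ⟨j, hj⟩ := j
      obtain rfl : j = i := h
      simp
    · simp [h]

theorem negMulLog_prod {ι : Type*} [DecidableEq ι] (s : Finset ι) (q : ι → ℝ) :
    Real.negMulLog (∏ i ∈ s, q i) =
      ∑ i ∈ s, ∏ j ∈ s, if j = i then Real.negMulLog (q j) else q j := by
  induction s using Finset.induction_on with
  | empty => simp
  | insert a s ha ih =>
    rw [Finset.prod_insert ha, Real.negMulLog_mul, ih, Finset.sum_insert ha, Finset.prod_insert ha,
      if_pos rfl, Finset.mul_sum]
    congr 1
    · rw [mul_comm]
      congr 1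
      exact Finset.prod_congr rfl fun j hj => by rw [if_neg fun h : j = a => ha (h ▸ hj)]
    · refine Finset.sum_congr rfl fun i hi => ?_
      rw [Finset.prod_insert ha, if_neg fun h : a = i => ha (h ▸ hi)]

theorem entropy_of_prod_law {Ω ι : Type*} [MeasurableSpace Ω] {μ : Measure Ω} [Fintype ι] [DecidableEq ι] {α : ι → Type*}
    [∀ i, Fintype (α i)] {W : Ω → ∀ i, α i} {q : ∀ i, α i → ℝ} (hq : ∀ i, ∑ x, q i x = 1)
    (hW : ∀ w, μ.real (W ⁻¹' {w}) = ∏ i, q i (w i)) :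
    entropy μ W = ∑ i, ∑ x, Real.negMulLog (q i x) := by
  simp only [entropy, hW, negMulLog_prod]
  rw [Finset.sum_comm]
  refine Finset.sum_congr rfl fun i _ => ?_
  have h := Fintype.prod_sum fun j x => if j = i then Real.negMulLog (q j x) else q j x
  rw [Fintype.prod_eq_single i] at h
  · simp only [if_true] at h
    rw [h]
  · intro j hj
    simp [hj, hq]

/-- The nonempty fibres are cosets of the kernel, so the image is uniform on the range. This turns
the entropy conditions on linear codes into counting. -/
theorem entropy_of_uniform_hom {G H : Type*} [AddGroup G] [Fintype G] [MeasurableSpace G]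
    [AddGroup H] [Fintype H] {μ : Measure G}
    (hμ : ∀ S : Finset G, μ.real (S : Set G) = S.card / Fintype.card G) (φ : G →+ H) :
    entropy μ φ = Real.log (Nat.card φ.range) := by
  classical
  have hG : (0 : ℝ) < Fintype.card G := by exact_mod_cast Fintype.card_pos
  have hp : ∀ y, μ.real (φ ⁻¹' {y}) =
      ((Finset.univ.filter fun g => φ g = y).card : ℝ) / Fintype.card G := fun y => by
    rw [← hμ]
    congr 1
    ext
    simp
  let R : Finset H := Finset.univ.filter fun y => y ∈ Set.range φ
  have hR : R.card = Nat.card φ.range := by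
    rw [Nat.card_eq_fintype_card]
    exact (Fintype.card_of_subtype R fun y => by simp [R]).symm
  let c := (Finset.univ.filter fun g => φ g = 0).card
  have hc : ∀ y ∈ R, (Finset.univ.filter fun g => φ g = y).card = c := fun y hy =>
    AddMonoidHom.card_fiber_eq_of_mem_range φ (by simpa [R] using hy) ⟨0, map_zero φ⟩
  have hcount : Fintype.card G = R.card * c := by
    rw [← Finset.card_univ, Finset.card_eq_sum_card_fiberwise (f := φ) (t := R) (by
      intro g _
      simp [R])]
    exact Finset.sum_const_nat hc
  have hRpos : (R.card : ℝ) ≠ 0 := by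
    intro h
    rw [hcount, Nat.cast_mul, h, zero_mul] at hG
    exact lt_irrefl _ hG
  have hcpos : (c : ℝ) ≠ 0 := by
    intro h
    rw [hcount, Nat.cast_mul, h, mul_zero] at hG
    exact lt_irrefl _ hG
  have hval : ∀ y, μ.real (φ ⁻¹' {y}) = if y ∈ R then (R.card : ℝ)⁻¹ else 0 := by
    intro y
    rw [hp]
    split_ifs with hy
    · rw [hc y hy, hcount, Nat.cast_mul]
      field_simp
    · rw [Finset.filter_eq_empty_iff.2]
      · simp
      · intro g _ hg
        exact hy (by simpa [R] using ⟨g, hg⟩)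
  rw [entropy]
  simp only [hval, apply_ite Real.negMulLog, Real.negMulLog_zero]
  rw [Finset.sum_ite_mem, Finset.univ_inter, Finset.sum_const, nsmul_eq_mul, ← hR, Real.negMulLog,
    Real.log_inv]
  field_simp

end Entropy

/-! ### Decodability, security and rates of linear codes -/

theorem real_uniform_prod {ι : Type*} [Fintype ι] {α : ι → Type*} {β : Type*}
    [∀ i, Fintype (α i)] [∀ i, Nonempty (α i)] [Fintype β] [Nonempty β]
    [Fintype ((∀ i, α i) × β)] [∀ i, MeasurableSpace (α i)]
    [∀ i, DiscreteMeasurableSpace (α i)] [MeasurableSpace β] [DiscreteMeasurableSpace β]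
    (S : Finset ((∀ i, α i) × β)) :
    ((Measure.pi fun i => (PMF.uniformOfFintype (α i)).toMeasure).prod
      (PMF.uniformOfFintype β).toMeasure).real (S : Set ((∀ i, α i) × β)) =
        S.card / Fintype.card ((∀ i, α i) × β) := by
  classical
  have h : ∀ x : (∀ i, α i) × β, ((Measure.pi fun i => (PMF.uniformOfFintype (α i)).toMeasure).prod
      (PMF.uniformOfFintype β).toMeasure).real {x} =
        ((Fintype.card ((∀ i, α i) × β) : ℝ))⁻¹ := by
    rintro ⟨w, k⟩
    rw [← Set.singleton_prod_singleton, measureReal_prod_prod, measureReal_def, measureReal_def,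
      Measure.pi_singleton]
    simp only [PMF.toMeasure_apply_singleton _ _ (measurableSet_singleton _),
      PMF.uniformOfFintype_apply, ENNReal.toReal_prod, ENNReal.toReal_inv, ENNReal.toReal_natCast]
    rw [← Nat.card_eq_fintype_card (α := (∀ i, α i) × β), Nat.card_prod, Nat.card_pi]
    simp [mul_comm]
  rw [← sum_measureReal_singleton]
  simp only [h, Finset.sum_const, nsmul_eq_mul]
  rfl

/-- After taking logarithms this is the criterion for `H(φ | ψ) = 0`: the projection from the joint
range to the range of `ψ` is injective. -/
theorem AddMonoidHom.card_range_prod_eq_iff {G H H' : Type*} [AddGroup G] [Finite G] [AddGroup H]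
    [AddGroup H'] (φ : G →+ H) (ψ : G →+ H') :
    Nat.card (φ.prod ψ).range = Nat.card ψ.range ↔ ∀ g, ψ g = 0 → φ g = 0 := by
  have : Finite (φ.prod ψ).range := Finite.of_surjective _ (φ.prod ψ).rangeRestrict_surjective
  have : Finite ψ.range := Finite.of_surjective _ ψ.rangeRestrict_surjective
  let π : (φ.prod ψ).range → ψ.range := fun x => ⟨x.1.2, by
    obtain ⟨g, hg⟩ := x.2
    exact ⟨g, by rw [← hg]; rfl⟩⟩
  have hπ : Function.Surjective π := by
    rintro ⟨_, g, rfl⟩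
    exact ⟨⟨_, g, rfl⟩, rfl⟩
  constructor
  · intro h g hg
    have hinj := (hπ.bijective_of_nat_card_le h.le).1
    have := @hinj ⟨_, g, rfl⟩ ⟨_, 0, rfl⟩ (Subtype.ext (by simpa [π] using hg))
    have h2 := congrArg (fun x => x.1.1) this
    simpa using h2
  · intro h
    refine Nat.card_congr (Equiv.ofBijective π ⟨?_, hπ⟩)
    rintro ⟨_, g, rfl⟩ ⟨_, g', rfl⟩ hgg
    have h1 : ψ g = ψ g' := congrArg Subtype.val hgg
    have h2 := h (g - g') (by rw [map_sub, h1, sub_self])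
    rw [map_sub, sub_eq_zero] at h2
    exact Subtype.ext (Prod.ext h2 h1)

/-- After taking logarithms this is the criterion for `I(φ ; ψ) = 0`: the joint range fills the
product. By translation it suffices to pair each value of `φ` with the value zero of `ψ`. -/
theorem AddMonoidHom.card_range_prod_eq_mul_iff {G H H' : Type*} [AddGroup G] [Finite G]
    [AddGroup H] [AddGroup H'] (φ : G →+ H) (ψ : G →+ H') :
    Nat.card φ.range * Nat.card ψ.range = Nat.card (φ.prod ψ).range ↔
      ∀ g, ∃ g', φ g' = φ g ∧ ψ g' = 0 := by
  have : Finite φ.range := Finite.of_surjective _ φ.rangeRestrict_surjective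
  have : Finite ψ.range := Finite.of_surjective _ ψ.rangeRestrict_surjective
  rw [← Nat.card_prod]
  let ι : (φ.prod ψ).range → φ.range × ψ.range := fun x => ⟨⟨x.1.1, by
    obtain ⟨g, hg⟩ := x.2
    exact ⟨g, by rw [← hg]; rfl⟩⟩, ⟨x.1.2, by
    obtain ⟨g, hg⟩ := x.2
    exact ⟨g, by rw [← hg]; rfl⟩⟩⟩
  have hι : Function.Injective ι := by
    rintro ⟨x, hx⟩ ⟨y, hy⟩ hxy
    simp only [ι, Prod.mk.injEq, Subtype.mk.injEq] at hxy
    exact Subtype.ext (Prod.ext hxy.1 hxy.2)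
  constructor
  · intro h g
    have hsurj := (hι.bijective_of_nat_card_le h.le).2
    obtain ⟨⟨_, g', rfl⟩, hg'⟩ := hsurj (⟨φ g, g, rfl⟩, ⟨0, 0, map_zero ψ⟩)
    simp only [ι, Prod.mk.injEq] at hg'
    exact ⟨g', congrArg Subtype.val hg'.1, congrArg Subtype.val hg'.2⟩
  · intro h
    refine (Nat.card_congr (Equiv.ofBijective ι ⟨hι, ?_⟩)).symm
    rintro ⟨⟨_, g₁, rfl⟩, ⟨_, g₂, rfl⟩⟩
    obtain ⟨g', h1, h2⟩ := h (g₁ - g₂)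
    refine ⟨⟨_, g' + g₂, rfl⟩, ?_⟩
    simp [ι, h1, h2]

section LinearCode

open Matrix

variable {V E : Type*} {m : ℕ} {N : Network V E m} {F T : Type} [Field F]
  [Fintype T] {R : Fin m → ℕ} {ρ : ℕ}

theorem LinearScheme.symbols_add {m : ℕ} {F T : Type} [Field F] {R : Fin m → ℕ} {ρ : ℕ}
    (s : LinearScheme F T R ρ) (w w' : ∀ i, Fin (R i) → F)
    (κ κ' : Fin ρ → F) : s.symbols (w + w') (κ + κ') = s.symbols w κ + s.symbols w' κ' := by
  have h : (fun p : Σ i, Fin (R i) => (w + w') p.1 p.2) =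
      (fun p => w p.1 p.2) + fun p => w' p.1 p.2 := rfl
  rw [symbols, symbols, symbols, h, Matrix.mulVec_add, Matrix.mulVec_add]
  abel

/-- The symbols on the edges in `Z` as a function of the packets. -/
def symbolsHom (G : Matrix E T F) (s : LinearScheme F T R ρ) (Z : Finset E) :
    (∀ i, Fin (R i) → F) × (Fin ρ → F) →+ (Z → Fin 1 → F) :=
  AddMonoidHom.mk' (fun ω e _ => G e.1 ⬝ᵥ s.symbols ω.1 ω.2) fun a b => by
    funext e x
    rw [Prod.fst_add, Prod.snd_add, s.symbols_add, dotProduct_add]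
    rfl

variable [Fintype F]

theorem linearCode_law_real (G : Matrix E T F) (hG : N.Realizable G) (s : LinearScheme F T R ρ)
    [Fintype ((∀ i, Fin (R i) → F) × (Fin ρ → F))]
    (S : Finset ((∀ i, Fin (R i) → F) × (Fin ρ → F))) :
    (linearCode N G hG s).law.real (S : Set ((∀ i, Fin (R i) → F) × (Fin ρ → F))) =
      S.card / Fintype.card ((∀ i, Fin (R i) → F) × (Fin ρ → F)) := by
  let _ : ∀ i, MeasurableSpace (Fin (R i) → F) := fun _ => ⊤
  have : ∀ i, DiscreteMeasurableSpace (Fin (R i) → F) := fun _ => ⟨fun _ => trivial⟩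
  let _ : MeasurableSpace (Fin ρ → F) := ⊤
  have : DiscreteMeasurableSpace (Fin ρ → F) := ⟨fun _ => trivial⟩
  exact real_uniform_prod S

theorem entropy_linearCode (G : Matrix E T F) (hG : N.Realizable G) (s : LinearScheme F T R ρ)
    {H : Type*} [AddGroup H] [Fintype H]
    (φ : (∀ i, Fin (R i) → F) × (Fin ρ → F) →+ H) :
    entropy (linearCode N G hG s).law (φ : (∀ i, Fin (R i) → F) × (Fin ρ → F) → H) =
      Real.log (Nat.card φ.range) := by
  let _ : ∀ i, MeasurableSpace (Fin (R i) → F) := fun _ => ⊤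
  let _ : MeasurableSpace (Fin ρ → F) := ⊤
  exact entropy_of_uniform_hom (linearCode_law_real G hG s) φ

theorem natCast_card_range_pos {G H : Type*} [AddGroup G] [Finite G] [AddGroup H] (φ : G →+ H) :
    (0 : ℝ) < Nat.card φ.range := by
  have : Finite φ.range := Finite.of_surjective _ φ.rangeRestrict_surjective
  exact_mod_cast Nat.card_pos

theorem linearCode_decodable_iff [Fintype E] (G : Matrix E T F) (hG : N.Realizable G)
    (s : LinearScheme F T R ρ) :
    (linearCode N G hG s).Decodable ↔ ∀ i w κ,
      (∀ e, N.head e = N.dest i → G e ⬝ᵥ s.symbols w κ = 0) → w i = 0 := by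
  classical
  refine forall_congr' fun i => ?_
  let φ : (∀ i, Fin (R i) → F) × (Fin ρ → F) →+ (Fin (R i) → F) :=
    (Pi.evalAddMonoidHom _ i).comp (AddMonoidHom.fst _ _)
  let ψ := symbolsHom G s (N.incoming (N.dest i))
  have h1 := entropy_linearCode G hG s ψ
  have h2 := entropy_linearCode G hG s (φ.prod ψ)
  have hiff : condEntropy (linearCode N G hG s).law (fun ω => ω.1 i)
      ((linearCode N G hG s).symOn (N.incoming (N.dest i))) = 0 ↔
        Nat.card (φ.prod ψ).range = Nat.card ψ.range := by
    rw [condEntropy, sub_eq_zero]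
    refine Iff.trans (Eq.to_iff (congrArg₂ (· = ·) h2 h1)) ?_
    rw [(Real.log_injOn_pos).eq_iff (natCast_card_range_pos _) (natCast_card_range_pos _),
      Nat.cast_inj]
  rw [hiff, AddMonoidHom.card_range_prod_eq_iff]
  constructor
  · intro h w κ hX
    refine h (w, κ) (funext fun e => funext fun _ => hX e.1 ?_)
    have := e.2
    simpa [Network.incoming] using this
  · rintro h ⟨w, κ⟩ hX
    refine h w κ fun e he => ?_
    exact congrFun (congrFun hX ⟨e, by simpa [Network.incoming] using he⟩) 0

/-- Independence means that every message is compatible with the zero observation, that is, random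
packets can cancel it on the wiretapped edges. The sign of `κ` turns cancelling into matching. -/
theorem linearCode_secure_iff (G : Matrix E T F) (hG : N.Realizable G)
    (s : LinearScheme F T R ρ) (k : ℕ) :
    (linearCode N G hG s).Secure k ↔ ∀ Z : Finset E, Z.card ≤ k → ∀ w, ∃ κ, ∀ e ∈ Z,
      G e ⬝ᵥ (s.M *ᵥ w) = G e ⬝ᵥ (s.V *ᵥ κ) := by
  classical
  refine forall_congr' fun Z => imp_congr_right fun _ => ?_
  let φ : (∀ i, Fin (R i) → F) × (Fin ρ → F) →+ (∀ i, Fin (R i) → F) := AddMonoidHom.fst _ _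
  let ψ := symbolsHom G s Z
  have h0 := entropy_linearCode G hG s φ
  have h1 := entropy_linearCode G hG s ψ
  have h2 := entropy_linearCode G hG s (φ.prod ψ)
  have hiff : mutualInfo (linearCode N G hG s).law (fun ω => ω.1)
      ((linearCode N G hG s).symOn Z) = 0 ↔
        Nat.card φ.range * Nat.card ψ.range = Nat.card (φ.prod ψ).range := by
    rw [mutualInfo, sub_eq_zero]
    refine Iff.trans (Eq.to_iff (congrArg₂ (· = ·) (congrArg₂ (· + ·) h0 h1) h2)) ?_
    rw [← Real.log_mul (natCast_card_range_pos _).ne' (natCast_card_range_pos _).ne',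
      (Real.log_injOn_pos).eq_iff
        (mul_pos (natCast_card_range_pos _) (natCast_card_range_pos _)) (natCast_card_range_pos _),
      ← Nat.cast_mul, Nat.cast_inj]
  have hsym : ∀ (w : ∀ i, Fin (R i) → F) κ e, G e ⬝ᵥ s.symbols w (-κ) =
      G e ⬝ᵥ (s.M *ᵥ fun p => w p.1 p.2) - G e ⬝ᵥ (s.V *ᵥ κ) := by
    intro w κ e
    rw [LinearScheme.symbols, Matrix.mulVec_neg, ← sub_eq_add_neg, dotProduct_sub]
  rw [hiff, AddMonoidHom.card_range_prod_eq_mul_iff]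
  constructor
  · intro h w
    obtain ⟨⟨w', κ⟩, h3, h4⟩ := h (fun i j => w ⟨i, j⟩, 0)
    obtain rfl : w' = fun i j => w ⟨i, j⟩ := h3
    refine ⟨-κ, fun e he => ?_⟩
    have h5 : G e ⬝ᵥ s.symbols (fun i j => w ⟨i, j⟩) κ = 0 := congrFun (congrFun h4 ⟨e, he⟩) 0
    rw [← neg_neg κ, hsym, sub_eq_zero] at h5
    exact h5
  · rintro h ⟨w, κ⟩
    obtain ⟨κ', h'⟩ := h fun p => w p.1 p.2
    refine ⟨(w, -κ'), rfl, funext fun e => funext fun _ => ?_⟩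
    change G e.1 ⬝ᵥ s.symbols w (-κ') = 0
    rw [hsym, h' e.1 e.2, sub_self]

theorem linearCode_rate (G : Matrix E T F) (hG : N.Realizable G) (s : LinearScheme F T R ρ)
    (i : Fin m) : (linearCode N G hG s).rate i = R i := by
  let φ : (∀ i, Fin (R i) → F) × (Fin ρ → F) →+ (Fin (R i) → F) :=
    (Pi.evalAddMonoidHom _ i).comp (AddMonoidHom.fst _ _)
  have h : entropy (linearCode N G hG s).law (fun ω => ω.1 i) = Real.log (Nat.card φ.range) :=
    entropy_linearCode G hG s φ
  have hφ : φ.range = ⊤ := AddMonoidHom.range_eq_top.2 fun x =>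
    ⟨(Pi.single i x, 0), by simp [φ]⟩
  have hF : Real.log (Fintype.card F) ≠ 0 :=
    (Real.log_pos (by exact_mod_cast Fintype.one_lt_card)).ne'
  rw [Code.rate, h, hφ, AddSubgroup.card_top, Nat.card_fun]
  change Real.log ((Nat.card F ^ Nat.card (Fin (R i)) : ℕ) : ℝ) /
    ((1 : ℕ) * Real.log (Fintype.card F)) = _
  rw [Nat.card_eq_fintype_card, Nat.card_eq_fintype_card, Fintype.card_fin, Nat.cast_pow,
    Real.log_pow, Nat.cast_one, one_mul, mul_div_assoc, div_self hF, mul_one]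

end LinearCode

/-! ### Linear algebra of row spans, ranks and MDS matrices -/

section LinearAlgebra

open Matrix

theorem dotProduct_eq_zero_of_mem_span {K T : Type*} [Field K] [Fintype T] {S : Set (T → K)}
    {x v : T → K} (hv : v ∈ Submodule.span K S) (hx : ∀ g ∈ S, g ⬝ᵥ x = 0) : v ⬝ᵥ x = 0 := by
  induction hv using Submodule.span_induction with
  | mem g hg => exact hx g hg
  | zero => exact zero_dotProduct x
  | add a b _ _ ha hb => rw [add_dotProduct, ha, hb, add_zero]
  | smul a b _ hb => rw [smul_dotProduct, hb, smul_zero]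

/-- Fredholm alternative: a vector outside the range of `B` is detected by a functional that kills
`B`, hence kills `A` too. -/
theorem exists_mulVec_eq_of_vecMul {K Z P Q : Type*} [Field K] [Fintype Z] [Fintype P] [Fintype Q]
    {A : Matrix Z P K} {B : Matrix Z Q K} (h : ∀ y, y ᵥ* B = 0 → y ᵥ* A = 0) (w : P → K) :
    ∃ κ, A *ᵥ w = B *ᵥ κ := by
  classical
  by_contra! hne
  have hmem : A *ᵥ w ∉ LinearMap.range B.mulVecLin := by
    rintro ⟨κ, hκ⟩
    exact hne κ hκ.symm
  obtain ⟨f, hf, hker⟩ := Submodule.exists_le_ker_of_notMem hmem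
  let y : Z → K := fun z => f (Pi.single z 1)
  have hy : ∀ v, f v = y ⬝ᵥ v := by
    intro v
    conv_lhs => rw [pi_eq_sum_univ' v, map_sum]
    refine Finset.sum_congr rfl fun z _ => ?_
    rw [map_smul, smul_eq_mul, mul_comm]
  have hyB : y ᵥ* B = 0 := by
    ext q
    have h1 := hker ⟨Pi.single q 1, rfl⟩
    rw [LinearMap.mem_ker, hy, Matrix.mulVecLin_apply, Matrix.dotProduct_mulVec,
      dotProduct_single_one] at h1
    exact h1
  rw [hy, Matrix.dotProduct_mulVec, h y hyB, zero_dotProduct] at hf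
  exact hf rfl

theorem rank_fromCols_eq_right {K Z P Q : Type*} [Field K] [Fintype Z] [Fintype P] [Fintype Q]
    {A : Matrix Z P K} {B : Matrix Z Q K} (h : ∀ y, y ᵥ* B = 0 → y ᵥ* A = 0) :
    (Matrix.fromCols A B).rank = B.rank := by
  rw [← Matrix.rank_transpose, ← Matrix.rank_transpose B, Matrix.rank, Matrix.rank]
  have h1 := (Matrix.fromCols A B)ᵀ.mulVecLin.finrank_range_add_finrank_ker
  have h2 := Bᵀ.mulVecLin.finrank_range_add_finrank_ker
  have hker : LinearMap.ker (Matrix.fromCols A B)ᵀ.mulVecLin = LinearMap.ker Bᵀ.mulVecLin := by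
    ext y
    rw [LinearMap.mem_ker, LinearMap.mem_ker, Matrix.mulVecLin_apply, Matrix.mulVecLin_apply,
      Matrix.mulVec_transpose, Matrix.mulVec_transpose, Matrix.vecMul_fromCols]
    constructor
    · intro hy
      ext q
      exact congrFun hy (.inr q)
    · intro hy
      ext (p | q)
      · exact congrFun (h y hy) p
      · exact congrFun hy q
  rw [hker] at h1
  omega

theorem mem_span_image_finset {K E T : Type*} [Field K] (G : Matrix E T K) (Z : Finset E)
    (y : Z → K) : y ᵥ* G.submatrix (fun e : Z => e.1) id ∈ Submodule.span K (G '' Z) := by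
  rw [Matrix.vecMul_eq_sum]
  exact Submodule.sum_mem _ fun e _ => Submodule.smul_mem _ _ (Submodule.subset_span ⟨e.1, e.2, rfl⟩)

theorem span_mul_image {K E T : Type*} [Field K] [Fintype T] (G : Matrix E T K) (A : Matrix T T K)
    (S : Set E) :
    Submodule.span K ((G * A) '' S) = (Submodule.span K (G '' S)).map A.vecMulLinear := by
  rw [Submodule.map_span]
  congr 1
  exact (Set.image_image A.vecMulLinear (fun e => G e) S).symm

/-- The form to which `exists_generic_block_matrix` applies: `ker V` meets the small coordinate
subspaces trivially. Both sides are vacuous when `ρ` exceeds the number of rows. -/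
theorem isMDS_iff {K T : Type} [Field K] [Fintype T] {ρ : ℕ} (V : Matrix T (Fin ρ) K) :
    IsMDS V ↔ ∀ I : Finset T, I.card = ρ → ∀ b ∈ supportedOn K (I : Set T), b ᵥ* V = 0 → b = 0 := by
  classical
  refine forall_congr' fun I => imp_congr_right fun _ => ?_
  rw [Fintype.linearIndependent_iff]
  have hsum : ∀ b ∈ supportedOn K (I : Set T), b ᵥ* V = ∑ r : I, b r • V r := by
    intro b hb
    rw [Matrix.vecMul_eq_sum, Finset.sum_coe_sort I fun r => b r • V r]
    refine (Finset.sum_subset (Finset.subset_univ I) fun r _ hr => ?_).symm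
    rw [hb r hr, zero_smul]
  constructor
  · intro h b hb hbV
    ext r
    by_cases hr : r ∈ I
    · exact h (fun r => b r) (by rw [← hsum b hb, hbV]) ⟨r, hr⟩
    · exact hb r hr
  · intro h c hc r
    let b : T → K := fun r => if hr : r ∈ I then c ⟨r, hr⟩ else 0
    have hb : b ∈ supportedOn K (I : Set T) := fun r hr => dif_neg hr
    have hbr : ∀ r : I, b r = c r := fun r => dif_pos r.2
    rw [← hbr, h b hb]
    · rfl
    · rw [hsum b hb, ← hc]
      exact Finset.sum_congr rfl fun r _ => by rw [hbr]

theorem vecMul_injective_of_linearIndependent {K T : Type*} [Field K] [Fintype T]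
    {A : Matrix T T K} (hA : LinearIndependent K A.row) {b : T → K} (hb : b ᵥ* A = 0) : b = 0 :=
  Matrix.vecMul_injective_iff.2 hA (hb.trans (Matrix.zero_vecMul A).symm)

end LinearAlgebra

section

open Matrix

variable {V E : Type*} {m : ℕ} {N : Network V E m}

/-- Dual form of security: a combination of observed symbols from which the random packets cancel is
free of messages as well. -/
theorem secure_of_vecMul {F T : Type} [Field F] [Fintype F] [Fintype T] {R : Fin m → ℕ} {ρ : ℕ}
    (G : Matrix E T F) (hG : N.Realizable G) (s : LinearScheme F T R ρ) {k : ℕ}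
    (h : ∀ Z : Finset E, Z.card ≤ k → ∀ b ∈ Submodule.span F (G '' Z),
      b ᵥ* s.V = 0 → b ᵥ* s.M = 0) : (linearCode N G hG s).Secure k := by
  refine (linearCode_secure_iff G hG s k).2 fun Z hZ w => ?_
  let GZ := G.submatrix (fun e : Z => e.1) id
  obtain ⟨κ, hκ⟩ := exists_mulVec_eq_of_vecMul (A := GZ * s.M) (B := GZ * s.V) (fun y hy => by
    rw [← Matrix.vecMul_vecMul] at hy ⊢
    exact h Z hZ _ (mem_span_image_finset G Z y) hy) w
  refine ⟨κ, fun e he => ?_⟩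
  have := congrFun hκ ⟨e, he⟩
  rwa [← Matrix.mulVec_mulVec, ← Matrix.mulVec_mulVec] at this

theorem forwarding_dotProduct {F T : Type} [Field F] [Fintype T] {conn : Fin m → Finset T}
    (e : TwoLayerEdge T conn) (x : T → F) : forwarding F conn e ⬝ᵥ x = x e.relay := by
  classical
  rw [forwarding]
  convert single_one_dotProduct e.relay x using 2

theorem span_forwarding_le {F T : Type} [Field F] {conn : Fin m → Finset T} [DecidableEq T]
    (Z : Finset (TwoLayerEdge T conn)) : Submodule.span F (forwarding F conn '' Z) ≤
      supportedOn F ((Z.image TwoLayerEdge.relay : Finset T) : Set T) := by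
  refine Submodule.span_le.2 ?_
  rintro _ ⟨e, he, rfl⟩ r hr
  have : r ≠ e.relay := fun h => hr (by
    rw [h]
    exact_mod_cast Finset.mem_image_of_mem _ he)
  simp [forwarding, this]

/-! ### Decodability and security on the child, and decoding after multicast -/

namespace Network.Separation

variable {sep : N.Separation} {F : Type} [Field F] [Fintype F] {R : Fin m → ℕ} {ρ : ℕ}

theorem childCode_decodable_iff (s : LinearScheme F sep.ChildRelay R ρ) :
    (sep.childCode s).Decodable ↔
      ∀ i w κ, (∀ r ∈ sep.childConn i, s.symbols w κ r = 0) → w i = 0 := by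
  refine (linearCode_decodable_iff (N := sep.child) _ _ s).trans ?_
  refine forall_congr' fun i => forall_congr' fun w => forall_congr' fun κ => imp_congr_left ?_
  constructor
  · intro h r hr
    have := h (.second i r hr) rfl
    rwa [forwarding_dotProduct] at this
  · intro h e he
    rw [forwarding_dotProduct]
    cases e with
    | first r => cases he
    | second i' r hr =>
      obtain rfl : i' = i := by injection he
      exact h r hr

theorem childCode_secure_iff (s : LinearScheme F sep.ChildRelay R ρ) (k : ℕ) :
    (sep.childCode s).Secure k ↔ ∀ I : Finset sep.ChildRelay, I.card ≤ k →
      ∀ w, ∃ κ, ∀ r ∈ I, (s.M *ᵥ w) r = (s.V *ᵥ κ) r := by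
  classical
  refine (linearCode_secure_iff (N := sep.child) _ _ s k).trans ?_
  constructor
  · intro h I hI w
    obtain ⟨κ, hκ⟩ := h (I.image .first) (Finset.card_image_le.trans hI) w
    refine ⟨κ, fun r hr => ?_⟩
    have := hκ (.first r) (Finset.mem_image_of_mem _ hr)
    rwa [forwarding_dotProduct, forwarding_dotProduct] at this
  · intro h Z hZ w
    obtain ⟨κ, hκ⟩ := h (Z.image TwoLayerEdge.relay) (Finset.card_image_le.trans hZ) w
    refine ⟨κ, fun e he => ?_⟩
    rw [forwarding_dotProduct, forwarding_dotProduct]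
    exact hκ e.relay (Finset.mem_image_of_mem _ he)

theorem Multicast.code_decodable [Fintype E] (g : sep.Multicast F)
    (s : LinearScheme F sep.ChildRelay R ρ) (h : (sep.childCode s).Decodable) :
    (g.code s).Decodable := by
  classical
  rw [childCode_decodable_iff] at h
  refine (linearCode_decodable_iff g.G g.realizable s).2 fun i w κ hX => h i w κ fun r hr => ?_
  have h1 := g.receive r i (sep.mem_childConn.1 hr)
  have h2 := dotProduct_eq_zero_of_mem_span (x := s.symbols w κ) h1 (by
    rintro _ ⟨l, hl, rfl⟩
    exact hX l hl.2)
  rw [← h2]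
  convert (single_one_dotProduct r (s.symbols w κ)).symm using 2

end Network.Separation

/-! ### Encoding matrices and MDS matrices -/

theorem vandermonde_vecMul_eq_zero {K T : Type*} [Field K] [Fintype T] {x : T → K}
    (hx : Function.Injective x) {k : ℕ} {I : Finset T} (hI : I.card ≤ k) {b : T → K}
    (hb : b ∈ supportedOn K (I : Set T))
    (h : b ᵥ* (Matrix.of fun r (j : Fin k) => x r ^ (j : ℕ)) = 0) : b = 0 := by
  classical
  have h1 : ∀ j : Fin I.card, ∑ i : Fin I.card,
      b (I.equivFin.symm i) * x (I.equivFin.symm i) ^ (j : ℕ) = 0 := by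
    intro j
    have h2 := congrFun h ⟨j, j.2.trans_le hI⟩
    rw [Equiv.sum_comp I.equivFin.symm fun r : I => b r * x r ^ (j : ℕ),
      Finset.sum_coe_sort I fun r => b r * x r ^ (j : ℕ)]
    refine Eq.trans ?_ h2
    refine Finset.sum_subset (Finset.subset_univ I) fun r _ hr => ?_
    rw [hb r hr, zero_mul]
  have h3 := Matrix.eq_zero_of_forall_pow_sum_mul_pow_eq_zero
    (hx.comp (Subtype.val_injective.comp I.equivFin.symm.injective)) h1
  ext r
  by_cases hr : r ∈ I
  · have := congrFun h3 (I.equivFin ⟨r, hr⟩)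
    simpa using this
  · exact hb r hr

/-- A Vandermonde matrix has no nonzero left kernel vector on `k` coordinates. The transfer
principle with a single block and `L' = ⊥` extends this to spans of `k` rows of `G`. -/
theorem exists_mds_matrix [Fintype E] {K T : Type} [Field K] [Fintype K] [Fintype T]
    (hK : Fintype.card (Option (Bool × Finset (E ⊕ T) × Finset T)) < Fintype.card K) (k : ℕ)
    (G : Matrix E T K) :
    ∃ V' : Matrix T (Fin k) K, IsMDS V' ∧
      ∀ Z : Finset E, Z.card ≤ k → ∀ b ∈ Submodule.span K (G '' Z), b ᵥ* V' = 0 → b = 0 := by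
  classical
  have hT : Fintype.card T ≤ Fintype.card K := by
    refine le_trans ?_ hK.le
    exact Fintype.card_le_of_injective (fun t : T => some (true, (∅ : Finset (E ⊕ T)), {t}))
      fun a b h => by simpa using h
  obtain ⟨x⟩ := Function.Embedding.nonempty_of_card_le hT
  let V₀ : Matrix T (Fin k) K := Matrix.of fun r (j : Fin k) => x r ^ (j : ℕ)
  -- The unit vectors are included so that `A * V₀` is again MDS.
  let g : E ⊕ T → T → K := Sum.elim G fun r => Pi.single r 1
  obtain ⟨A, hA, -, hgen⟩ := exists_generic_block_matrix (K := K) (fun _ : T => ()) g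
    (fun z => ⟨(), fun r hr => absurd rfl hr⟩)
    (fun _ : Bool => LinearMap.ker V₀.vecMulLinear) (fun _ => ⊥) (fun _ => bot_le) (fun _ => k)
    (fun _ I hI y hy hyV => (Submodule.mem_bot K).2
      (vandermonde_vecMul_eq_zero x.injective hI hy hyV)) hK
  have key : ∀ Z : Finset (E ⊕ T), Z.card ≤ k → ∀ b ∈ Submodule.span K (g '' Z),
      b ᵥ* (A * V₀) = 0 → b = 0 := by
    intro Z hZ b hb hbV
    rw [← Matrix.vecMul_vecMul] at hbV
    exact vecMul_injective_of_linearIndependent hA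
      ((Submodule.mem_bot K).1 (hgen true Z hZ b hb hbV))
  refine ⟨A * V₀, (isMDS_iff _).2 fun I hI b hb => ?_, fun Z hZ b hb => ?_⟩
  · refine key (I.map Function.Embedding.inr) (by rw [Finset.card_map, hI]) b ?_
    refine supportedOn_le_of_single_mem (fun s hs => ?_) hb
    exact Submodule.subset_span ⟨.inr s, by simpa using hs, rfl⟩
  · refine key (Z.map Function.Embedding.inl) (by rwa [Finset.card_map]) b ?_
    refine Submodule.span_mono ?_ hb
    rintro _ ⟨e, he, rfl⟩
    exact ⟨.inl e, by simpa using he, rfl⟩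

/-! ### Extension of scalars -/

section BaseChange

variable {F K T : Type} [Field F] [Field K] [Algebra F K] {R : Fin m → ℕ} {ρ : ℕ}

/-- An `F`-linear functional `K → F` commutes with matrices over `F`, so it maps a relation over `K`
to one over `F`; such functionals separate the points of `K`. Decodability passes to `K` in the same
way. -/
theorem IsMDS.baseChange [Fintype T] {s : LinearScheme F T R ρ} (h : IsMDS s.V) :
    IsMDS (s.baseChange K).V := by
  rw [isMDS_iff] at h ⊢
  intro I hI b hb hbV
  ext r
  refine (Module.forall_dual_apply_eq_zero_iff F (b r)).1 fun φ => ?_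
  refine congrFun (h I hI (fun r => φ (b r)) (fun r hr => by
    change φ (b r) = 0
    rw [hb r hr, map_zero]) ?_) r
  ext j
  have h1 := congrArg φ (congrFun hbV j)
  rw [Matrix.vecMul, dotProduct, map_sum, Pi.zero_apply, map_zero] at h1
  refine Eq.trans ?_ h1
  refine Finset.sum_congr rfl fun r _ => ?_
  change φ (b r) * s.V r j = φ (b r * algebraMap F K (s.V r j))
  rw [← Algebra.commutes, ← Algebra.smul_def, map_smul,
    smul_eq_mul, mul_comm]

theorem LinearScheme.dual_symbols_baseChange (s : LinearScheme F T R ρ)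
    (φ : Module.Dual F K) (w : ∀ i, Fin (R i) → K) (κ : Fin ρ → K) (r : T) :
    s.symbols (fun i j => φ (w i j)) (fun j => φ (κ j)) r =
      φ ((s.baseChange K).symbols w κ r) := by
  simp only [symbols, baseChange, Pi.add_apply, map_add, Matrix.mulVec, dotProduct, map_sum,
    Matrix.map_apply, ← Algebra.smul_def, map_smul, smul_eq_mul]

/-- The packets `κ` masking a unit message on `I` have entries in `F`, so over `K` the column of `M`
still equals a combination of columns of `V` on `I`. -/
theorem LinearScheme.baseChange_vecMul [Fintype T] (s : LinearScheme F T R ρ) {I : Finset T}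
    (h : ∀ w, ∃ κ, ∀ r ∈ I, (s.M *ᵥ w) r = (s.V *ᵥ κ) r) {x : T → K}
    (hx : x ∈ supportedOn K (I : Set T)) (hxV : x ᵥ* (s.baseChange K).V = 0) :
    x ᵥ* (s.baseChange K).M = 0 := by
  classical
  ext p
  obtain ⟨κ, hκ⟩ := h (Pi.single p 1)
  have h1 : ∀ r, x r * (s.baseChange K).M r p =
      x r * ∑ j, (s.baseChange K).V r j * algebraMap F K (κ j) := by
    intro r
    by_cases hr : r ∈ I
    · have h2 := hκ r hr
      rw [Matrix.mulVec_single_one] at h2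
      congr 1
      change algebraMap F K (s.M r p) = _
      rw [show s.M r p = _ from h2, Matrix.mulVec, dotProduct, map_sum]
      simp [baseChange]
    · rw [hx r hr, zero_mul, zero_mul]
  calc (x ᵥ* (s.baseChange K).M) p
      = ∑ r, x r * ∑ j, (s.baseChange K).V r j * algebraMap F K (κ j) :=
        Finset.sum_congr rfl fun r _ => h1 r
    _ = (x ᵥ* (s.baseChange K).V) ⬝ᵥ (fun j => algebraMap F K (κ j)) := by
        rw [← Matrix.dotProduct_mulVec]
        rfl
    _ = 0 := by rw [hxV, zero_dotProduct]

end BaseChange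

/-! ### Generic precoding and the conversion from child to parent -/

namespace Network.Separation

variable {sep : N.Separation} {F K : Type} [Field F] [Fintype F] [Field K] [Fintype K]
  [Algebra F K] {R : Fin m → ℕ} {ρ k : ℕ}

theorem childCode_baseChange_decodable {s : LinearScheme F sep.ChildRelay R ρ}
    (h : (sep.childCode s).Decodable) : (sep.childCode (s.baseChange K)).Decodable := by
  rw [childCode_decodable_iff] at h ⊢
  intro i w κ hX
  ext j
  refine (Module.forall_dual_apply_eq_zero_iff F (w i j)).1 fun φ => ?_
  refine congrFun (h i (fun i j => φ (w i j)) (fun j => φ (κ j)) fun r hr => ?_) j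
  rw [s.dual_symbols_baseChange, hX r hr, map_zero]

theorem Multicast.mem_supportedOn {K : Type} [Field K] (g : sep.Multicast K) {J : Finset (Fin m)} (hJ : J.Nonempty)
    {e : E} (he : e ∈ sep.part J) :
    g.G e ∈ supportedOn K {r : sep.ChildRelay | r.1.1 = J} := fun r hr => g.support e r fun he' =>
  Set.disjoint_left.1 (sep.disjoint r.1.1 J r.1.2 hJ hr) he' he

theorem Multicast.exists_block {K : Type} [Field K] (g : sep.Multicast K) (e : E) :
    ∃ J, g.G e ∈ supportedOn K {r : sep.ChildRelay | r.1.1 = J} := by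
  by_cases h : ∃ J : Finset (Fin m), J.Nonempty ∧ e ∈ sep.part J
  · obtain ⟨J, hJ, he⟩ := h
    exact ⟨J, g.mem_supportedOn hJ he⟩
  · exact ⟨∅, fun r _ => g.support e r fun he => h ⟨_, r.1.2, he⟩⟩

/-- `A` restricts to an injective, hence surjective, endomorphism of each block, so its inverse
mixes no blocks. -/
theorem single_eq_vecMul_block {K T ι : Type*} [Field K] [Fintype T] [DecidableEq T] {τ : T → ι}
    {A : Matrix T T K} (hA : LinearIndependent K A.row)
    (hblock : ∀ r, A r ∈ supportedOn K {s | τ s = τ r}) (r : T) :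
    ∃ b ∈ supportedOn K {s | τ s = τ r}, b ᵥ* A = Pi.single r 1 := by
  let f : supportedOn K {s | τ s = τ r} →ₗ[K] supportedOn K {s | τ s = τ r} :=
    A.vecMulLinear.restrict fun b hb => vecMul_mem_block hblock hb
  have hf : Function.Injective f := by
    rw [← LinearMap.ker_eq_bot, LinearMap.ker_eq_bot']
    intro b hb
    exact Subtype.ext (vecMul_injective_of_linearIndependent hA (congrArg Subtype.val hb))
  obtain ⟨b, hb⟩ := LinearMap.injective_iff_surjective.1 hf
    ⟨Pi.single r 1, single_mem_supportedOn (S := {s | τ s = τ r}) rfl 1⟩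
  exact ⟨b.1, b.2, congrArg Subtype.val hb⟩

/-- Composition of a multicast code with an invertible block diagonal matrix. -/
noncomputable def Multicast.mulBlock [DecidableEq sep.ChildRelay] (g : sep.Multicast K)
    (A : Matrix sep.ChildRelay sep.ChildRelay K) (hA : LinearIndependent K A.row)
    (hblock : ∀ r, A r ∈ supportedOn K {s : sep.ChildRelay | s.1.1 = r.1.1}) :
    sep.Multicast K where
  G := g.G * A
  support e r he := Finset.sum_eq_zero fun s _ => by
    by_cases hs : s.1.1 = r.1.1
    · change g.G e s * A s r = 0
      rw [g.support e s (by rwa [hs]), zero_mul]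
    · change g.G e s * A s r = 0
      rw [hblock s r fun h : r.1.1 = s.1.1 => hs h.symm, mul_zero]
  relay J hJ e he hes := by
    rw [span_mul_image]
    exact Submodule.mem_map_of_mem (f := A.vecMulLinear) (g.relay J hJ e he hes)
  receive r i hi := by
    obtain ⟨b, hb, hbA⟩ := single_eq_vecMul_block (τ := fun r : sep.ChildRelay => r.1.1) hA
      hblock r
    -- `D_i` recovers every coordinate of the block under `g`, so it recovers the combination `b`
    -- that `A` maps to the symbol `r`.
    have h1 : b ∈ Submodule.span K (g.G '' {l | l ∈ sep.part r.1.1 ∧ N.head l = N.dest i}) := by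
      refine supportedOn_le_of_single_mem (fun s hs => ?_) hb
      have h2 := g.receive s i (by rwa [show s.1.1 = r.1.1 from hs])
      rw [show s.1.1 = r.1.1 from hs] at h2
      convert h2 using 1
      congr 1
      exact Subsingleton.elim _ _
    rw [span_mul_image]
    refine ⟨b, h1, hbA.trans ?_⟩
    congr 1
    exact Subsingleton.elim _ _

/-- A single `A` must handle the edges of the parent, the relays of the child and the MDS property.
The unit vectors stand for the relays, and two pairs of subspaces encode security and MDS. -/
theorem exists_precoding [Fintype E] [DecidableEq sep.ChildRelay]
    (hK : Fintype.card (Option (Bool × Finset (E ⊕ sep.ChildRelay) × Finset sep.ChildRelay)) <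
      Fintype.card K) (g : sep.Multicast K) (s : LinearScheme K sep.ChildRelay R ρ)
    (hs : ∀ I : Finset sep.ChildRelay, I.card ≤ k →
      ∀ x ∈ supportedOn K (I : Set sep.ChildRelay), x ᵥ* s.V = 0 → x ᵥ* s.M = 0) :
    ∃ A : Matrix sep.ChildRelay sep.ChildRelay K, LinearIndependent K A.row ∧
      (∀ r, A r ∈ supportedOn K {s : sep.ChildRelay | s.1.1 = r.1.1}) ∧
      (∀ Z : Finset E, Z.card ≤ k → ∀ b ∈ Submodule.span K (g.G '' Z),
        b ᵥ* A ᵥ* s.V = 0 → b ᵥ* A ᵥ* s.M = 0) ∧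
      (∀ I : Finset sep.ChildRelay, I.card ≤ k → ∀ b ∈ supportedOn K (I : Set sep.ChildRelay),
        b ᵥ* A ᵥ* s.V = 0 → b ᵥ* A ᵥ* s.M = 0) ∧
      (IsMDS s.V → IsMDS (A * s.V)) := by
  classical
  let G' : E ⊕ sep.ChildRelay → sep.ChildRelay → K := Sum.elim g.G fun r => Pi.single r 1
  have hblock : ∀ z, ∃ J, G' z ∈ supportedOn K {r : sep.ChildRelay | r.1.1 = J} := by
    rintro (e | r)
    · exact g.exists_block e
    · exact ⟨r.1.1, single_mem_supportedOn (S := {s : sep.ChildRelay | s.1.1 = r.1.1}) rfl 1⟩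
  -- With more columns than relays `IsMDS` is vacuous and does not control small supports; the bound
  -- is then set to `0`, where nothing is claimed.
  let mds : Prop := IsMDS s.V ∧ ρ ≤ Fintype.card sep.ChildRelay
  have hbase : ∀ I : Finset sep.ChildRelay, (I.card ≤ if mds then ρ else 0) →
      ∀ x ∈ supportedOn K (I : Set sep.ChildRelay), x ᵥ* s.V = 0 → x = 0 := by
    intro I hI x hx hxV
    split_ifs at hI with h
    · obtain ⟨I', hII', -, hI'⟩ := Finset.exists_subsuperset_card_eq (Finset.subset_univ I) hI
        (by simpa using h.2)
      exact (isMDS_iff _).1 h.1 I' hI' x (fun r hr => hx r fun h => hr (hII' h)) hxV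
    · obtain rfl : I = ∅ := by simpa using hI
      exact funext fun r => hx r (by simp)
  obtain ⟨A, hA, hAblock, hgen⟩ := exists_generic_block_matrix (K := K)
    (fun r : sep.ChildRelay => r.1.1) G' hblock
    -- `true` is security, `ker V` into `ker V ⊓ ker M` with bound `k`; `false` is MDS, `ker V` into
    -- `⊥`.
    (fun _ : Bool => LinearMap.ker s.V.vecMulLinear)
    (fun c => if c then LinearMap.ker s.V.vecMulLinear ⊓ LinearMap.ker s.M.vecMulLinear else ⊥)
    (fun c => by cases c <;> simp) (fun c => if c then k else if mds then ρ else 0)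
    (fun c I hI x hx hxV => by
      cases c
      · exact (Submodule.mem_bot K).2 (hbase I hI x hx hxV)
      · exact ⟨hxV, hs I hI x hx hxV⟩) hK
  have hsupp : ∀ I : Finset sep.ChildRelay, supportedOn K (I : Set sep.ChildRelay) ≤
      Submodule.span K (G' '' (I.map Function.Embedding.inr : Finset (E ⊕ sep.ChildRelay))) :=
    fun I => supportedOn_le_of_single_mem fun s hs =>
      Submodule.subset_span ⟨.inr s, by simpa using hs, rfl⟩
  refine ⟨A, hA, hAblock, fun Z hZ b hb hbV => ?_, fun I hI b hb hbV => ?_, fun hV => ?_⟩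
  · refine (hgen true (Z.map Function.Embedding.inl) (by simpa using hZ) b ?_ hbV).2
    refine Submodule.span_mono ?_ hb
    rintro _ ⟨e, he, rfl⟩
    exact ⟨.inl e, by simpa using he, rfl⟩
  · exact (hgen true (I.map Function.Embedding.inr) (by simpa using hI) b (hsupp I hb) hbV).2
  · refine (isMDS_iff _).2 fun I hI b hb hbV => ?_
    rw [← Matrix.vecMul_vecMul] at hbV
    have hmds : mds := ⟨hV, hI ▸ Finset.card_le_univ I⟩
    have := hgen false (I.map Function.Embedding.inr) (by simp [hmds, hI]) b (hsupp I hb) hbV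
    exact vecMul_injective_of_linearIndependent hA ((Submodule.mem_bot K).1 this)

/-- Here `A` is absorbed into the network code, `G * A`, and the scheme is only extended to `K`. -/
theorem exists_multicast_code_secure [Fintype E]
    (hK : Fintype.card (Option (Bool × Finset (E ⊕ sep.ChildRelay) × Finset sep.ChildRelay)) <
      Fintype.card K) (g : sep.Multicast K) {s : LinearScheme F sep.ChildRelay R ρ}
    (hdec : (sep.childCode s).Decodable) (hsec : (sep.childCode s).Secure k) :
    ∃ g' : sep.Multicast K, (g'.code (s.baseChange K)).Decodable ∧
      (g'.code (s.baseChange K)).Secure k := by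
  classical
  obtain ⟨A, hA, hblock, hZ, -, -⟩ := exists_precoding hK g (s.baseChange K) fun I hI x hx =>
    s.baseChange_vecMul ((childCode_secure_iff s k).1 hsec I hI) hx
  refine ⟨g.mulBlock A hA hblock, Multicast.code_decodable _ _ (childCode_baseChange_decodable hdec),
    secure_of_vecMul _ _ _ fun Z hZk b hb => ?_⟩
  obtain ⟨b', hb', rfl⟩ := (span_mul_image g.G A Z).le hb
  exact hZ Z hZk b' hb'

/-- Here `A` is absorbed into the scheme, so the given multicast code is kept. -/
theorem exists_scheme_secure [Fintype E]
    (hK : Fintype.card (Option (Bool × Finset (E ⊕ sep.ChildRelay) × Finset sep.ChildRelay)) <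
      Fintype.card K) (g : sep.Multicast K) {s : LinearScheme F sep.ChildRelay R ρ}
    (hdec : (sep.childCode s).Decodable) (hsec : (sep.childCode s).Secure k) :
    ∃ s' : LinearScheme K sep.ChildRelay R ρ, (IsMDS s.V → IsMDS s'.V) ∧
      (sep.childCode s').Decodable ∧ (sep.childCode s').Secure k ∧
      (g.code s').Decodable ∧ (g.code s').Secure k := by
  classical
  obtain ⟨A, hA, hblock, hZ, hI, hmds⟩ := exists_precoding hK g (s.baseChange K) fun I hI x hx =>
    s.baseChange_vecMul ((childCode_secure_iff s k).1 hsec I hI) hx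
  let s' : LinearScheme K sep.ChildRelay R ρ := ⟨A * (s.baseChange K).M, A * (s.baseChange K).V⟩
  have hsym : ∀ w κ, s'.symbols w κ = A *ᵥ (s.baseChange K).symbols w κ := by
    intro w κ
    rw [LinearScheme.symbols, LinearScheme.symbols, Matrix.mulVec_add, Matrix.mulVec_mulVec,
      Matrix.mulVec_mulVec]
  have hdec' : (sep.childCode s').Decodable := by
    have h := childCode_baseChange_decodable (K := K) hdec
    rw [childCode_decodable_iff] at h ⊢
    intro i w κ hX
    refine h i w κ fun r hr => ?_
    obtain ⟨b, hb, hbA⟩ := single_eq_vecMul_block (τ := fun r : sep.ChildRelay => r.1.1) hA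
      hblock r
    rw [← single_one_dotProduct r ((s.baseChange K).symbols w κ), ← hbA, ← Matrix.dotProduct_mulVec, ← hsym]
    refine Finset.sum_eq_zero fun q _ => ?_
    by_cases hq : q.1.1 = r.1.1
    · rw [hX q (by rw [mem_childConn, hq]; exact sep.mem_childConn.1 hr), mul_zero]
    · rw [hb q hq, zero_mul]
  refine ⟨s', fun hV => hmds hV.baseChange, hdec', ?_, g.code_decodable s' hdec', ?_⟩
  · refine secure_of_vecMul _ _ _ fun Z hZk b hb hbV => ?_
    change b ᵥ* (A * (s.baseChange K).V) = 0 at hbV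
    change b ᵥ* (A * (s.baseChange K).M) = 0
    rw [← Matrix.vecMul_vecMul] at hbV ⊢
    exact hI _ (Finset.card_image_le.trans hZk) b (span_forwarding_le Z hb) hbV
  · refine secure_of_vecMul _ _ _ fun Z hZk b hb hbV => ?_
    change b ᵥ* (A * (s.baseChange K).V) = 0 at hbV
    change b ᵥ* (A * (s.baseChange K).M) = 0
    rw [← Matrix.vecMul_vecMul] at hbV ⊢
    exact hZ Z hZk b hb hbV

end Network.Separation

end

/-! ### The secure capacity region -/

section Region

variable {V E : Type*} {m : ℕ} {N : Network V E m}

theorem Network.mem_incoming [Fintype E] (N : Network V E m) {v : V} {e : E} :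
    e ∈ N.incoming v ↔ N.head e = v := by
  simp [incoming]

namespace Code

instance isProbabilityMeasure_law (c : Code N) : IsProbabilityMeasure c.law := by
  unfold law
  infer_instance

theorem fibersMeasurable_msg (c : Code N) (i : Fin m) :
    FibersMeasurable fun ω : (∀ i, c.Msg i) × c.Rnd => ω.1 i := fun a =>
  ((measurable_pi_apply i).comp measurable_fst) (MeasurableSet.of_discrete (s := {a}))

theorem fibersMeasurable_symOn (c : Code N) (Z : Finset E) : FibersMeasurable (c.symOn Z) :=
  FibersMeasurable.pi fun e : Z => c.sym_meas e.1

theorem real_msg_preimage (c : Code N) (i : Fin m) (x : c.Msg i) :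
    c.law.real ((fun ω => ω.1 i) ⁻¹' {x}) = (c.msgLaw i).real {x} := by
  have h : (fun ω : (∀ i, c.Msg i) × c.Rnd => ω.1 i) ⁻¹' {x} =
      ((Function.eval i) ⁻¹' {x}) ×ˢ Set.univ := by
    ext ω
    simp
  rw [h, law, measureReal_prod_prod, probReal_univ, mul_one]
  exact (measurePreserving_eval c.msgLaw i).measureReal_preimage
    (MeasurableSet.of_discrete (s := {x})).nullMeasurableSet

theorem entropy_msg (c : Code N) :
    entropy c.law (fun ω => ω.1) = ∑ i, entropy c.law (fun ω => ω.1 i) := by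
  have h1 : ∀ i, ∑ x, (c.msgLaw i).real {x} = 1 := fun i => by
    rw [sum_measureReal_singleton, Finset.coe_univ, probReal_univ]
  rw [entropy_of_prod_law h1]
  · refine Finset.sum_congr rfl fun i _ => Finset.sum_congr rfl fun x _ => ?_
    rw [real_msg_preimage]
  · intro w
    have h : (fun ω : (∀ i, c.Msg i) × c.Rnd => ω.1) ⁻¹' {w} = {w} ×ˢ Set.univ := by
      ext ω
      simp
    rw [h, law, measureReal_prod_prod, probReal_univ, mul_one, measureReal_def,
      Measure.pi_singleton, ENNReal.toReal_prod]
    rfl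

theorem log_card_pos (c : Code N) : 0 < Real.log (Fintype.card c.F) :=
  Real.log_pos (by exact_mod_cast Fintype.one_lt_card)

theorem rate_nonneg (c : Code N) (i : Fin m) : 0 ≤ c.rate i :=
  div_nonneg (entropy_nonneg _) (mul_nonneg (Nat.cast_nonneg _) c.log_card_pos.le)

/-! ### The outer bound -/

/-- The symbols behind a cut are functions of the symbols on the cut. -/
theorem sym_eq_of_cut [Finite E] (c : Code N) {C : Finset E} {ω ω' : (∀ i, c.Msg i) × c.Rnd}
    (h : c.symOn C ω = c.symOn C ω') (e : E)
    (he : e ∈ C ∨ ¬ N.Reach (Set.univ \ C) N.source (N.tail e)) : c.sym e ω = c.sym e ω' := by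
  induction e using N.wellFounded_feeds.induction with
  | _ e ih =>
    rcases he with he | he
    · exact congrFun h ⟨e, he⟩
    · have hes : N.tail e ≠ N.source := fun h => he (h ▸ Relation.ReflTransGen.refl)
      obtain ⟨f, hf⟩ := c.sym_relay e hes
      rw [hf, hf]
      congr 1
      funext l
      refine ih l.1 l.2 ?_
      by_cases hl : l.1 ∈ C
      · exact .inl hl
      · refine .inr fun hreach => he ?_
        exact Relation.ReflTransGen.tail hreach ⟨l.1, ⟨trivial, hl⟩, rfl, l.2⟩

theorem symOn_incoming_eq_of_isCut [Fintype E] (c : Code N) {A : Finset (Fin m)} {C : Finset E}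
    (hC : N.IsCut Set.univ A C) {i : Fin m} (hi : i ∈ A) {ω ω' : (∀ i, c.Msg i) × c.Rnd}
    (h : c.symOn C ω = c.symOn C ω') :
    c.symOn (N.incoming (N.dest i)) ω = c.symOn (N.incoming (N.dest i)) ω' := by
  funext e
  refine c.sym_eq_of_cut h e.1 ?_
  have he : N.head e.1 = N.dest i := by simpa [Network.incoming] using e.2
  by_cases hl : e.1 ∈ C
  · exact .inl hl
  · exact .inr fun hreach => hC i hi (Relation.ReflTransGen.tail hreach
      ⟨e.1, ⟨trivial, hl⟩, rfl, he⟩)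

theorem exists_decoder [Fintype E] (c : Code N) (hdec : c.Decodable) {A : Finset (Fin m)}
    {C : Finset E} (hC : N.IsCut Set.univ A C) {i : Fin m} (hi : i ∈ A) :
    ∃ f : (C → Fin c.n → c.F) → c.Msg i, ∀ᵐ ω ∂c.law, ω.1 i = f (c.symOn C ω) := by
  classical
  obtain ⟨f, hf⟩ := exists_ae_eq_of_condEntropy_eq_zero (c.fibersMeasurable_msg i)
    (c.fibersMeasurable_symOn (N.incoming (N.dest i))) (hdec i)
  obtain ⟨g, hg⟩ : ∃ g : (C → Fin c.n → c.F) → (N.incoming (N.dest i) → Fin c.n → c.F),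
      ∀ ω, c.symOn (N.incoming (N.dest i)) ω = g (c.symOn C ω) := by
    have hfac : Function.FactorsThrough (c.symOn (N.incoming (N.dest i))) (c.symOn C) :=
      fun ω ω' h => c.symOn_incoming_eq_of_isCut hC hi h
    exact ⟨Function.extend (c.symOn C) (c.symOn (N.incoming (N.dest i))) fun _ => 0,
      fun ω => (hfac.extend_apply _ ω).symm⟩
  refine ⟨fun y => f (g y), ?_⟩
  filter_upwards [hf] with ω hω
  rw [← hg, hω]

/-- With `Z` a set of `k` edges of the cut, `H(W) + H(X_Z) = H(W, X_Z) ≤ H(W_A, X_Z) + H(W_{Aᶜ})`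
and `H(W_A, X_Z) ≤ H(X_C) ≤ H(X_Z) + H(X_{C \ Z})`. Independence of the messages leaves `H(W_A) ≤
H(X_{C \ Z})`. -/
theorem sum_entropy_le_of_isCut [Fintype E] (c : Code N) (hdec : c.Decodable) {k : ℕ}
    (hsec : c.Secure k) {A : Finset (Fin m)} {C : Finset E} (hC : N.IsCut Set.univ A C)
    (hk : k ≤ C.card) :
    ∑ i ∈ A, entropy c.law (fun ω => ω.1 i) ≤
      ((C.card : ℝ) - k) * (c.n * Real.log (Fintype.card c.F)) := by
  classical
  obtain ⟨Z, hZC, hZ⟩ := Finset.exists_subset_card_eq hk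
  have hmsg := c.fibersMeasurable_msg
  have hW : FibersMeasurable fun ω : (∀ i, c.Msg i) × c.Rnd => ω.1 := FibersMeasurable.pi hmsg
  have hsym := c.fibersMeasurable_symOn
  have hWs : ∀ B : Finset (Fin m), FibersMeasurable
      fun (ω : (∀ i, c.Msg i) × c.Rnd) (i : B) => ω.1 i :=
    fun B => FibersMeasurable.pi fun i => hmsg i.1
  have h1 : entropy c.law (fun ω => ω.1) + entropy c.law (c.symOn Z) =
      entropy c.law (fun ω => (ω.1, c.symOn Z ω)) := by
    have := hsec Z hZ.le
    rw [mutualInfo, sub_eq_zero] at this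
    convert this using 2
  have h2 : entropy c.law (fun ω => (ω.1, c.symOn Z ω)) ≤
      entropy c.law (fun ω => ((fun i : A => ω.1 i), c.symOn Z ω)) +
        entropy c.law (fun ω (i : (Aᶜ : Finset (Fin m))) => ω.1 i) := by
    refine le_trans (le_of_eq ?_) ((entropy_comp_le (((hWs A).prodMk (hsym Z)).prodMk (hWs Aᶜ))
      fun y => ((fun i => if h : i ∈ A then y.1.1 ⟨i, h⟩ else
        y.2 ⟨i, Finset.mem_compl.2 h⟩ : ∀ i, c.Msg i), y.1.2)).trans
        (entropy_prodMk_le ((hWs A).prodMk (hsym Z)) (hWs Aᶜ)))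
    congr 1
    funext ω
    refine Prod.ext (funext fun i => ?_) rfl
    by_cases h : i ∈ A <;> simp [h]
  have h3 := entropy_le_sum (μ := c.law) hmsg Aᶜ
  have h4 : entropy c.law (fun ω => ((fun i : A => ω.1 i), c.symOn Z ω)) ≤
      entropy c.law (c.symOn C) := by
    choose f hf using fun i : A => c.exists_decoder hdec hC i.2
    refine le_trans (le_of_eq (entropy_congr_ae ?_)) (entropy_comp_le (hsym C) fun y =>
      ((fun i : A => f i y), fun e : Z => y ⟨e.1, hZC e.2⟩))
    filter_upwards [ae_all_iff.2 hf] with ω hω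
    exact Prod.ext (funext hω) rfl
  have h5 : entropy c.law (c.symOn C) ≤
      entropy c.law (c.symOn Z) + entropy c.law (c.symOn (C \ Z)) := by
    refine le_trans (le_of_eq ?_) ((entropy_comp_le ((hsym Z).prodMk (hsym (C \ Z)))
      fun y (e : C) => if h : e.1 ∈ Z then y.1 ⟨e.1, h⟩ else
        y.2 ⟨e.1, Finset.mem_sdiff.2 ⟨e.2, h⟩⟩).trans
        (entropy_prodMk_le (hsym Z) (hsym (C \ Z))))
    congr 1
    funext ω e
    by_cases h : e.1 ∈ Z <;> simp [h, symOn]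
  have h6 : entropy c.law (c.symOn (C \ Z)) ≤
      ((C.card : ℝ) - k) * (c.n * Real.log (Fintype.card c.F)) := by
    refine (entropy_le_log_card (hsym (C \ Z))).trans (le_of_eq ?_)
    rw [Fintype.card_fun, Fintype.card_fun, Fintype.card_fin, Fintype.card_coe,
      Finset.card_sdiff_of_subset hZC, hZ, Nat.cast_pow, Nat.cast_pow, Real.log_pow, Real.log_pow,
      Nat.cast_sub hk]
  rw [c.entropy_msg, ← Finset.sum_add_sum_compl A] at h1
  linarith

theorem rate_mem_rateRegion [Fintype E] (c : Code N) (hdec : c.Decodable) {k : ℕ}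
    (hsec : c.Secure k) (hk : ∀ i, k ≤ N.cutCap {i}) :
    c.rate ∈ rateRegion fun A => (N.cutCap A : ℝ) - k := by
  refine ⟨c.rate_nonneg, fun A hA => ?_⟩
  obtain ⟨C, hC, hcard⟩ := N.exists_isCut Set.univ A
  obtain ⟨i, hi⟩ := hA
  -- The assumption on single destinations makes every minimum cut large enough to contain `k`
  -- wiretapped edges.
  have hkC : k ≤ C.card := by
    rw [hcard]
    exact (hk i).trans (N.minCut_mono _ (Finset.singleton_subset_iff.2 hi))
  have h := c.sum_entropy_le_of_isCut hdec hsec hC hkC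
  have hpos : (0 : ℝ) < c.n * Real.log (Fintype.card c.F) :=
    mul_pos (by exact_mod_cast c.n_pos) c.log_card_pos
  simp only [rate]
  rw [← Finset.sum_div, div_le_iff₀ hpos]
  rwa [hcard] at h

end Code

theorem isClosed_rateRegion {m : ℕ} (b : Finset (Fin m) → ℝ) : IsClosed (rateRegion b) := by
  have h : rateRegion b = (⋂ i, {R | 0 ≤ R i}) ∩
      ⋂ A : Finset (Fin m), ⋂ _ : A.Nonempty, {R | ∑ i ∈ A, R i ≤ b A} := by
    ext R
    simp [rateRegion]
  rw [h]
  refine (isClosed_iInter fun i => isClosed_le continuous_const (continuous_apply i)).inter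
    (isClosed_iInter fun A => isClosed_iInter fun _ => isClosed_le ?_ continuous_const)
  exact continuous_finsetSum _ fun i _ => continuous_apply i

theorem secureCapacityRegion_subset [Fintype E] {k : ℕ} (hk : ∀ i, k ≤ N.cutCap {i}) :
    secureCapacityRegion N k ⊆ rateRegion fun A => (N.cutCap A : ℝ) - k := by
  refine closure_minimal ?_ (isClosed_rateRegion _)
  rintro R ⟨c, hdec, hsec, hR⟩
  rw [← funext hR]
  exact c.rate_mem_rateRegion hdec hsec hk

/-! ### Codes for the replicated network -/

namespace Code

variable {L : ℕ}

/-- A code for the network with every edge replicated `L` times is a code of `L` times the block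
length for the network. -/
def ofReplicate (hL : 0 < L) (c : Code (N.replicate L)) : Code N where
  n := L * c.n
  n_pos := Nat.mul_pos hL c.n_pos
  F := c.F
  Msg := c.Msg
  Rnd := c.Rnd
  msgLaw := c.msgLaw
  rndLaw := c.rndLaw
  sym e ω j := c.sym (e, (finProdFinEquiv.symm j).1) ω (finProdFinEquiv.symm j).2
  sym_meas e x := by
    have h : (fun ω (j : Fin (L * c.n)) => c.sym (e, (finProdFinEquiv.symm j).1) ω
        (finProdFinEquiv.symm j).2) ⁻¹' {x} =
          ⋂ l, c.sym (e, l) ⁻¹' {fun t => x (finProdFinEquiv (l, t))} := by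
      ext ω
      simp only [Set.mem_preimage, Set.mem_singleton_iff, Set.mem_iInter, funext_iff]
      constructor
      · intro h l t
        rw [← h, Equiv.symm_apply_apply]
      · intro h j
        rw [h, Prod.mk.eta, Equiv.apply_symm_apply]
    rw [h]
    exact MeasurableSet.iInter fun l => c.sym_meas _ _
  sym_relay e he := by
    choose f hf using fun l => c.sym_relay (e, l) he
    refine ⟨fun y j => f (finProdFinEquiv.symm j).1
      (fun l t => y ⟨l.1.1, l.2⟩ (finProdFinEquiv (l.1.2, t))) (finProdFinEquiv.symm j).2,
      fun ω => funext fun j => ?_⟩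
    rw [hf]
    simp only [Equiv.symm_apply_apply]

theorem exists_injective_symOn_ofReplicate (hL : 0 < L) (c : Code (N.replicate L)) (Z : Finset E)
    {Z' : Finset (E × Fin L)} (hZ : ∀ e, e ∈ Z' ↔ e.1 ∈ Z) :
    ∃ f : (Z' → Fin c.n → c.F) → (Z → Fin (c.ofReplicate hL).n → (c.ofReplicate hL).F),
      Function.Injective f ∧ ∀ ω, (c.ofReplicate hL).symOn Z ω = f (c.symOn Z' ω) := by
  refine ⟨fun y e j => y ⟨(e.1, (finProdFinEquiv.symm j).1), (hZ _).2 e.2⟩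
    (finProdFinEquiv.symm j).2, fun y y' h => ?_, fun ω => rfl⟩
  funext ⟨⟨e, l⟩, hel⟩ t
  have := congrFun (congrFun h ⟨e, (hZ _).1 hel⟩) (finProdFinEquiv (l, t))
  simpa only [Equiv.symm_apply_apply] using this

theorem ofReplicate_decodable [Fintype E] (hL : 0 < L) {c : Code (N.replicate L)}
    (hdec : c.Decodable) : (c.ofReplicate hL).Decodable := by
  classical
  let _ : DecidableEq (E × Fin L) := fun a b => Classical.propDecidable (a = b)
  intro i
  obtain ⟨f, hf, hfs⟩ := c.exists_injective_symOn_ofReplicate hL (N.incoming (N.dest i))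
    (Z' := (N.replicate L).incoming ((N.replicate L).dest i)) fun e =>
      (Network.mem_incoming _).trans (N.mem_incoming).symm
  have h := hdec i
  have hY := c.fibersMeasurable_symOn ((N.replicate L).incoming ((N.replicate L).dest i))
  have h1 := entropy_comp_of_injective (μ := c.law) hY hf
  have h2 := entropy_comp_of_injective (μ := c.law) ((c.fibersMeasurable_msg i).prodMk hY)
    (f := fun x => (x.1, f x.2)) fun x y hxy => by
      rw [Prod.mk.injEq] at hxy
      exact Prod.ext hxy.1 (hf hxy.2)
  rw [condEntropy, ← h1, ← h2] at h
  rw [condEntropy, show (c.ofReplicate hL).symOn (N.incoming (N.dest i)) = _ from funext hfs]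
  exact h

/-- Wiretapping `k` edges means seeing all `L` copies of each, so the replicated code must resist `L
* k` edges. -/
theorem ofReplicate_secure (hL : 0 < L) {c : Code (N.replicate L)} {k : ℕ}
    (hsec : c.Secure (L * k)) : (c.ofReplicate hL).Secure k := by
  classical
  let _ : DecidableEq (E × Fin L) := fun a b => Classical.propDecidable (a = b)
  intro Z hZ
  obtain ⟨f, hf, hfs⟩ := c.exists_injective_symOn_ofReplicate hL Z (Z' := Z ×ˢ Finset.univ)
    (fun e => by simp)
  have h := hsec (Z ×ˢ Finset.univ) (by
    rw [Finset.card_product, Finset.card_univ, Fintype.card_fin, mul_comm]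
    exact Nat.mul_le_mul_left L hZ)
  have hY := c.fibersMeasurable_symOn (Z ×ˢ Finset.univ)
  have hW : FibersMeasurable fun ω : (∀ i, c.Msg i) × c.Rnd => ω.1 :=
    FibersMeasurable.pi c.fibersMeasurable_msg
  have h1 := entropy_comp_of_injective (μ := c.law) hY hf
  have h2 := entropy_comp_of_injective (μ := c.law) (hW.prodMk hY)
    (f := fun x => (x.1, f x.2)) fun x y hxy => by
      rw [Prod.mk.injEq] at hxy
      exact Prod.ext hxy.1 (hf hxy.2)
  rw [mutualInfo, ← h1, ← h2] at h
  rw [mutualInfo, show (c.ofReplicate hL).symOn Z = _ from funext hfs]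
  exact h

theorem ofReplicate_rate (hL : 0 < L) (c : Code (N.replicate L)) (i : Fin m) :
    (c.ofReplicate hL).rate i = c.rate i / L := by
  rw [rate, rate, div_div]
  congr 1
  change ((L * c.n : ℕ) : ℝ) * _ = _
  rw [Nat.cast_mul]
  change (L : ℝ) * c.n * Real.log (Fintype.card c.F) = _
  ring

end Code

/-! ### Achievability -/

theorem Network.Separation.exists_code [Fintype E] (sep : N.Separation) (hm : 0 < m)
    (R : Fin m → ℕ) (k : ℕ)
    (hR : ∀ A : Finset (Fin m), A.Nonempty → ∑ i ∈ A, R i + k ≤ N.cutCap A) :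
    ∃ c : Code N, c.Decodable ∧ c.Secure k ∧ ∀ i, c.rate i = R i := by
  classical
  obtain ⟨p, hp, hprime⟩ := Nat.exists_infinite_primes
    (Fintype.card (Option (Bool × Finset (E ⊕ sep.ChildRelay) × Finset sep.ChildRelay)) + 1)
  have : Fact p.Prime := ⟨hprime⟩
  have hK : Fintype.card (Option (Bool × Finset (E ⊕ sep.ChildRelay) ×
      Finset sep.ChildRelay)) < Fintype.card (ZMod p) := by
    rw [ZMod.card]
    exact hp
  obtain ⟨ρ, s, hdec, hsec⟩ := exists_secure_scheme (K := ZMod p) hm sep.childConn R k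
    (fun A hA => by
      rw [← sep.cutCap_child_eq_card, sep.cutCap_child]
      exact hR A hA)
    (lt_of_le_of_lt (Fintype.card_le_of_injective
      (fun S => some (true, (∅ : Finset (E ⊕ sep.ChildRelay)), S)) fun a b h => by
        simpa using h) hK)
  obtain ⟨g⟩ := sep.nonempty_multicast (ZMod p)
    (lt_of_le_of_lt (Fintype.card_le_of_injective
      (fun S : Finset E => some (true, (S.map Function.Embedding.inl : Finset (E ⊕ sep.ChildRelay)),
        (∅ : Finset sep.ChildRelay))) fun a b h => by simpa using h) hK)
  obtain ⟨g', h1, h2⟩ := Network.Separation.exists_multicast_code_secure hK g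
    ((Network.Separation.childCode_decodable_iff s).2 hdec)
    ((Network.Separation.childCode_secure_iff s k).2 hsec)
  exact ⟨_, h1, h2, linearCode_rate _ _ _⟩

theorem exists_code_of_isEmpty [Fintype E] (N : Network V E 0) (k : ℕ) :
    ∃ c : Code N, c.Decodable ∧ c.Secure k := by
  have : Fact (Nat.Prime 2) := ⟨Nat.prime_two⟩
  refine ⟨linearCode N (0 : Matrix E Unit (ZMod 2)) (fun e _ => Submodule.zero_mem _)
    (⟨0, 0⟩ : LinearScheme (ZMod 2) Unit (fun _ => 0) 0), fun i => i.elim0, ?_⟩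
  refine (linearCode_secure_iff _ _ _ _).2 fun Z _ w => ⟨0, fun e _ => ?_⟩
  simp

/-- The integer rates `⌊R i * L⌋₊` satisfy the bounds of the `L`-fold network against `L * k` edges.
Dividing by `L` and letting `L` grow approaches `R`. -/
theorem subset_secureCapacityRegion [Fintype E] (sep : N.Separation) (k : ℕ) :
    rateRegion (fun A => (N.cutCap A : ℝ) - k) ⊆ secureCapacityRegion N k := by
  rintro R ⟨hR0, hR⟩
  -- Without destinations no bound controls `k`, but the region is one point and any secure code
  -- attains it.
  rcases Nat.eq_zero_or_pos m with rfl | hm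
  · obtain ⟨c, hdec, hsec⟩ := exists_code_of_isEmpty N k
    exact subset_closure ⟨c, hdec, hsec, fun i => i.elim0⟩
  have hlim : Filter.Tendsto (fun (L : ℕ) i => (⌊R i * L⌋₊ : ℝ) / L) Filter.atTop (nhds R) :=
    tendsto_pi_nhds.2 fun i =>
      (tendsto_nat_floor_mul_div_atTop (hR0 i)).comp tendsto_natCast_atTop_atTop
  refine mem_closure_of_tendsto hlim ?_
  filter_upwards [Filter.eventually_gt_atTop 0] with L hL
  obtain ⟨c, hdec, hsec, hrate⟩ := (sep.replicate L).exists_code hm (fun i => ⌊R i * L⌋₊) (L * k)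
    (fun A hA => by
      rw [N.cutCap_replicate]
      have h1 : ∑ i ∈ A, (⌊R i * L⌋₊ : ℝ) ≤ (∑ i ∈ A, R i) * L := by
        rw [Finset.sum_mul]
        exact Finset.sum_le_sum fun i _ =>
          Nat.floor_le (mul_nonneg (hR0 i) (Nat.cast_nonneg L))
      have h2 : (∑ i ∈ A, R i) * L ≤ ((N.cutCap A : ℝ) - k) * L :=
        mul_le_mul_of_nonneg_right (hR A hA) (Nat.cast_nonneg L)
      have h3 : ((∑ i ∈ A, ⌊R i * L⌋₊ + L * k : ℕ) : ℝ) ≤ ((L * N.cutCap A : ℕ) : ℝ) := by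
        push_cast
        linarith
      exact_mod_cast h3)
  exact ⟨c.ofReplicate hL, Code.ofReplicate_decodable hL hdec, Code.ofReplicate_secure hL hsec,
    fun i => by rw [Code.ofReplicate_rate, hrate]⟩

theorem secureCapacityRegion_eq [Fintype E] (sep : N.Separation) {k : ℕ}
    (hk : ∀ i, k ≤ N.cutCap {i}) :
    secureCapacityRegion N k = rateRegion fun A => (N.cutCap A : ℝ) - k :=
  (secureCapacityRegion_subset hk).antisymm (subset_secureCapacityRegion sep k)

theorem secureCapacityRegion_child [Fintype E] (sep : N.Separation) {k : ℕ}
    (hk : ∀ i, k ≤ N.cutCap {i}) :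
    secureCapacityRegion sep.child k = secureCapacityRegion N k := by
  rw [secureCapacityRegion_eq sep hk, secureCapacityRegion_eq sep.childSeparation fun i => by
    rw [sep.cutCap_child]
    exact hk i]
  simp only [sep.cutCap_child]

/-! ### Protection against a single wiretapped edge -/

/-- Destinations in different components share no relay, so the relay sets counted by the child's
cut values are disjoint. -/
theorem sum_cutCap_components_le [Fintype E] (sep : N.Separation) (A : Finset (Fin m))
    [Fintype (overlapGraph sep.childConn A).ConnectedComponent]
    (comp : (overlapGraph sep.childConn A).ConnectedComponent → Finset (Fin m))
    (hcomp : ∀ C i, i ∈ comp C ↔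
      ∃ h : i ∈ A, (overlapGraph sep.childConn A).connectedComponentMk ⟨i, h⟩ = C) :
    ∑ C, N.cutCap (comp C) ≤ N.cutCap A := by
  classical
  simp only [← sep.cutCap_child, sep.cutCap_child_eq_card]
  rw [← Finset.card_biUnion]
  · refine Finset.card_le_card fun r hr => ?_
    simp only [Finset.mem_biUnion, Finset.mem_univ, true_and] at hr ⊢
    obtain ⟨C, i, hi, hri⟩ := hr
    exact ⟨i, ((hcomp C i).1 hi).1, hri⟩
  · intro C _ C' _ hne
    refine Finset.disjoint_left.2 fun r hr hr' => hne ?_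
    rw [Finset.mem_biUnion] at hr hr'
    obtain ⟨i, hi, hri⟩ := hr
    obtain ⟨j, hj, hrj⟩ := hr'
    obtain ⟨hiA, rfl⟩ := (hcomp C i).1 hi
    obtain ⟨hjA, rfl⟩ := (hcomp C' j).1 hj
    by_cases hij : i = j
    · subst hij
      rfl
    · refine SimpleGraph.ConnectedComponent.sound (SimpleGraph.Adj.reachable ?_)
      exact ⟨fun h => hij (congrArg Subtype.val h), r, hri, hrj⟩

theorem rateRegion_components_eq [Fintype E] (sep : N.Separation) :
    rateRegion (fun A => (N.cutCap A : ℝ) - numComponents sep.childConn A) =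
      rateRegion fun A => (N.cutCap A : ℝ) - (1 : ℕ) := by
  classical
  ext R
  refine and_congr_right fun _ => ⟨fun h A hA => ?_, fun h A hA => ?_⟩
  · refine (h A hA).trans (sub_le_sub_left ?_ _)
    obtain ⟨i, hi⟩ := hA
    have : Nonempty (overlapGraph sep.childConn A).ConnectedComponent :=
      ⟨(overlapGraph sep.childConn A).connectedComponentMk ⟨i, hi⟩⟩
    have hpos : 0 < numComponents sep.childConn A := Nat.card_pos
    exact_mod_cast hpos
  · have := Fintype.ofFinite (overlapGraph sep.childConn A).ConnectedComponent
    let comp : (overlapGraph sep.childConn A).ConnectedComponent → Finset (Fin m) := fun C =>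
      A.filter fun i => ∃ h : i ∈ A, (overlapGraph sep.childConn A).connectedComponentMk ⟨i, h⟩ = C
    have hcomp : ∀ C i, i ∈ comp C ↔
        ∃ h : i ∈ A, (overlapGraph sep.childConn A).connectedComponentMk ⟨i, h⟩ = C := by
      intro C i
      simp only [comp, Finset.mem_filter, and_iff_right_iff_imp]
      exact fun h => h.1
    have hne : ∀ C, (comp C).Nonempty := by
      intro C
      induction C using SimpleGraph.ConnectedComponent.ind with
      | _ v => exact ⟨v.1, (hcomp _ _).2 ⟨v.2, rfl⟩⟩
    have hsum : ∑ i ∈ A, R i = ∑ C, ∑ i ∈ comp C, R i := by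
      rw [← Finset.sum_biUnion]
      · congr 1
        ext i
        simp only [Finset.mem_biUnion, Finset.mem_univ, true_and, hcomp]
        exact ⟨fun hi => ⟨_, hi, rfl⟩, fun ⟨_, hi, _⟩ => hi⟩
      · intro C _ C' _ hCC
        refine Finset.disjoint_left.2 fun i hi hi' => hCC ?_
        obtain ⟨_, rfl⟩ := (hcomp C i).1 hi
        obtain ⟨_, rfl⟩ := (hcomp C' i).1 hi'
        rfl
    have h1 : ∑ C, ∑ i ∈ comp C, R i ≤ ∑ C, ((N.cutCap (comp C) : ℝ) - (1 : ℕ)) :=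
      Finset.sum_le_sum fun C _ => h _ (hne C)
    have h2 : (∑ C, (N.cutCap (comp C) : ℝ)) ≤ N.cutCap A := by
      exact_mod_cast sum_cutCap_components_le sep A comp hcomp
    rw [Finset.sum_sub_distrib] at h1
    simp only [Nat.cast_one, Finset.sum_const, nsmul_eq_mul, mul_one, Finset.card_univ] at h1
    have h3 : numComponents sep.childConn A =
        Fintype.card (overlapGraph sep.childConn A).ConnectedComponent := Nat.card_eq_fintype_card
    change _ ≤ (N.cutCap A : ℝ) - (numComponents sep.childConn A : ℝ)
    rw [hsum, h3]
    linarith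

end Region

theorem mainTheorem3 {V E : Type*} [Fintype E] {m : ℕ} (N : Network V E m) (sep : N.Separation)
    (k : ℕ) :
    -- the child has the same min-cut capacities as the parent
    (∀ A : Finset (Fin m), sep.child.cutCap A = N.cutCap A) ∧
    (∃ q₀ : ℕ, ∀ (K : Type) [Field K] [Fintype K], q₀ ≤ Fintype.card K →
      -- multicasting over all the subgraphs is possible
      Nonempty (sep.Multicast K) ∧
      -- multicasting preserves decodability
      (∀ (g : sep.Multicast K) (R : Fin m → ℕ) (ρ : ℕ) (s : LinearScheme K sep.ChildRelay R ρ),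
        (sep.childCode s).Decodable → (g.code s).Decodable) ∧
      -- every encoding matrix admits a suitable MDS matrix
      (∀ G : Matrix E sep.ChildRelay K, ∃ V' : Matrix sep.ChildRelay (Fin k) K, IsMDS V' ∧
        (∀ (d : ℕ) (M : Matrix sep.ChildRelay (Fin d) K) (Z : Finset E), Z.card ≤ k →
          ((Matrix.fromCols (G * M) (G * V')).submatrix (fun e : Z => e.1) id).rank =
            ((G * V').submatrix (fun e : Z => e.1) id).rank) ∧
        (∀ (hG : N.Realizable G) (R : Fin m → ℕ)
          (M : Matrix sep.ChildRelay (Σ i, Fin (R i)) K),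
          (linearCode N G hG (⟨M, V'⟩ : LinearScheme K sep.ChildRelay R k)).Secure k)) ∧
      -- every secure linear scheme on the child is converted into one on the parent
      (∀ (F : Type) [Field F] [Fintype F] [Algebra F K] (R : Fin m → ℕ) (ρ : ℕ)
        (s : LinearScheme F sep.ChildRelay R ρ),
        (sep.childCode s).Decodable → (sep.childCode s).Secure k →
          (∃ g : sep.Multicast K,
            (g.code (s.baseChange K)).Decodable ∧ (g.code (s.baseChange K)).Secure k ∧
              ∀ i, (g.code (s.baseChange K)).rate i = R i) ∧
          (∀ g : sep.Multicast K, ∃ s' : LinearScheme K sep.ChildRelay R ρ,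
            (IsMDS s.V → IsMDS s'.V) ∧
              (sep.childCode s').Decodable ∧ (sep.childCode s').Secure k ∧
              (g.code s').Decodable ∧ (g.code s').Secure k ∧
              ∀ i, (g.code s').rate i = R i))) ∧
    -- the capacity results
    ((∀ i, k ≤ N.cutCap {i}) →
      (k = 1 →
        secureCapacityRegion N k =
            rateRegion (fun A => (N.cutCap A : ℝ) - numComponents sep.childConn A) ∧
          secureCapacityRegion sep.child k = secureCapacityRegion N k) ∧
      (m = 3 →
        secureCapacityRegion N k = rateRegion (fun A => (N.cutCap A : ℝ) - k) ∧
          secureCapacityRegion sep.child k = secureCapacityRegion N k) ∧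
      ((∀ i j, i ≠ j → k ≤ (sep.childConn i ∩ sep.childConn j).card) →
        secureCapacityRegion N k = rateRegion (fun A => (N.cutCap A : ℝ) - k) ∧
          secureCapacityRegion sep.child k = secureCapacityRegion N k)) := by
  classical
  -- The threshold counts the subspaces avoided in the precoding: a condition, a set of observed
  -- rows and a set `I`, plus one for invertibility. The count for multicast embeds into it.
  refine ⟨sep.cutCap_child, ⟨Fintype.card
    (Option (Bool × Finset (E ⊕ sep.ChildRelay) × Finset sep.ChildRelay)) + 1, ?_⟩, fun hk => ?_⟩
  · intro K _ _ hK
    have hK' : Fintype.card (Option (Bool × Finset (E ⊕ sep.ChildRelay) ×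
        Finset sep.ChildRelay)) < Fintype.card K := hK
    refine ⟨sep.nonempty_multicast K (lt_of_le_of_lt (Fintype.card_le_of_injective
      (fun S : Finset E => some (true,
        (S.map Function.Embedding.inl : Finset (E ⊕ sep.ChildRelay)),
        (∅ : Finset sep.ChildRelay))) fun a b h => by simpa using h) hK'),
      fun g R ρ s h => g.code_decodable s h, fun G => ?_, ?_⟩
    · obtain ⟨V', hV', hker⟩ := exists_mds_matrix hK' k G
      refine ⟨V', hV', fun d M Z hZ => ?_, fun hG R M => ?_⟩
      · change (Matrix.fromCols ((G * M).submatrix (fun e : Z => e.1) id)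
          ((G * V').submatrix (fun e : Z => e.1) id)).rank = _
        refine rank_fromCols_eq_right fun y hy => ?_
        have h1 : ∀ {q : ℕ} (B : Matrix sep.ChildRelay (Fin q) K),
            (G * B).submatrix (fun e : Z => e.1) id = G.submatrix (fun e : Z => e.1) id * B :=
          fun B => rfl
        rw [h1, ← Matrix.vecMul_vecMul] at hy ⊢
        rw [hker Z hZ _ (mem_span_image_finset G Z y) hy, Matrix.zero_vecMul]
      · refine secure_of_vecMul G hG _ fun Z hZ b hb hbV => ?_
        rw [hker Z hZ b hb hbV, Matrix.zero_vecMul]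
    · intro F _ _ _ R ρ s hdec hsec
      refine ⟨?_, fun g => ?_⟩
      · obtain ⟨g⟩ := sep.nonempty_multicast K (lt_of_le_of_lt (Fintype.card_le_of_injective
          (fun S : Finset E => some (true,
            (S.map Function.Embedding.inl : Finset (E ⊕ sep.ChildRelay)),
            (∅ : Finset sep.ChildRelay))) fun a b h => by simpa using h) hK')
        obtain ⟨g', h1, h2⟩ := Network.Separation.exists_multicast_code_secure hK' g hdec hsec
        exact ⟨g', h1, h2, linearCode_rate _ _ _⟩
      · obtain ⟨s', h1, h2, h3, h4, h5⟩ :=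
          Network.Separation.exists_scheme_secure hK' g hdec hsec
        exact ⟨s', h1, h2, h3, h4, h5, linearCode_rate _ _ _⟩
  · refine ⟨?_, fun _ => ⟨secureCapacityRegion_eq sep hk, secureCapacityRegion_child sep hk⟩,
      fun _ => ⟨secureCapacityRegion_eq sep hk, secureCapacityRegion_child sep hk⟩⟩
    rintro rfl
    exact ⟨(secureCapacityRegion_eq sep hk).trans (rateRegion_components_eq sep).symm,
      secureCapacityRegion_child sep hk⟩
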